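/- There are a computable function $f:\mathbb{N}\to\mathbb{N}$, a constant $C$ and a single algorithm (a program for a random access machine with natural-number registers and arrays, indirect addressing, and unit-cost addition, truncated subtraction and test for zero) with the following property. Let $G=(V,E)$ be a finite simple undirected graph with $V=\{0,\dots,n-1\}$, let $k$ be the tree-width of $G$, let $s\neq t$ be vertices of $G$, and let $L\in\mathbb{N}$. Given $n$, the adjacency matrix of $G$, $s$, $t$ and $L$ as input (but neither $k$ nor a tree decomposition), the algorithm halts after at most $C\cdot n^{f(k)}$ steps and outputs the indicator matrix of a minimum $L$-bounded $s$–$t$ cut of $G$, that is, of a set $F\subseteq E$ of minimum size among all sets of edges for which every path between $s$ and $t$ in $(V,E\setminus F)$ has at least $L+1$ edges. In other words, a minimum $L$-bounded $s$–$t$ cut can be computed in time $O(n^{f(k)})$ for a computable $f$, so the problem is in $\mathsf{XP}$ when parameterized by tree-width alone. -/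

import Mathlib

namespace LBCut

/-! ## Tree-width -/

/-- A tree decomposition of `G` whose decomposition tree has the node set `Fin m`: every vertex
and every edge lies in some bag, and for every vertex `v` the nodes whose bags contain `v` induce
a subtree, that is, a nonempty connected subgraph of the tree. The choice of a root plays no role
for the width. -/
structure TreeDecomposition {V : Type*} (G : SimpleGraph V) (m : ℕ) where
  tree : SimpleGraph (Fin m)
  isTree : tree.IsTree
  bag : Fin m → Finset V
  vertex_mem : ∀ v, ∃ i, v ∈ bag i
  edge_mem : ∀ u v, G.Adj u v → ∃ i, u ∈ bag i ∧ v ∈ bag i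
  subtree : ∀ v, (tree.induce {i | v ∈ bag i}).Connected

/-- The width: the maximal size of a bag, minus one. (Truncated subtraction only matters when all
bags are empty, that is, for the graph without vertices.) -/
def TreeDecomposition.width {V : Type*} {G : SimpleGraph V} {m : ℕ}
    (D : TreeDecomposition G m) : ℕ :=
  (Finset.univ.sup fun i => (D.bag i).card) - 1

/-- The tree-width of a finite graph: the minimum width of a tree decomposition. -/
noncomputable def treeWidth {V : Type*} (G : SimpleGraph V) : ℕ :=
  sInf {w | ∃ (m : ℕ) (D : TreeDecomposition G m), D.width = w}

/-! ## Length-bounded cuts -/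

/-- `F ⊆ E(G)` is an `L`-bounded `s`–`t` cut: after deleting `F`, the shortest path between `s`
and `t` has at least `L + 1` edges (the distance is `⊤` if there is no path). -/
def IsBoundedCut {V : Type*} (G : SimpleGraph V) (s t : V) (L : ℕ) (F : Finset (Sym2 V)) : Prop :=
  (F : Set (Sym2 V)) ⊆ G.edgeSet ∧
    ((L + 1 : ℕ) : ℕ∞) ≤ (G.deleteEdges (F : Set (Sym2 V))).edist s t

/-- A minimum `L`-bounded cut: one of minimum size. -/
def IsMinBoundedCut {V : Type*} (G : SimpleGraph V) (s t : V) (L : ℕ)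
    (F : Finset (Sym2 V)) : Prop :=
  IsBoundedCut G s t L F ∧ ∀ F', IsBoundedCut G s t L F' → F.card ≤ F'.card

/-! ## Machine model

A random access machine, programmed with structured control flow. Its storage consists of
registers (numbered by `ℕ`) and arrays (numbered by `ℕ`, each indexed by `ℕ`) of natural numbers. A program
is a finite piece of text, so it names only finitely many registers and arrays; array positions
are computed at run time (indirect addressing). The only arithmetic is addition and truncated
subtraction, so unit cost per operation is polynomially equivalent to Turing machine time. -/

/-- The storage: registers and arrays of natural numbers. -/
structure State where
  reg : ℕ → ℕ
  arr : ℕ → ℕ → ℕ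

/-- Expressions: literal, register, array entry at a computed position, sum, truncated
difference. -/
inductive Expr where
  | lit (c : ℕ)
  | reg (x : ℕ)
  | entry (a : ℕ) (i : Expr)
  | plus (e₁ e₂ : Expr)
  | minus (e₁ e₂ : Expr)

/-- The value of an expression. -/
def Expr.eval (σ : State) : Expr → ℕ
  | .lit c => c
  | .reg x => σ.reg x
  | .entry a i => σ.arr a (i.eval σ)
  | .plus e₁ e₂ => e₁.eval σ + e₂.eval σ
  | .minus e₁ e₂ => e₁.eval σ - e₂.eval σ

/-- The time for evaluating an expression: one step for every operation in it. -/
def Expr.cost : Expr → ℕ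
  | .lit _ => 1
  | .reg _ => 1
  | .entry _ i => i.cost + 1
  | .plus e₁ e₂ => e₁.cost + e₂.cost + 1
  | .minus e₁ e₂ => e₁.cost + e₂.cost + 1

/-- Programs. -/
inductive Program where
  /-- do nothing -/
  | skip
  /-- `x := e` for a register `x` -/
  | assign (x : ℕ) (e : Expr)
  /-- `a[i] := e` for an array `a` -/
  | store (a : ℕ) (i e : Expr)
  /-- `p` followed by `q` -/
  | seq (p q : Program)
  /-- if `e ≠ 0` then `p` else `q` -/
  | branch (e : Expr) (p q : Program)
  /-- while `e ≠ 0` do `p` -/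
  | loop (e : Expr) (p : Program)

/-- `Runs p σ T τ`: started in the state `σ`, the program `p` halts in the state `τ` after exactly
`T` steps. -/
inductive Runs : Program → State → ℕ → State → Prop
  | skip (σ : State) : Runs .skip σ 1 σ
  | assign (σ : State) (x : ℕ) (e : Expr) :
      Runs (.assign x e) σ (e.cost + 1)
        ⟨Function.update σ.reg x (e.eval σ), σ.arr⟩
  | store (σ : State) (a : ℕ) (i e : Expr) :
      Runs (.store a i e) σ (i.cost + e.cost + 1)
        ⟨σ.reg, Function.update σ.arr a
          (Function.update (σ.arr a) (i.eval σ) (e.eval σ))⟩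
  | seq {p q : Program} {σ τ υ : State} {T₁ T₂ : ℕ} :
      Runs p σ T₁ τ → Runs q τ T₂ υ → Runs (.seq p q) σ (T₁ + T₂) υ
  | branch_true {e : Expr} {p q : Program} {σ τ : State} {T : ℕ} :
      e.eval σ ≠ 0 → Runs p σ T τ → Runs (.branch e p q) σ (e.cost + 1 + T) τ
  | branch_false {e : Expr} {p q : Program} {σ τ : State} {T : ℕ} :
      e.eval σ = 0 → Runs q σ T τ → Runs (.branch e p q) σ (e.cost + 1 + T) τ
  | loop_true {e : Expr} {p : Program} {σ τ υ : State} {T₁ T₂ : ℕ} :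
      e.eval σ ≠ 0 → Runs p σ T₁ τ → Runs (.loop e p) τ T₂ υ →
        Runs (.loop e p) σ (e.cost + 1 + T₁ + T₂) υ
  | loop_false {e : Expr} {p : Program} {σ : State} :
      e.eval σ = 0 → Runs (.loop e p) σ (e.cost + 1) σ

/-! ## Input and output -/

open Classical in
/-- The initial state for the instance `(G, s, t, L)`: registers `0, 1, 2, 3` hold `n, s, t, L`,
array `0` holds the adjacency matrix of `G` (row by row), and everything else is `0`. -/
noncomputable def inputState {n : ℕ} (G : SimpleGraph (Fin n)) (s t : Fin n) (L : ℕ) : State where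
  reg x := if x = 0 then n else if x = 1 then s else if x = 2 then t else if x = 3 then L else 0
  arr a p :=
    if a = 0 ∧ ∃ i j : Fin n, p = (i : ℕ) * n + (j : ℕ) ∧ G.Adj i j then 1 else 0

/-- The final state `τ` represents the set of edges `F`: array `1` holds (row by row) the adjacency
matrix of the graph with the edge set `F`. -/
def OutputsEdgeSet {n : ℕ} (τ : State) (F : Finset (Sym2 (Fin n))) : Prop :=
  ∀ i j : Fin n, τ.arr 1 ((i : ℕ) * n + (j : ℕ)) = if s(i, j) ∈ F then 1 else 0

end LBCut

/-! A minimum cut is turned into a labelling problem. Put D = min(L + 1, n) + 1. For a bounded cut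
F, one plus the distance from s in G − F, truncated at D − 1, is a labelling with values 1, …, D in
which s has label 1, t has label D, and the labels at the ends of every edge outside F differ by at
most one. Conversely, for any such labelling the edges whose labels differ by more than one form a
bounded cut. So the task is to minimise the number of these edges. Costs are summed over ordered
pairs, so every edge counts twice.

The minimum is found by dynamic programming without a tree decomposition. The table lists all
partial labellings with at most K labels besides those of s and t. For every component C of G minus
the labelled vertices, the least cost of the pairs meeting C is to be found. It depends only on the
labels of the neighbours of C. To find it, pick u in C, try all labels of u, forget every label
(other than those of s and t) that is not on a neighbour of C, and add up the costs of the smaller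
components into which C falls apart. The result is correct for any u (`IsBest.leastCost`); the only
obstacle is that the new labelling may need more than K labels. If all bags of some tree
decomposition have at most K vertices, there is always a good u: when the labelled neighbours of C
lie in one bag, they lie in a bag that also meets C (`exists_bag_meets`), and u is taken there
(`solvable_of_bag`). Hence K = k + 1 suffices. As k is not given, K is increased until the cost of
the whole graph comes out; an earlier success is just as correct.

The edges are found by self-reduction. Costs are measured in a subgraph H of G, while components are
always taken in G, so that solvability does not depend on H. An edge is deleted from H for good if
this lowers the optimum by two, that is, by one edge. In the end an optimal labelling of H pays for
no remaining edge, and the deleted edges are a minimum cut (`Reduced.isMinBoundedCut`).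

For the running time, programs are written with counting loops only. Their final state is a function
of the initial one (`exec`), and their time is polynomial in a common bound B on the numbers of
rounds (`runs`, `bnd_le`). Here B is about (1 + nD)^(k + 1), the size of the largest table. The only
loop of another kind is the search for K, which has at most k + 1 rounds. -/

namespace LBCut

/-! ## A language of terminating programs -/

/-- Assign a value to a register. -/
def State.setReg (σ : State) (x v : ℕ) : State := ⟨Function.update σ.reg x v, σ.arr⟩

/-- Assign a value to an array entry. -/
def State.setArr (σ : State) (a i v : ℕ) : State :=
  ⟨σ.reg, Function.update σ.arr a (Function.update (σ.arr a) i v)⟩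

@[simp] theorem State.setReg_reg (σ : State) (x v y : ℕ) :
    (σ.setReg x v).reg y = if y = x then v else σ.reg y := by
  simp [State.setReg, Function.update_apply]

@[simp] theorem State.setReg_arr (σ : State) (x v : ℕ) : (σ.setReg x v).arr = σ.arr := rfl

@[simp] theorem State.setArr_reg (σ : State) (a i v : ℕ) : (σ.setArr a i v).reg = σ.reg := rfl

@[simp] theorem State.setArr_arr (σ : State) (a i v b j : ℕ) :
    (σ.setArr a i v).arr b j = if b = a ∧ j = i then v else σ.arr b j := by
  by_cases h : b = a
  · subst h
    simp [State.setArr, Function.update_apply]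
  · simp [State.setArr, h]

/-- Commands: programs whose only loops are counting loops. -/
inductive Cmd where
  | skip
  | assign (x : ℕ) (e : Expr)
  | store (a : ℕ) (i e : Expr)
  | seq (p q : Cmd)
  | ite (e : Expr) (p q : Cmd)
  /-- run `p` with the register `x` holding `0, 1, …, r - 1`, where `r` is the value of the
  register `b` -/
  | count (x b : ℕ) (p : Cmd)

namespace Cmd

/-- Translation of commands to programs. -/
def prog : Cmd → Program
  | skip => .skip
  | assign x e => .assign x e
  | store a i e => .store a i e
  | seq p q => .seq p.prog q.prog
  | ite e p q => .branch e p.prog q.prog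
  | count x b p => .seq (.assign x (.lit 0))
      (.loop (.minus (.reg b) (.reg x)) (.seq p.prog (.assign x (.plus (.reg x) (.lit 1)))))

/-- The effect of running a step function with a register holding `0, 1, …, r - 1`. -/
def iter (f : State → State) (x : ℕ) (σ : State) : ℕ → State
  | 0 => σ
  | k + 1 => f ((iter f x σ k).setReg x k)

/-- The final state of a command. -/
def exec : Cmd → State → State
  | skip, σ => σ
  | assign x e, σ => σ.setReg x (e.eval σ)
  | store a i e, σ => σ.setArr a (i.eval σ) (e.eval σ)
  | seq p q, σ => q.exec (p.exec σ)
  | ite e p q, σ => if e.eval σ ≠ 0 then p.exec σ else q.exec σ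
  | count x b p, σ => (iter p.exec x σ (σ.reg b)).setReg x (σ.reg b)

/-- The registers that are written by a command. -/
def wregs : Cmd → List ℕ
  | skip => []
  | assign x _ => [x]
  | store _ _ _ => []
  | seq p q => p.wregs ++ q.wregs
  | ite _ p q => p.wregs ++ q.wregs
  | count x _ p => x :: p.wregs

/-- The arrays that are written by a command. -/
def warrs : Cmd → List ℕ
  | skip => []
  | assign _ _ => []
  | store a _ _ => [a]
  | seq p q => p.warrs ++ q.warrs
  | ite _ p q => p.warrs ++ q.warrs
  | count _ _ p => p.warrs

/-- The registers that bound the loops of a command. -/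
def bounds : Cmd → List ℕ
  | skip => []
  | assign _ _ => []
  | store _ _ _ => []
  | seq p q => p.bounds ++ q.bounds
  | ite _ p q => p.bounds ++ q.bounds
  | count _ b p => b :: p.bounds

/-- No loop changes its counter in its body. -/
def wf : Cmd → Bool
  | skip => true
  | assign _ _ => true
  | store _ _ _ => true
  | seq p q => p.wf && q.wf
  | ite _ p q => p.wf && q.wf
  | count x _ p => p.wf && decide (x ∉ p.wregs)

theorem exec_reg (c : Cmd) : ∀ {σ : State} {x : ℕ}, x ∉ c.wregs → (c.exec σ).reg x = σ.reg x := by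
  induction c with
  | skip => intros; rfl
  | assign x e => intro σ y h; simp_all [exec, wregs]
  | store => intros; rfl
  | seq p q hp hq => intro σ y h; simp_all [exec, wregs]
  | ite e p q hp hq => intro σ y h; simp only [exec]; split_ifs <;> simp_all [wregs]
  | count x b p hp =>
    intro σ y h
    simp only [wregs, List.mem_cons, not_or] at h
    simp only [exec, State.setReg_reg, h.1, if_false]
    generalize σ.reg b = r
    induction r with
    | zero => rfl
    | succ r ih => simp [iter, hp h.2, h.1, ih]

theorem exec_arr (c : Cmd) : ∀ {σ : State} {a : ℕ}, a ∉ c.warrs → (c.exec σ).arr a = σ.arr a := by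
  induction c with
  | skip => intros; rfl
  | assign x e => intro σ y h; simp [exec]
  | store b i e =>
    intro σ y h
    simp only [warrs, List.mem_singleton] at h
    funext j; simp [exec, h]
  | seq p q hp hq => intro σ y h; simp_all [exec, warrs]
  | ite e p q hp hq => intro σ y h; simp only [exec]; split_ifs <;> simp_all [warrs]
  | count x b p hp =>
    intro σ y h
    simp only [warrs] at h
    simp only [exec, State.setReg_arr]
    generalize σ.reg b = r
    induction r with
    | zero => rfl
    | succ r ih => simp [iter, hp h, ih]

/-- The states `σ` and `τ` differ only in what the command writes. -/
def Frame (c : Cmd) (σ τ : State) : Prop :=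
  (∀ x, x ∉ c.wregs → τ.reg x = σ.reg x) ∧ ∀ a, a ∉ c.warrs → τ.arr a = σ.arr a

theorem frame_exec (c : Cmd) (σ : State) : c.Frame σ (c.exec σ) :=
  ⟨fun _ h => c.exec_reg h, fun _ h => c.exec_arr h⟩

/-- The invariant rule for counting loops. -/
theorem exec_count {x b : ℕ} {p : Cmd} {σ : State} (I : ℕ → State → Prop) {r : ℕ}
    (hr : σ.reg b = r) (hset : ∀ k j τ, I k τ → I k (τ.setReg x j)) (h0 : I 0 σ)
    (hstep : ∀ k τ, k < r → (count x b p).Frame σ τ → τ.reg x = k → I k τ →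
      I (k + 1) (p.exec τ)) :
    I r ((count x b p).exec σ) := by
  -- The frame condition is carried along with the invariant, so that a round may use whatever the
  -- loop never writes. The hypothesis `hset` absorbs the assignments to the counter before each
  -- round and after the last one.
  have key : ∀ k, k ≤ r → (count x b p).Frame σ (iter p.exec x σ k) ∧ I k (iter p.exec x σ k) := by
    intro k
    induction k with
    | zero => intro _; exact ⟨⟨fun _ _ => rfl, fun _ _ => rfl⟩, h0⟩
    | succ k ih =>
      intro hk
      obtain ⟨⟨h1, h2⟩, h3⟩ := ih (by omega)
      have h1' : ∀ y, y ∉ (count x b p).wregs →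
          ((iter p.exec x σ k).setReg x k).reg y = σ.reg y := fun y hy => by
        rw [State.setReg_reg, if_neg (fun h => hy (by simp [wregs, h])), h1 y hy]
      refine ⟨⟨fun y hy => ?_, fun a ha => ?_⟩,
        hstep k _ (by omega) ⟨h1', h2⟩ (by simp) (hset _ _ _ h3)⟩
      · rw [← h1' y hy]
        exact exec_reg p fun h => hy (by simp [wregs, h])
      · rw [← h2 a ha]
        exact exec_arr p ha
  simp only [exec, hr]
  exact hset _ _ _ (key r le_rfl).2

/-- The rule for loops that compute a sum. -/
theorem exec_count_sum {x b f : ℕ} {p : Cmd} {σ : State} {r : ℕ} (g : Fin r → ℕ)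
    (hr : σ.reg b = r) (hxf : f ≠ x)
    (hstep : ∀ (k : Fin r) (τ : State), (count x b p).Frame σ τ → τ.reg x = k →
      (p.exec τ).reg f = τ.reg f + g k) :
    ((count x b p).exec σ).reg f = σ.reg f + ∑ k, g k := by
  have := exec_count (x := x) (p := p)
    (fun k τ => τ.reg f = σ.reg f + ∑ i ∈ Finset.range k, if h : i < r then g ⟨i, h⟩ else 0) hr
    (fun k j τ h => by simpa [hxf] using h) (by simp) (fun k τ hk hF hx h => by
      rw [hstep ⟨k, hk⟩ τ hF hx, h, Finset.sum_range_succ, dif_pos hk, add_assoc])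
  rw [this, Finset.sum_range]
  simp

/-- A bound for the running time of a command whose loops have at most `B` rounds. -/
def bnd (B : ℕ) : Cmd → ℕ
  | skip => 1
  | assign _ e => e.cost + 1
  | store _ i e => i.cost + e.cost + 1
  | seq p q => p.bnd B + q.bnd B
  | ite e p q => e.cost + 1 + p.bnd B + q.bnd B
  | count _ _ p => 6 + B * (p.bnd B + 8)

/-- Degrees and coefficients add up under composition and branching, and every nested loop raises
the degree by one. -/
theorem bnd_le (c : Cmd) : ∃ a d : ℕ, ∀ B, c.bnd B ≤ a * (B + 1) ^ d := by
  have mono : ∀ (B : ℕ) {d d' : ℕ}, d ≤ d' → (B + 1) ^ d ≤ (B + 1) ^ d' :=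
    fun B _ _ h => Nat.pow_le_pow_right (by omega) h
  have comb : ∀ p q : Cmd, (∃ a d : ℕ, ∀ B, p.bnd B ≤ a * (B + 1) ^ d) →
      (∃ a d : ℕ, ∀ B, q.bnd B ≤ a * (B + 1) ^ d) →
      ∀ e, ∃ a d : ℕ, ∀ B, e + p.bnd B + q.bnd B ≤ a * (B + 1) ^ d := by
    rintro p q ⟨a, d, h⟩ ⟨a', d', h'⟩ e
    refine ⟨e + a + a', d + d', fun B => ?_⟩
    have h1 := Nat.mul_le_mul_left a (mono B (Nat.le_add_right d d'))
    have h2 := Nat.mul_le_mul_left a' (mono B (Nat.le_add_left d' d))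
    have h3 : e ≤ e * (B + 1) ^ (d + d') := Nat.le_mul_of_pos_right _ (by positivity)
    have := h B
    have := h' B
    calc e + p.bnd B + q.bnd B ≤ e * (B + 1) ^ (d + d') + a * (B + 1) ^ (d + d')
          + a' * (B + 1) ^ (d + d') := by omega
      _ = _ := by ring
  induction c with
  | skip => exact ⟨1, 0, fun B => by simp [bnd]⟩
  | assign x e => exact ⟨e.cost + 1, 0, fun B => by simp [bnd]⟩
  | store a i e => exact ⟨i.cost + e.cost + 1, 0, fun B => by simp [bnd]⟩
  | seq p q hp hq => simpa [bnd] using comb p q hp hq 0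
  | ite e p q hp hq => simpa [bnd] using comb p q hp hq (e.cost + 1)
  | count x b p hp =>
    obtain ⟨a, d, h⟩ := hp
    -- The number 14 = 6 + 8 collects the overhead of a loop and that of one of its rounds.
    refine ⟨a + 14, d + 1, fun B => ?_⟩
    have h1 := h B
    have h2 : 1 ≤ (B + 1) ^ d := Nat.one_le_pow _ _ (by omega)
    have h3 : B * (p.bnd B + 8) ≤ B * ((a + 8) * (B + 1) ^ d) :=
      Nat.mul_le_mul_left _ (by nlinarith)
    simp only [bnd, pow_succ]
    nlinarith [Nat.zero_le (a * (B + 1) ^ d), Nat.zero_le (B * (B + 1) ^ d)]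

/-- The translation of a command terminates in the state given by `exec`, and the time is bounded
by `bnd`. -/
theorem runs (B : ℕ) (c : Cmd) : c.wf → (∀ b ∈ c.bounds, b ∉ c.wregs) →
    ∀ σ : State, (∀ b ∈ c.bounds, σ.reg b ≤ B) →
    ∃ T, T ≤ c.bnd B ∧ Runs c.prog σ T (c.exec σ) := by
  induction c with
  | skip => exact fun _ _ σ _ => ⟨1, le_rfl, .skip σ⟩
  | assign x e => exact fun _ _ σ _ => ⟨_, le_rfl, .assign σ x e⟩
  | store a i e => exact fun _ _ σ _ => ⟨_, le_rfl, .store σ a i e⟩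
  | seq p q hp hq =>
    intro hw hd σ hB
    simp only [wf, Bool.and_eq_true, bounds, wregs, List.mem_append, not_or] at hw hd hB
    obtain ⟨T₁, h₁, r₁⟩ := hp hw.1 (fun b hb => (hd b (.inl hb)).1) σ (fun b hb => hB b (.inl hb))
    obtain ⟨T₂, h₂, r₂⟩ := hq hw.2 (fun b hb => (hd b (.inr hb)).2) (p.exec σ)
      (fun b hb => by rw [exec_reg p (hd b (.inr hb)).1]; exact hB b (.inr hb))
    exact ⟨T₁ + T₂, by simp only [bnd]; omega, .seq r₁ r₂⟩
  | ite e p q hp hq =>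
    intro hw hd σ hB
    simp only [wf, Bool.and_eq_true, bounds, wregs, List.mem_append, not_or] at hw hd hB
    by_cases he : e.eval σ = 0
    · obtain ⟨T, h, r⟩ := hq hw.2 (fun b hb => (hd b (.inr hb)).2) σ (fun b hb => hB b (.inr hb))
      refine ⟨e.cost + 1 + T, by simp only [bnd]; omega, ?_⟩
      simpa [exec, prog, he] using Runs.branch_false he r
    · obtain ⟨T, h, r⟩ := hp hw.1 (fun b hb => (hd b (.inl hb)).1) σ (fun b hb => hB b (.inl hb))
      refine ⟨e.cost + 1 + T, by simp only [bnd]; omega, ?_⟩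
      simpa [exec, prog, he] using Runs.branch_true he r
  | count x b p hp =>
    intro hw hd σ hB
    simp only [wf, Bool.and_eq_true, decide_eq_true_eq, bounds, wregs, List.mem_cons, not_or,
      forall_eq_or_imp] at hw hd hB
    obtain ⟨⟨hbx, hbp⟩, hd⟩ := hd
    have hreg : ∀ y, y ≠ x → y ∉ p.wregs → ∀ k, (iter p.exec x σ k).reg y = σ.reg y := by
      intro y hyx hy k
      induction k with
      | zero => rfl
      | succ k ih => simp [iter, exec_reg p hy, hyx, ih]
    -- Induction on the number j of rounds that remain. A test of the loop condition takes 4 steps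
    -- and the increment of the counter 4 more, so every round has an overhead of 8 and the last
    -- test accounts for the 4. The initial assignment to the counter adds 2, whence the 6 in `bnd`.
    have main : ∀ j, j ≤ σ.reg b → ∃ T, T ≤ 4 + j * (p.bnd B + 8) ∧
        Runs (.loop (.minus (.reg b) (.reg x)) (.seq p.prog (.assign x (.plus (.reg x) (.lit 1)))))
          ((iter p.exec x σ (σ.reg b - j)).setReg x (σ.reg b - j)) T ((count x b p).exec σ) := by
      intro j
      induction j with
      | zero =>
        intro _
        refine ⟨4, by omega, ?_⟩
        exact Runs.loop_false (by simp [Expr.eval, hbx, hreg b hbx hbp])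
      | succ j ih =>
        intro hj
        obtain ⟨T, hT, hr⟩ := ih (by omega)
        obtain ⟨T₁, hT₁, hr₁⟩ := hp hw.1 (fun b hb => (hd b hb).2)
          ((iter p.exec x σ (σ.reg b - (j + 1))).setReg x (σ.reg b - (j + 1)))
          (fun c hc => by
            have := hB.2 c hc
            simp [(hd c hc).1, hreg c (hd c hc).1 (hd c hc).2, this])
        have e1 : σ.reg b - j = σ.reg b - (j + 1) + 1 := by omega
        have hs : (p.exec ((iter p.exec x σ (σ.reg b - (j + 1))).setReg x (σ.reg b - (j + 1)))
            ).setReg x (σ.reg b - j) =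
            (iter p.exec x σ (σ.reg b - j)).setReg x (σ.reg b - j) := by
          rw [e1]; rfl
        have ha := Runs.assign (p.exec ((iter p.exec x σ (σ.reg b - (j + 1))).setReg x
          (σ.reg b - (j + 1)))) x (.plus (.reg x) (.lit 1))
        have hv : Expr.eval (p.exec ((iter p.exec x σ (σ.reg b - (j + 1))).setReg x
          (σ.reg b - (j + 1)))) (.plus (.reg x) (.lit 1)) = σ.reg b - j := by
          simp only [Expr.eval, exec_reg p hw.2, State.setReg_reg, if_true]
          omega
        rw [hv] at ha
        change Runs _ _ _ (State.setReg _ x _) at ha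
        rw [hs] at ha
        refine ⟨_, ?_, Runs.loop_true ?_ (.seq hr₁ ha) hr⟩
        · simp only [Expr.cost]
          nlinarith
        · simp [Expr.eval, hbx, hreg b hbx hbp]
          omega
    obtain ⟨T, hT, hr⟩ := main (σ.reg b) le_rfl
    refine ⟨2 + T, ?_, ?_⟩
    · have := Nat.mul_le_mul_right (p.bnd B + 8) hB.1
      simp only [bnd]
      omega
    · refine Runs.seq (τ := σ.setReg x 0) (T₁ := 2) (Runs.assign σ x (.lit 0)) ?_
      simpa [iter] using hr

end Cmd

set_option linter.unusedSectionVars false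

/-! ## Connected sets in tree decompositions -/

/-- Two vertices of a set are joined by a walk within the set. -/
def Joined {V : Type*} (G : SimpleGraph V) (C : Set V) : V → V → Prop :=
  Relation.ReflTransGen fun x y => G.Adj x y ∧ x ∈ C ∧ y ∈ C

theorem Joined.symm {V : Type*} {G : SimpleGraph V} {C : Set V} {x y : V}
    (h : Joined G C x y) : Joined G C y x :=
  haveI : Std.Symm fun x y => G.Adj x y ∧ x ∈ C ∧ y ∈ C :=
    ⟨fun _ _ h => ⟨h.1.symm, h.2.2, h.2.1⟩⟩
  Relation.ReflTransGen.stdSymm.symm _ _ h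

theorem TreeDecomposition.exists_walk_mem_bag {V : Type*} {G : SimpleGraph V} {m : ℕ}
    (D : TreeDecomposition G m) {v : V} {i j : Fin m} (hi : v ∈ D.bag i) (hj : v ∈ D.bag j) :
    ∃ p : D.tree.Walk i j, ∀ l ∈ p.support, v ∈ D.bag l := by
  obtain ⟨w⟩ := (D.subtree v).preconnected ⟨i, hi⟩ ⟨j, hj⟩
  refine ⟨w.map (SimpleGraph.Embedding.induce _).toHom, fun l hl => ?_⟩
  replace hl : l ∈ w.support.map
      (SimpleGraph.Embedding.induce (G := D.tree) {i | v ∈ D.bag i}).toHom := by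
    rwa [← SimpleGraph.Walk.support_map]
  obtain ⟨a, -, rfl⟩ := List.mem_map.1 hl
  exact a.2

/-- Consecutive vertices of a walk within C share a bag, so their subtrees have a common node and
walks in these subtrees can be concatenated. -/
theorem TreeDecomposition.exists_walk_meets {V : Type*} {G : SimpleGraph V} {m : ℕ}
    (D : TreeDecomposition G m) {C : Set V} {x y : V} (hx : x ∈ C) (h : Joined G C x y) :
    ∀ {i j : Fin m}, x ∈ D.bag i → y ∈ D.bag j →
      ∃ p : D.tree.Walk i j, ∀ l ∈ p.support, ∃ v ∈ C, v ∈ D.bag l := by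
  induction h with
  | refl =>
    intro i j hi hj
    obtain ⟨p, hp⟩ := D.exists_walk_mem_bag hi hj
    exact ⟨p, fun l hl => ⟨x, hx, hp l hl⟩⟩
  | tail _ h ih =>
    intro i j hi hj
    obtain ⟨l, h1, h2⟩ := D.edge_mem _ _ h.1
    obtain ⟨p, hp⟩ := ih hi h1
    obtain ⟨q, hq⟩ := D.exists_walk_mem_bag h2 hj
    refine ⟨p.append q, fun l hl => ?_⟩
    rw [SimpleGraph.Walk.mem_support_append_iff] at hl
    exact hl.elim (hp l) fun hl => ⟨_, h.2.2, hq l hl⟩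

/-- If all neighbours of a connected set `C` in a set `Z` lie in one bag then they lie in one bag
that meets `C`. -/
theorem TreeDecomposition.exists_bag_meets {V : Type*} {G : SimpleGraph V} {m : ℕ}
    (D : TreeDecomposition G m) {C Z : Set V} {x₀ : V} (hx₀ : x₀ ∈ C)
    (hC : ∀ x ∈ C, ∀ y ∈ C, Joined G C x y) {j₀ : Fin m} (hZ : ∀ z ∈ Z, z ∈ D.bag j₀)
    (hN : ∀ z ∈ Z, ∃ x ∈ C, G.Adj x z) :
    ∃ j, (∀ z ∈ Z, z ∈ D.bag j) ∧ ∃ u ∈ C, u ∈ D.bag j := by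
  classical
  obtain ⟨i₀, hi₀⟩ := D.vertex_mem x₀
  -- Among the nodes whose bags meet C, the one closest to j₀ has the required property.
  obtain ⟨j, hj, hmin⟩ := Set.exists_min_image {i | ∃ u ∈ C, u ∈ D.bag i}
    (fun i => D.tree.dist j₀ i) (Set.toFinite _) ⟨i₀, x₀, hx₀, hi₀⟩
  refine ⟨j, fun z hz => ?_, hj⟩
  obtain ⟨x, hx, hxz⟩ := hN z hz
  obtain ⟨i, hxi, hzi⟩ := D.edge_mem x z hxz
  obtain ⟨p, hp, hpl⟩ := D.isTree.connected.exists_path_of_dist j₀ j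
  obtain ⟨u, hu, huj⟩ := hj
  obtain ⟨q', hq'⟩ := D.exists_walk_meets hu (hC u hu x hx) huj hxi
  obtain ⟨r, hr⟩ := D.exists_walk_mem_bag (hZ z hz) hzi
  set q := q'.bypass
  have hq : ∀ l ∈ q.support, ∃ v ∈ C, v ∈ D.bag l :=
    fun l hl => hq' l (q'.support_bypass_subset_support hl)
  have hqp : q.IsPath := q'.bypass_isPath
  -- By the choice of j, the path p from j₀ meets the nodes with bags meeting C only in its last
  -- node j. As q runs within these nodes, the two paths share nothing but j.
  have hpq : (p.append q).IsPath := by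
    rw [SimpleGraph.Walk.isPath_def, SimpleGraph.Walk.support_append]
    refine List.Nodup.append hp.support_nodup (hqp.support_nodup.sublist (List.tail_sublist _)) ?_
    intro l hl hl'
    have hlj : l ≠ j := by
      rintro rfl
      have := hqp.support_nodup
      rw [← SimpleGraph.Walk.cons_tail_support] at this
      exact (List.nodup_cons.1 this).1 hl'
    have h1 := hmin l (hq l (List.mem_of_mem_tail hl'))
    have h2 := SimpleGraph.dist_le (p.takeUntil l hl)
    have h3 := congrArg SimpleGraph.Walk.length (p.take_spec hl)
    rw [SimpleGraph.Walk.length_append] at h3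
    exact hlj (SimpleGraph.Walk.eq_of_length_eq_zero (p := p.dropUntil l hl) (by omega))
  -- Paths in a tree are unique, so the path from j₀ to i within the subtree of z passes through j
  -- as well.
  have heq : p.append q = r.bypass :=
    (D.isTree.existsUnique_path j₀ i).unique hpq r.bypass_isPath
  refine hr j (r.support_bypass_subset_support ?_)
  rw [← heq, SimpleGraph.Walk.mem_support_append_iff]
  exact .inl p.end_mem_support

/-! ## Labellings and their costs -/

section Cost

open Classical

variable {V : Type*} [Fintype V] {G H : SimpleGraph V} {s t : V} {D K M : ℕ}

/-- The cost of an ordered pair of vertices: one if it is an edge whose ends have labels that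
differ by more than one. -/
noncomputable def pairCost (H : SimpleGraph V) (d : V → ℕ) (x y : V) : ℕ :=
  if H.Adj x y ∧ 1 < (d x - d y) + (d y - d x) then 1 else 0

theorem pairCost_comm (H : SimpleGraph V) (d : V → ℕ) (x y : V) :
    pairCost H d x y = pairCost H d y x := by
  simp only [pairCost, H.adj_comm x y, add_comm]

theorem pairCost_self (H : SimpleGraph V) (d : V → ℕ) (x : V) : pairCost H d x x = 0 := by
  simp [pairCost]

/-- The total cost of the ordered pairs that meet `C`. -/
noncomputable def cost (H : SimpleGraph V) (C : Set V) (d : V → ℕ) : ℕ :=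
  ∑ x, ∑ y, if x ∈ C ∨ y ∈ C then pairCost H d x y else 0

/-- The labellings with labels `1, …, D` where `s` has the first and `t` the last label. -/
def Admissible (s t : V) (D : ℕ) (d : V → ℕ) : Prop :=
  d s = 1 ∧ d t = D ∧ ∀ v, 1 ≤ d v ∧ d v ≤ D

/-- The partial labellings with labels `1, …, D` where `s` has the first and `t` the last label;
the value `0` stands for a missing label. -/
def PartialAdmissible (s t : V) (D : ℕ) (φ : V → ℕ) : Prop :=
  φ s = 1 ∧ φ t = D ∧ ∀ v, φ v ≤ D

/-- The labelling `d` extends the partial labelling `φ`. -/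
def Extends (φ d : V → ℕ) : Prop := ∀ v, φ v ≠ 0 → d v = φ v

theorem cost_congr {C : Set V} {d d' : V → ℕ} (hC : ∀ x ∈ C, d x = d' x)
    (hN : ∀ x ∈ C, ∀ y, H.Adj x y → d y = d' y) : cost H C d = cost H C d' := by
  refine Finset.sum_congr rfl fun x _ => Finset.sum_congr rfl fun y _ => ?_
  by_cases h : x ∈ C ∨ y ∈ C
  · simp only [h, if_true, pairCost]
    by_cases ha : H.Adj x y
    · have : d x = d' x ∧ d y = d' y := by
        rcases h with h | h
        · exact ⟨hC x h, hN x h y ha⟩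
        · exact ⟨hN y h x ha.symm, hC y h⟩
      rw [this.1, this.2]
    · simp [ha]
  · simp [h]

/-- The minimal cost of `C` over all admissible extensions of `φ` is `m`. -/
def LeastCost (H : SimpleGraph V) (s t : V) (D : ℕ) (φ : V → ℕ) (C : Set V) (m : ℕ) : Prop :=
  (∃ d, Admissible s t D d ∧ Extends φ d ∧ cost H C d = m) ∧
    ∀ d, Admissible s t D d → Extends φ d → m ≤ cost H C d

/-- `R` picks a representative of every connected component of `G` minus the domain of `φ`. -/
structure IsComp (G : SimpleGraph V) (φ : V → ℕ) (R : V → V) : Prop where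
  adj : ∀ x y, φ x = 0 → φ y = 0 → G.Adj x y → R x = R y
  joined : ∀ x, φ x = 0 → Joined G {v | φ v = 0} x (R x)

/-- The component with the representative `v`. -/
def comp (φ : V → ℕ) (R : V → V) (v : V) : Set V := {x | φ x = 0 ∧ R x = v}

/-- `v` is the representative of its component. -/
def IsRep (φ : V → ℕ) (R : V → V) (v : V) : Prop := φ v = 0 ∧ R v = v

namespace IsComp

variable {φ : V → ℕ} {R : V → V}

theorem eq_of_joined (h : IsComp G φ R) {x y : V} (hxy : Joined G {v | φ v = 0} x y) :
    R x = R y := by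
  induction hxy with
  | refl => rfl
  | tail _ hb ih => rw [ih, h.adj _ _ hb.2.1 hb.2.2 hb.1]

theorem isRep (h : IsComp G φ R) {x : V} (hx : φ x = 0) : IsRep φ R (R x) := by
  have hj := h.joined x hx
  refine ⟨?_, (h.eq_of_joined hj).symm⟩
  rcases Relation.ReflTransGen.cases_tail hj with h0 | ⟨c, -, hc⟩
  · rw [h0]; exact hx
  · exact hc.2.2

theorem mem_of_joined {C : Set V} (hC : ∀ x y, G.Adj x y → x ∈ C → φ y = 0 → y ∈ C) {x y : V}
    (hxy : Joined G {v | φ v = 0} x y) (hx : x ∈ C) : y ∈ C := by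
  induction hxy with
  | refl => exact hx
  | tail _ hb ih => exact hC _ _ hb.1 ih hb.2.2

theorem rep_mem_iff (h : IsComp G φ R) {C : Set V}
    (hC : ∀ x y, G.Adj x y → x ∈ C → φ y = 0 → y ∈ C) {x : V} (hx : φ x = 0) :
    R x ∈ C ↔ x ∈ C :=
  ⟨mem_of_joined hC (h.joined x hx).symm, mem_of_joined hC (h.joined x hx)⟩

/-- Both vertices are joined to v by unlabelled vertices, and the representative is constant along
such a walk, which therefore never leaves the component. -/
theorem joined_comp (h : IsComp G φ R) {v x y : V} (hx : x ∈ comp φ R v) (hy : y ∈ comp φ R v) :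
    Joined G (comp φ R v) x y := by
  have hj : Joined G {v | φ v = 0} x y := by
    have h1 := h.joined x hx.1
    have h2 := h.joined y hy.1
    rw [hx.2] at h1
    rw [hy.2] at h2
    exact h1.trans h2.symm
  clear hy
  induction hj with
  | refl => exact .refl
  | tail hb hc ih =>
    have h1 := h.eq_of_joined hb
    have h2 := h.adj _ _ hc.2.1 hc.2.2 hc.1
    exact ih.tail ⟨hc.1, ⟨hc.2.1, h1 ▸ hx.2⟩, ⟨hc.2.2, h2 ▸ h1 ▸ hx.2⟩⟩

end IsComp

/-- The cost of the pairs with both ends in the domain of `φ` that meet `C`. -/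
noncomputable def baseCost (H : SimpleGraph V) (φ : V → ℕ) (C : Set V) : ℕ :=
  ∑ x, ∑ y, if φ x ≠ 0 ∧ φ y ≠ 0 ∧ (x ∈ C ∨ y ∈ C) then pairCost H φ x y else 0

/-- An edge with two labelled ends is counted by `baseCost`. Any other edge has an unlabelled end
and belongs to the component of that end and to no other; two unlabelled ends lie in the same
component because H is a subgraph of G. As C is closed under passing to unlabelled neighbours, such
an edge meets C exactly if the representative of its component lies in C. -/
theorem cost_eq_add_sum {φ : V → ℕ} {R : V → V} (hHG : H ≤ G) (hR : IsComp G φ R) {C : Set V}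
    (hC : ∀ x y, G.Adj x y → x ∈ C → φ y = 0 → y ∈ C) {d : V → ℕ} (hd : Extends φ d) :
    cost H C d = baseCost H φ C +
      ∑ w, if IsRep φ R w ∧ w ∈ C then cost H (comp φ R w) d else 0 := by
  have key : ∀ x y, (if x ∈ C ∨ y ∈ C then pairCost H d x y else 0) =
      (if φ x ≠ 0 ∧ φ y ≠ 0 ∧ (x ∈ C ∨ y ∈ C) then pairCost H φ x y else 0) +
      ∑ w, if IsRep φ R w ∧ w ∈ C then
        (if x ∈ comp φ R w ∨ y ∈ comp φ R w then pairCost H d x y else 0) else 0 := by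
    intro x y
    by_cases ha : H.Adj x y
    swap
    · simp [pairCost, ha]
    have single : ∀ z, φ z = 0 → (∀ w, (x ∈ comp φ R w ∨ y ∈ comp φ R w) ↔ w = R z) →
        (∑ w, if IsRep φ R w ∧ w ∈ C then
        (if x ∈ comp φ R w ∨ y ∈ comp φ R w then pairCost H d x y else 0) else 0) =
        if z ∈ C then pairCost H d x y else 0 := by
      intro z hz h
      simp only [h]
      rw [Finset.sum_eq_single (R z)]
      · simp [hR.isRep hz, hR.rep_mem_iff hC hz]
      · intro b _ hb; simp [hb]
      · simp
    by_cases hx : φ x = 0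
    · have hyC : y ∈ C → x ∈ C := fun h => hC y x (hHG ha).symm h hx
      rw [single x hx]
      · have : x ∈ C ∨ y ∈ C ↔ x ∈ C := ⟨fun h => h.elim id hyC, .inl⟩
        simp [hx, this]
      · intro w
        simp only [comp, Set.mem_ofPred_eq, hx, true_and]
        constructor
        · rintro (h | ⟨h, h'⟩)
          · exact h.symm
          · rw [hR.adj x y hx h (hHG ha), h']
        · rintro rfl; exact .inl rfl
    · by_cases hy : φ y = 0
      · have hxC : x ∈ C → y ∈ C := fun h => hC x y (hHG ha) h hy
        rw [single y hy]
        · have : x ∈ C ∨ y ∈ C ↔ y ∈ C := ⟨fun h => h.elim hxC id, .inr⟩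
          simp [hy, this]
        · intro w
          simp [comp, hx, hy, eq_comm]
      · have h1 : pairCost H d x y = pairCost H φ x y := by simp [pairCost, hd x hx, hd y hy]
        simp [comp, hx, hy, h1]
  simp only [cost, key, Finset.sum_add_distrib, baseCost]
  congr 1
  rw [Finset.sum_congr rfl fun x _ => Finset.sum_comm, Finset.sum_comm]
  refine Finset.sum_congr rfl fun w _ => ?_
  by_cases h : IsRep φ R w ∧ w ∈ C <;> simp [h]

theorem PartialAdmissible.exists_extension {φ : V → ℕ} (h : PartialAdmissible s t D φ)
    (hD : 1 ≤ D) : ∃ d, Admissible s t D d ∧ Extends φ d := by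
  obtain ⟨h1, h2, h3⟩ := h
  refine ⟨fun v => if φ v = 0 then 1 else φ v, ⟨by simp [h1], ?_, fun v => ?_⟩, fun v hv => by
    simp [hv]⟩
  · simp only [h2]; split_ifs <;> omega
  · have := h3 v
    dsimp only
    split_ifs <;> omega

/-- The minimal cost of `C` is composed of the costs within the domain of the partial labelling and
the minimal costs of the components. -/
theorem leastCost_add_sum {φ : V → ℕ} {R : V → V} (hHG : H ≤ G) (hD : 1 ≤ D)
    (hφ : PartialAdmissible s t D φ) (hR : IsComp G φ R) {C : Set V}
    (hC : ∀ x y, G.Adj x y → x ∈ C → φ y = 0 → y ∈ C) {val : V → ℕ}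
    (hval : ∀ w, IsRep φ R w → w ∈ C → LeastCost H s t D φ (comp φ R w) (val w)) :
    LeastCost H s t D φ C
      (baseCost H φ C + ∑ w, if IsRep φ R w ∧ w ∈ C then val w else 0) := by
  constructor
  · obtain ⟨d₀, hd₀, he₀⟩ := hφ.exists_extension hD
    -- Optimal extensions for the single components are glued together: a vertex x takes its label
    -- from the extension chosen for its representative. An edge that leaves a component ends in a
    -- labelled vertex, where all extensions agree, so the cost of each component is unchanged.
    have : ∀ w, ∃ d, Admissible s t D d ∧ Extends φ d ∧
        (IsRep φ R w → w ∈ C → cost H (comp φ R w) d = val w) := by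
      intro w
      by_cases h : IsRep φ R w ∧ w ∈ C
      · obtain ⟨d, h1, h2, h3⟩ := (hval w h.1 h.2).1
        exact ⟨d, h1, h2, fun _ _ => h3⟩
      · exact ⟨d₀, hd₀, he₀, fun h1 h2 => absurd ⟨h1, h2⟩ h⟩
    choose e he1 he2 he3 using this
    have hext : Extends φ fun x => e (R x) x := fun v hv => he2 _ v hv
    refine ⟨fun x => e (R x) x, ⟨(he1 _).1, (he1 _).2.1, fun v => (he1 _).2.2 v⟩, hext, ?_⟩
    rw [cost_eq_add_sum hHG hR hC hext]
    congr 1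
    refine Finset.sum_congr rfl fun w _ => ?_
    by_cases h : IsRep φ R w ∧ w ∈ C
    · rw [if_pos h, if_pos h, ← he3 w h.1 h.2]
      refine cost_congr (fun x hx => by rw [hx.2]) fun x hx y hxy => ?_
      by_cases hy : φ y = 0
      · rw [← hR.adj x y hx.1 hy (hHG hxy), hx.2]
      · rw [he2 _ y hy, he2 _ y hy]
    · rw [if_neg h, if_neg h]
  · intro d hd he
    rw [cost_eq_add_sum hHG hR hC he]
    refine Nat.add_le_add_left (Finset.sum_le_sum fun w _ => ?_) _
    by_cases h : IsRep φ R w ∧ w ∈ C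
    · rw [if_pos h, if_pos h]; exact (hval w h.1 h.2).2 d hd he
    · rw [if_neg h, if_neg h]

/-- This is the situation after labelling u in a component C: no other vertex of C is labelled, so
each pair consists of u and a labelled vertex, in either order. -/
theorem baseCost_single {φ : V → ℕ} {C : Set V} {u : V} (hu : φ u ≠ 0)
    (hC : ∀ x, φ x ≠ 0 → (x ∈ C ↔ x = u)) :
    baseCost H φ C = 2 * ∑ y, if φ y ≠ 0 then pairCost H φ u y else 0 := by
  have : ∀ x y, (if φ x ≠ 0 ∧ φ y ≠ 0 ∧ (x ∈ C ∨ y ∈ C) then pairCost H φ x y else 0) =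
      (if x = u then (if φ y ≠ 0 then pairCost H φ u y else 0) else 0) +
      (if y = u then (if φ x ≠ 0 then pairCost H φ u x else 0) else 0) := by
    intro x y
    by_cases hxu : x = u
    · subst hxu
      by_cases hyx : y = x
      · subst hyx; simp [pairCost_self]
      · by_cases hy : φ y = 0
        · simp [hyx, hy]
        · simp [hyx, hy, hu, (hC x hu).2 rfl]
    · by_cases hyu : y = u
      · subst hyu
        by_cases hx : φ x = 0
        · simp [hxu, hx]
        · simp [hxu, hx, hu, (hC y hu).2 rfl, pairCost_comm H φ y x]
      · by_cases hx : φ x = 0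
        · simp [hxu, hyu, hx]
        · by_cases hy : φ y = 0
          · simp [hxu, hyu, hy]
          · simp [hxu, hyu, hC x hx, hC y hy]
  simp only [baseCost, this, Finset.sum_add_distrib]
  rw [Finset.sum_comm]
  simp [two_mul]

theorem baseCost_pair {φ : V → ℕ} (hst : s ≠ t) (hφ : ∀ x, φ x ≠ 0 ↔ x = s ∨ x = t) :
    baseCost H φ Set.univ = 2 * pairCost H φ s t := by
  obtain ⟨C, hC⟩ : ∃ C : Set V, C = Set.univ := ⟨_, rfl⟩
  rw [← hC]
  have : ∀ x y, (if φ x ≠ 0 ∧ φ y ≠ 0 ∧ (x ∈ C ∨ y ∈ C)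
      then pairCost H φ x y else 0) =
      (if x = s then (if y = t then pairCost H φ s t else 0) else 0) +
      (if x = t then (if y = s then pairCost H φ s t else 0) else 0) := by
    intro x y
    simp only [hC, hφ, Set.mem_univ, or_self, and_true]
    by_cases hxs : x = s
    · subst hxs
      by_cases hyt : y = t
      · subst hyt; simp [hst]
      · by_cases hyx : y = x
        · subst hyx; simp [hst, pairCost_self]
        · simp [hyt, hyx]
    · by_cases hxt : x = t
      · subst hxt
        by_cases hys : y = s
        · subst hys; simp [hxs, pairCost_comm H φ x y]
        · by_cases hyx : y = x
          · subst hyx; simp [pairCost_self, hxs]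
          · simp [hys, hyx]
      · simp [hxs, hxt]
  rw [baseCost, Finset.sum_congr rfl fun x _ => Finset.sum_congr rfl fun y _ => this x y]
  simp [Finset.sum_add_distrib, two_mul]

end Cost

/-! ## Dynamic programming over partial labellings -/

section Table

open Classical

variable {V : Type*} [Fintype V] {G H : SimpleGraph V} {s t : V} {D K M : ℕ}
  {φ : ℕ → V → ℕ} {R : ℕ → V → V}

/-- The number of labels of `ψ` besides those of `s` and `t`. -/
noncomputable def numLabelled (s t : V) (ψ : V → ℕ) : ℕ :=
  {v | (v ≠ s ∧ v ≠ t) ∧ ψ v ≠ 0}.ncard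

/-- `φ` lists (as `φ 0, …, φ (M - 1)`) the partial labellings with at most `K` labels besides
those of `s` and `t`, and begins with the one that labels only `s` and `t`. -/
structure IsTable (s t : V) (D K M : ℕ) (φ : ℕ → V → ℕ) : Prop where
  pos : 0 < M
  partialAdmissible : ∀ c < M, PartialAdmissible s t D (φ c)
  numLabelled_le : ∀ c < M, numLabelled s t (φ c) ≤ K
  exists_eq : ∀ ψ : V → ℕ, PartialAdmissible s t D ψ →
    numLabelled s t ψ ≤ K → ∃ c < M, φ c = ψ
  zero_ne : ∀ v, φ 0 v ≠ 0 ↔ v = s ∨ v = t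

/-- The partial labelling `ψ` restricted to `s`, `t` and the neighbours of `C`. -/
noncomputable def boundary (G : SimpleGraph V) (s t : V) (ψ : V → ℕ) (C : Set V) (y : V) : ℕ :=
  if (∃ x ∈ C, G.Adj x y) ∨ y = s ∨ y = t then ψ y else 0

/-- `ψ'` consists of the labels of `ψ` on `s`, `t` and the neighbours of `C`, and a label of
`u`. -/
def Matches (G : SimpleGraph V) (s t : V) (ψ : V → ℕ) (C : Set V) (u : V) (ψ' : V → ℕ) : Prop :=
  ψ' u ≠ 0 ∧ ∀ y, y ≠ u → ψ' y = boundary G s t ψ C y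

/-- One plus the cost of `C` that results from labelling `u` according to `ψ`, where
`w c - 1` is the cost of a component with the representative `c`. -/
noncomputable def candidate (H : SimpleGraph V) (ψ : V → ℕ) (r : V → V) (C : Set V) (u : V)
    (w : V → ℕ) : ℕ :=
  1 + 2 * (∑ y, if ψ y ≠ 0 then pairCost H ψ u y else 0) +
    ∑ x, if IsRep ψ r x ∧ x ∈ C then w x - 1 else 0

variable (G s t M φ R) in
/-- The costs needed for labelling `u` in the component of `v` are known. -/
def Known (W : ℕ → V → ℕ) (c : ℕ) (v u : V) : Prop :=
  ∀ c' < M, Matches G s t (φ c) (comp (φ c) (R c) v) u (φ c') →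
    ∀ w, IsRep (φ c') (R c') w → w ∈ comp (φ c) (R c) v → W c' w ≠ 0

variable (G H s t M φ R) in
/-- `b` is the least candidate for labelling `u` in the component of `v`. -/
def IsBest (W : ℕ → V → ℕ) (c : ℕ) (v u : V) (b : ℕ) : Prop :=
  (∃ c' < M, Matches G s t (φ c) (comp (φ c) (R c) v) u (φ c') ∧
    candidate H (φ c') (R c') (comp (φ c) (R c) v) u (W c') = b) ∧
  ∀ c' < M, Matches G s t (φ c) (comp (φ c) (R c) v) u (φ c') →
    b ≤ candidate H (φ c') (R c') (comp (φ c) (R c) v) u (W c')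

variable (G s t M φ R) in
/-- The minimal cost of a component can be computed by repeatedly labelling a vertex and forgetting
all labels of vertices that are not adjacent to the component. -/
inductive Solvable : ℕ → V → Prop
  | intro (c : ℕ) (v u : V) : u ∈ comp (φ c) (R c) v →
      (∃ c' < M, Matches G s t (φ c) (comp (φ c) (R c) v) u (φ c')) →
      (∀ c' < M, Matches G s t (φ c) (comp (φ c) (R c) v) u (φ c') →
        ∀ w, IsRep (φ c') (R c') w → w ∈ comp (φ c) (R c) v → Solvable c' w) →
      Solvable c v

variable (G H s t D M φ R) in
/-- The values of `W` are correct where they are known. -/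
def Sound (W : ℕ → V → ℕ) : Prop :=
  ∀ c < M, ∀ v, IsRep (φ c) (R c) v → W c v ≠ 0 →
    LeastCost H s t D (φ c) (comp (φ c) (R c) v) (W c v - 1) ∧ Solvable G s t M φ R c v

theorem IsComp.mem_comp_of_adj {ψ : V → ℕ} {r : V → V} (h : IsComp G ψ r) {v x y : V}
    (hx : x ∈ comp ψ r v) (hxy : G.Adj x y) (hy : ψ y = 0) : y ∈ comp ψ r v :=
  ⟨hy, (h.adj x y hx.1 hy hxy).symm.trans hx.2⟩

/-- The new labelling keeps all old labels of neighbours of C, so a neighbour that is unlabelled now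
was unlabelled before and lies in C. Thus C is closed in the sense needed for splitting its cost
into the costs of the new components. -/
theorem Matches.mem_of_adj {ψ ψ' : V → ℕ} {r : V → V} (h : IsComp G ψ r) {v u : V}
    (hm : Matches G s t ψ (comp ψ r v) u ψ') {x y : V} (hxy : G.Adj x y)
    (hx : x ∈ comp ψ r v) (hy : ψ' y = 0) : y ∈ comp ψ r v := by
  by_contra hyC
  have hψ : ψ y ≠ 0 := fun h0 => hyC (h.mem_comp_of_adj hx hxy h0)
  have hyu : y ≠ u := fun h0 => hm.1 (h0 ▸ hy)
  rw [hm.2 y hyu, boundary, if_pos (.inl ⟨x, hx, hxy⟩)] at hy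
  exact hψ hy

theorem Matches.dom_mem {ψ ψ' : V → ℕ} {r : V → V} {v u : V}
    (hm : Matches G s t ψ (comp ψ r v) u ψ') (hu : u ∈ comp ψ r v) {x : V} (hx : ψ' x ≠ 0) :
    x ∈ comp ψ r v ↔ x = u := by
  refine ⟨fun hxC => ?_, fun h => h ▸ hu⟩
  by_contra hxu
  rw [hm.2 x hxu, boundary] at hx
  split_ifs at hx
  · exact hx hxC.1
  · exact hx rfl

/-- The components of a refined partial labelling that meet the component are smaller. -/
theorem Matches.comp_ssubset {ψ ψ' : V → ℕ} {r r' : V → V} (h : IsComp G ψ r)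
    (h' : IsComp G ψ' r') {v u w : V} (hm : Matches G s t ψ (comp ψ r v) u ψ')
    (hu : u ∈ comp ψ r v) (hw : w ∈ comp ψ r v) :
    comp ψ' r' w ⊂ comp ψ r v := by
  refine (Set.ssubset_iff_of_subset fun x hx => ?_).2 ⟨u, hu, fun h => hm.1 h.1⟩
  exact (h'.rep_mem_iff (fun x y hxy hx hy => hm.mem_of_adj h hxy hx hy) hx.1).1 (hx.2 ▸ hw)

/-- Known costs of smaller components give the cost of a component. -/
theorem IsBest.leastCost (hHG : H ≤ G) (hD : 1 ≤ D) (hT : IsTable s t D K M φ)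
    (hR : ∀ c < M, IsComp G (φ c) (R c)) {W : ℕ → V → ℕ} (hW : Sound G H s t D M φ R W)
    {c : ℕ} (hc : c < M) {v u : V} (hu : u ∈ comp (φ c) (R c) v)
    (hK : Known G s t M φ R W c v u) {b : ℕ} (hb : IsBest G H s t M φ R W c v u b) :
    b ≠ 0 ∧ LeastCost H s t D (φ c) (comp (φ c) (R c) v) (b - 1) := by
  unfold Known at hK
  unfold IsBest at hb
  set C := comp (φ c) (R c) v with hCdef
  have hadm := hT.partialAdmissible c hc
  have hsC : s ∉ C := fun h => by have := h.1; rw [hadm.1] at this; omega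
  have htC : t ∉ C := fun h => by have := h.1; rw [hadm.2.1] at this; omega
  have hus : u ≠ s := fun h => hsC (h ▸ hu)
  have hut : u ≠ t := fun h => htC (h ▸ hu)
  -- For a fixed label of u, the candidate is one plus the least cost of C over all extensions of
  -- the new partial labelling.
  have val : ∀ c' < M, Matches G s t (φ c) C u (φ c') →
      LeastCost H s t D (φ c') C (candidate H (φ c') (R c') C u (W c') - 1) := by
    intro c' hc' hm
    have := leastCost_add_sum hHG hD (hT.partialAdmissible c' hc') (hR c' hc') (C := C)
      (fun x y hxy hx hy => hm.mem_of_adj (hR c hc) hxy hx hy) (val := fun w => W c' w - 1)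
      (fun w hw hwC => (hW c' hc' w hw (hK c' hc' hm w hw hwC)).1)
    rw [baseCost_single hm.1 fun x hx => hm.dom_mem hu hx] at this
    convert this using 1
    simp only [candidate]
    omega
  obtain ⟨⟨c₁, hc₁, hm₁, hb₁⟩, hmin⟩ := hb
  have hpos : ∀ c', 1 ≤ candidate H (φ c') (R c') C u (W c') := by
    intro c'; simp only [candidate]; omega
  refine ⟨by have := hpos c₁; omega, ?_, ?_⟩
  · obtain ⟨d, hd, he, hcost⟩ := (val c₁ hc₁ hm₁).1
    obtain ⟨d₀, hd₀, he₀⟩ := hadm.exists_extension hD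
    -- The optimal d extends a labelling in which labels away from C were forgotten, so it may
    -- contradict φ c there. It is used on C only and replaced elsewhere by an extension of φ c; the
    -- cost of C does not notice, since both agree on the neighbours of C outside C.
    have hext : Extends (φ c) fun x => if x ∈ C then d x else d₀ x := by
      intro x hx
      have : x ∉ C := fun h => hx h.1
      simp [this, he₀ x hx]
    refine ⟨_, ⟨by simp [hsC, hd₀.1], by simp [htC, hd₀.2.1], fun x => ?_⟩, hext, ?_⟩
    · split_ifs
      · exact hd.2.2 x
      · exact hd₀.2.2 x
    · rw [← hb₁, ← hcost]
      refine cost_congr (fun x hx => by simp [hx]) fun x hx y hxy => ?_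
      by_cases hy : y ∈ C
      · simp [hy]
      · have hφy : φ c y ≠ 0 := fun h0 => hy ((hR c hc).mem_comp_of_adj hx (hHG hxy) h0)
        have hyu : y ≠ u := fun h => hy (h ▸ hu)
        have h1 : φ c₁ y = φ c y := by
          rw [hm₁.2 y hyu, boundary, if_pos (.inl ⟨x, hx, hHG hxy⟩)]
        simp only [hy, if_false]
        rw [he₀ y hφy, he y (h1 ▸ hφy), h1]
  · intro d hd he
    have hψ : PartialAdmissible s t D
        (fun y => if y = u then d u else boundary G s t (φ c) C y) := by
      refine ⟨by simp [hus.symm, boundary, hadm.1], by simp [hut.symm, boundary, hadm.2.1],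
        fun y => ?_⟩
      simp only [boundary]
      split_ifs
      · exact (hd.2.2 u).2
      · exact hadm.2.2 y
      · exact Nat.zero_le _
    -- The refinement that gives u its label in d is in the table because it labels no vertex that φ
    -- c₁, one refinement known to be in the table, leaves unlabelled. So a single refinement in the
    -- table guarantees that those for all labels of u are there.
    obtain ⟨c', hc', hφ'⟩ := hT.exists_eq _ hψ (le_trans (Set.ncard_le_ncard (fun y => by
      rintro ⟨h1, h2⟩
      refine ⟨h1, ?_⟩
      by_cases hy : y = u
      · exact hy ▸ hm₁.1
      · rw [hm₁.2 y hy]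
        simpa [hy] using h2) (Set.toFinite _)) (hT.numLabelled_le c₁ hc₁))
    have hdu := (hd.2.2 u).1
    have hm' : Matches G s t (φ c) C u (φ c') := by
      rw [hφ']
      exact ⟨by simp; omega, fun y hy => by simp [hy]⟩
    have he' : Extends (φ c') d := by
      rw [hφ']
      intro y hy
      by_cases hyu : y = u
      · simp [hyu]
      · simp only [hyu, if_false, boundary] at hy ⊢
        split_ifs at hy ⊢
        · exact he y hy
        · exact absurd rfl hy
    have h1 := (val c' hc' hm').2 d hd he'
    have h2 := hmin c' hc' hm'
    omega

/-- Entering a value for labelling `u` keeps the table of costs correct. -/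
theorem Sound.update (hHG : H ≤ G) (hD : 1 ≤ D) (hT : IsTable s t D K M φ)
    (hR : ∀ c < M, IsComp G (φ c) (R c)) {W W' : ℕ → V → ℕ} (hW : Sound G H s t D M φ R W)
    {c : ℕ} (hc : c < M) {v u : V} (hu : u ∈ comp (φ c) (R c) v)
    (hK : Known G s t M φ R W c v u) (hb : IsBest G H s t M φ R W c v u (W' c v))
    (hW' : ∀ c' < M, ∀ v', (c', v') ≠ (c, v) → W' c' v' = W c' v') :
    Sound G H s t D M φ R W' ∧ W' c v ≠ 0 := by
  have hbest := hb.leastCost hHG hD hT hR hW hc hu hK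
  refine ⟨fun c' hc' v' hv' hne => ?_, hbest.1⟩
  by_cases h : (c', v') = (c, v)
  · obtain ⟨rfl, rfl⟩ := Prod.mk.inj h
    refine ⟨hbest.2, .intro _ _ u hu ?_ fun c₁ hc₁ hm w hw hwC =>
      (hW c₁ hc₁ w hw (hK c₁ hc₁ hm w hw hwC)).2⟩
    obtain ⟨c₁, hc₁, hm, -⟩ := hb.1
    exact ⟨c₁, hc₁, hm⟩
  · rw [hW' c' hc' v' h] at hne ⊢
    exact hW c' hc' v' hv' hne

/-- The value of the whole graph. -/
theorem leastCost_univ (hHG : H ≤ G) (hD : 1 ≤ D) (hst : s ≠ t) (hT : IsTable s t D K M φ)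
    (hR : ∀ c < M, IsComp G (φ c) (R c)) {W : ℕ → V → ℕ} (hW : Sound G H s t D M φ R W)
    (hK : ∀ v, IsRep (φ 0) (R 0) v → W 0 v ≠ 0) :
    LeastCost H s t D (φ 0) Set.univ (2 * pairCost H (φ 0) s t +
      ∑ x, if IsRep (φ 0) (R 0) x then W 0 x - 1 else 0) := by
  have := leastCost_add_sum hHG hD (hT.partialAdmissible 0 hT.pos) (hR 0 hT.pos) (C := Set.univ)
    (fun _ _ _ _ _ => trivial) (val := fun w => W 0 w - 1)
    (fun w hw _ => (hW 0 hT.pos w hw (hK w hw)).1)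
  rw [baseCost_pair hst hT.zero_ne] at this
  simpa using this

/-- Small tree-width makes all components solvable that have their neighbours in one bag. -/
theorem solvable_of_bag {m : ℕ} (Δ : TreeDecomposition G m) (hΔ : ∀ i, (Δ.bag i).card ≤ K)
    (hD : 1 ≤ D) (hT : IsTable s t D K M φ) (hR : ∀ c < M, IsComp G (φ c) (R c)) :
    ∀ (N : ℕ), ∀ c < M, ∀ v, IsRep (φ c) (R c) v → (comp (φ c) (R c) v).ncard ≤ N →
      (∃ j, ∀ z, (z ≠ s ∧ z ≠ t) → φ c z ≠ 0 → (∃ x ∈ comp (φ c) (R c) v, G.Adj x z) →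
        z ∈ Δ.bag j) →
      Solvable G s t M φ R c v := by
  intro N
  induction N with
  | zero =>
    intro c hc v hv h0
    rw [Nat.le_zero, Set.ncard_eq_zero] at h0
    exact absurd (show v ∈ comp (φ c) (R c) v from hv) (h0 ▸ Set.notMem_empty v)
  | succ N ih =>
    rintro c hc v hv hN ⟨j₀, hj₀⟩
    set C := comp (φ c) (R c) v with hCdef
    -- The terminals s and t are left out of Z: their labels are never forgotten and do not count
    -- towards K, so they need not lie in the bag.
    obtain ⟨j, hj, u, hu, huj⟩ := Δ.exists_bag_meets (C := C)
      (Z := {z | (z ≠ s ∧ z ≠ t) ∧ φ c z ≠ 0 ∧ ∃ x ∈ C, G.Adj x z}) (x₀ := v) hv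
      (fun x hx y hy => (hR c hc).joined_comp hx hy) (fun z hz => hj₀ z hz.1 hz.2.1 hz.2.2)
      (fun z hz => hz.2.2)
    have hadm := hT.partialAdmissible c hc
    have hus : u ≠ s := fun h => by have := (h ▸ hu : s ∈ C).1; rw [hadm.1] at this; omega
    have hut : u ≠ t := fun h => by have := (h ▸ hu : t ∈ C).1; rw [hadm.2.1] at this; omega
    have hbd : ∀ y, (y ≠ s ∧ y ≠ t) → boundary G s t (φ c) C y ≠ 0 → y ∈ Δ.bag j := by
      intro y hy h
      simp only [boundary, hy.1, hy.2, or_false] at h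
      split_ifs at h with h'
      · exact hj y ⟨hy, h, h'⟩
      · exact absurd rfl h
    refine .intro c v u hu ?_ fun c' hc' hm w hw hwC => ih c' hc' w hw ?_ ⟨j, ?_⟩
    -- Some refinement must be in the table. Its labels besides those of s and t are on u and on
    -- neighbours of C, all within bag j, so there are at most K. The label 1 for u is an arbitrary
    -- choice.
    · have h1 : PartialAdmissible s t D
          (fun y => if y = u then 1 else boundary G s t (φ c) C y) := by
        refine ⟨by simp [hus.symm, boundary, hadm.1], by simp [hut.symm, boundary, hadm.2.1],
          fun y => ?_⟩
        simp only [boundary]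
        split_ifs
        · exact hD
        · exact hadm.2.2 y
        · exact Nat.zero_le _
      obtain ⟨c', hc', h⟩ := hT.exists_eq _ h1 (le_trans (Set.ncard_le_ncard (t := (Δ.bag j : Set V)) (fun y hy => by
        by_cases hyu : y = u
        · exact hyu ▸ huj
        · exact hbd y hy.1 (by simpa [hyu] using hy.2)) (Set.toFinite _)) (by
          rw [Set.ncard_coe_finset]; exact hΔ j))
      exact ⟨c', hc', by simp [h], fun y hy => by simp [h, hy, hCdef]⟩
    · have := Set.ncard_lt_ncard (hm.comp_ssubset (hR c hc) (hR c' hc') hu hwC) (Set.toFinite _)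
      rw [← hCdef] at this
      omega
    -- All labels of the refinement other than those of s and t are in bag j, which therefore serves
    -- for each of the smaller components.
    · intro z hz hφz _
      by_cases hzu : z = u
      · exact hzu ▸ huj
      · exact hbd z hz (hm.2 z hzu ▸ hφz)

/-- In the first labelling only s and t are labelled, so the condition on labelled neighbours is
empty and any bag will do. -/
theorem solvable_root {m : ℕ} (Δ : TreeDecomposition G m) (hΔ : ∀ i, (Δ.bag i).card ≤ K)
    (hD : 1 ≤ D) (hT : IsTable s t D K M φ) (hR : ∀ c < M, IsComp G (φ c) (R c)) (v : V)
    (hv : IsRep (φ 0) (R 0) v) : Solvable G s t M φ R 0 v := by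
  obtain ⟨j, -⟩ := Δ.vertex_mem v
  exact solvable_of_bag Δ hΔ hD hT hR _ 0 hT.pos v hv le_rfl
    ⟨j, fun z hz h => absurd ((hT.zero_ne z).1 h) (by simp [hz.1, hz.2])⟩

end Table

/-- A graph of tree-width `k` has a tree decomposition with bags of size at most `k + 1`. -/
theorem exists_treeDecomposition {V : Type*} [Fintype V] (G : SimpleGraph V) :
    ∃ (m : ℕ) (Δ : TreeDecomposition G m), ∀ i, (Δ.bag i).card ≤ treeWidth G + 1 := by
  -- The decomposition with a single bag shows that the infimum in `treeWidth` is attained, rather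
  -- than being the default value of an empty set.
  have hne : {w | ∃ (m : ℕ) (Δ : TreeDecomposition G m), Δ.width = w}.Nonempty := by
    refine ⟨_, 1, ⟨⊥, .of_subsingleton, fun _ => Finset.univ, fun v => ⟨0, by simp⟩,
      fun u v _ => ⟨0, by simp⟩, fun v => ?_⟩, rfl⟩
    have : Nonempty {i : Fin 1 | v ∈ (Finset.univ : Finset V)} := ⟨⟨0, by simp⟩⟩
    exact ⟨.of_subsingleton⟩
  obtain ⟨m, Δ, h⟩ := Nat.sInf_mem hne
  refine ⟨m, Δ, fun i => ?_⟩
  have h1 : (Δ.bag i).card ≤ Finset.univ.sup fun i => (Δ.bag i).card :=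
    Finset.le_sup (f := fun i => (Δ.bag i).card) (Finset.mem_univ i)
  change Δ.width = treeWidth G at h
  rw [← h, TreeDecomposition.width]
  omega

/-! ## Cuts and labellings -/

section Cut

open Classical

variable {V : Type*} [Fintype V] {G H : SimpleGraph V} {s t : V} {L : ℕ}

/-- The number of labels. -/
def numLabels (n L : ℕ) : ℕ := min (L + 1) n + 1

/-- The label is one plus the distance from s in G − F, truncated at m = min(L + 1, n). Distances of
adjacent vertices differ by at most one, and truncation preserves this while giving a finite label
to unreachable vertices. The distance of t is at least L + 1, so t receives the last label m + 1. -/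
theorem IsBoundedCut.exists_labelling {F : Finset (Sym2 V)} (hF : IsBoundedCut G s t L F) :
    ∃ d, Admissible s t (numLabels (Fintype.card V) L) d ∧
      ∀ x y, G.Adj x y → s(x, y) ∉ F → (d x - d y) + (d y - d x) ≤ 1 := by
  set G' := G.deleteEdges (F : Set (Sym2 V)) with hG'
  set m := min (L + 1) (Fintype.card V) with hm
  have hle : ∀ x, min (G'.edist s x) (m : ℕ∞) ≤ m := fun x => min_le_right _ _
  have hco : ∀ x, ((min (G'.edist s x) (m : ℕ∞)).toNat : ℕ∞) = min (G'.edist s x) (m : ℕ∞) :=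
    fun x => ENat.natCast_toNat (ne_top_of_le_ne_top (ENat.natCast_ne_top m) (hle x))
  have hst : (m : ℕ∞) ≤ G'.edist s t :=
    le_trans (by exact_mod_cast min_le_left _ _) hF.2
  have hadj : ∀ x y, G'.Adj x y → (min (G'.edist s y) (m : ℕ∞)).toNat ≤
      (min (G'.edist s x) (m : ℕ∞)).toNat + 1 := by
    intro x y hxy
    have h1 : G'.edist s y ≤ G'.edist s x + 1 := by
      refine le_trans G'.edist_triangle (add_le_add_right ?_ _)
      rw [SimpleGraph.edist_eq_one_iff_adj.2 hxy]
    have h2 : min (G'.edist s y) (m : ℕ∞) ≤ min (G'.edist s x) (m : ℕ∞) + 1 := by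
      rcases le_total (G'.edist s x) (m : ℕ∞) with h | h
      · rw [min_eq_left h]; exact (min_le_left _ _).trans h1
      · rw [min_eq_right h]; exact (hle y).trans le_self_add
    rw [← hco y, ← hco x] at h2
    exact_mod_cast h2
  refine ⟨fun x => (min (G'.edist s x) (m : ℕ∞)).toNat + 1, ⟨by simp, ?_, fun v => ?_⟩, ?_⟩
  · simp only [min_eq_right hst, ENat.toNat_natCast, numLabels]
    omega
  · have : (min (G'.edist s v) (m : ℕ∞)).toNat ≤ m := by
      have := hle v
      rw [← hco] at this
      exact_mod_cast this
    simp only [numLabels]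
    omega
  · intro x y hxy hF'
    have h : G'.Adj x y := by simp [hG', hxy, hF']
    have h1 := hadj x y h
    have h2 := hadj y x h.symm
    dsimp only
    omega

/-- Labels grow by at most one along each edge, so a path from s to t has at least min(L + 1, n)
edges. Since a path has fewer than n edges, the minimum is L + 1. This is why D may be capped at n +
1, which keeps the table small for large L. -/
theorem isBoundedCut_of_labelling {F : Finset (Sym2 V)} (hF : (F : Set (Sym2 V)) ⊆ G.edgeSet)
    {d : V → ℕ} (hd : Admissible s t (numLabels (Fintype.card V) L) d)
    (h : ∀ x y, G.Adj x y → s(x, y) ∉ F → (d x - d y) + (d y - d x) ≤ 1) :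
    IsBoundedCut G s t L F := by
  refine ⟨hF, ?_⟩
  by_contra hlt
  rw [not_le] at hlt
  have hr : (G.deleteEdges (F : Set (Sym2 V))).Reachable s t := by
    rw [← SimpleGraph.edist_ne_top_iff_reachable]
    exact ne_top_of_lt hlt
  obtain ⟨p, hp, hpl⟩ := hr.exists_path_of_dist
  have hlen : ∀ {x y : V} (q : (G.deleteEdges (F : Set (Sym2 V))).Walk x y),
      d y ≤ d x + q.length := by
    intro x y q
    induction q with
    | nil => simp
    | cons hq q ih =>
      simp only [SimpleGraph.deleteEdges_adj, Finset.mem_coe] at hq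
      have := h _ _ hq.1 hq.2
      simp only [SimpleGraph.Walk.length_cons]
      omega
  have h1 := hlen p
  have h2 := hp.length_lt
  have h3 : p.length < L + 1 := by
    rw [hpl]
    have := hr.coe_dist_eq_edist
    rw [← this] at hlt
    exact_mod_cast hlt
  rw [hd.1, hd.2.1, numLabels] at h1
  omega

theorem sum_adj_eq (G : SimpleGraph V) [Fintype G.edgeSet] :
    (∑ x, ∑ y, if G.Adj x y then 1 else 0) = 2 * G.edgeFinset.card := by
  have h := SimpleGraph.sum_degrees_eq_twice_card_edges (G := G)
  have h2 : G.edgeFinset.card = (@SimpleGraph.edgeFinset V G (Fintype.ofFinite _)).card := by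
    congr!
  rw [h2]
  refine Eq.trans (Finset.sum_congr rfl fun x _ => ?_) (h.trans (by congr!))
  rw [← SimpleGraph.card_neighborFinset_eq_degree, SimpleGraph.neighborFinset_eq_filter,
    Finset.card_filter]

/-- The cost of a labelling is at most twice the size of a set of edges that contains all edges
with labels that differ by more than one. -/
theorem cost_univ_le {F : Finset (Sym2 V)} {d : V → ℕ}
    (h : ∀ x y, G.Adj x y → s(x, y) ∉ F → (d x - d y) + (d y - d x) ≤ 1) :
    cost G Set.univ d ≤ 2 * F.card := by
  -- The degree sum formula is applied to the graph with edge set F. Only an inequality results for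
  -- its size, since F may contain loops, which this graph drops.
  have h1 := sum_adj_eq (SimpleGraph.fromEdgeSet (F : Set (Sym2 V)))
  have h2 : (SimpleGraph.fromEdgeSet (F : Set (Sym2 V))).edgeFinset.card ≤ F.card := by
    refine Finset.card_le_card fun e he => ?_
    simp only [SimpleGraph.mem_edgeFinset, SimpleGraph.edgeSet_fromEdgeSet] at he
    exact he.1
  refine le_trans ?_ (h1.trans_le (Nat.mul_le_mul_left 2 h2))
  refine Finset.sum_le_sum fun x _ => Finset.sum_le_sum fun y _ => ?_
  simp only [Set.mem_univ, or_self, if_true, pairCost, SimpleGraph.fromEdgeSet_adj,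
    Finset.mem_coe]
  by_cases hc : G.Adj x y ∧ 1 < (d x - d y) + (d y - d x)
  · have : s(x, y) ∈ F := by
      by_contra hF
      have := h x y hc.1 hF
      omega
    simp [hc, this, hc.1.ne]
  · simp [hc]

/-- The number of ordered pairs of vertices that are adjacent in `G` but not in `H`. -/
noncomputable def deletedPairs (G H : SimpleGraph V) : ℕ :=
  ∑ x, ∑ y, if G.Adj x y ∧ ¬H.Adj x y then 1 else 0

/-- The minimal total cost of an admissible labelling is `m`. -/
def IsOpt (H : SimpleGraph V) (s t : V) (D m : ℕ) : Prop :=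
  (∃ d, Admissible s t D d ∧ cost H Set.univ d = m) ∧
    ∀ d, Admissible s t D d → m ≤ cost H Set.univ d

/-- A partial labelling of s and t alone is extended by every admissible labelling. -/
theorem LeastCost.isOpt {D m : ℕ} {φ : V → ℕ} (h : LeastCost H s t D φ Set.univ m)
    (hφ : PartialAdmissible s t D φ) (h0 : ∀ v, φ v ≠ 0 ↔ v = s ∨ v = t) : IsOpt H s t D m := by
  refine ⟨?_, fun d hd => h.2 d hd fun v hv => ?_⟩
  · obtain ⟨d, h1, -, h2⟩ := h.1
    exact ⟨d, h1, h2⟩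
  · rcases (h0 v).1 hv with rfl | rfl
    · rw [hd.1, hφ.1]
    · rw [hd.2.1, hφ.2.1]

theorem sum_pair {i j : V} (hij : i ≠ j) (c : ℕ) :
    (∑ x, ∑ y, if s(x, y) = s(i, j) then c else 0) = 2 * c := by
  have : ∀ x y : V, (if s(x, y) = s(i, j) then c else 0) =
      (if x = i then (if y = j then c else 0) else 0) +
      (if x = j then (if y = i then c else 0) else 0) := by
    intro x y
    simp only [Sym2.eq_iff]
    by_cases h1 : x = i
    · by_cases h2 : y = j <;> simp [h1, h2, hij]
    · by_cases h2 : x = j <;> by_cases h3 : y = i <;> simp [h1, h2, h3, hij.symm]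
  rw [Finset.sum_congr rfl fun x _ => Finset.sum_congr rfl fun y _ => this x y]
  simp [Finset.sum_add_distrib, two_mul]

theorem cost_deleteEdges {i j : V} (hij : H.Adj i j) (d : V → ℕ) :
    cost H Set.univ d =
      cost (H.deleteEdges {s(i, j)}) Set.univ d + 2 * pairCost H d i j := by
  rw [← sum_pair hij.ne]
  simp only [cost, ← Finset.sum_add_distrib]
  refine Finset.sum_congr rfl fun x _ => Finset.sum_congr rfl fun y _ => ?_
  simp only [Set.mem_univ, or_self, if_true, pairCost, SimpleGraph.deleteEdges_adj,
    Set.mem_singleton_iff]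
  by_cases h : s(x, y) = s(i, j)
  · rcases Sym2.eq_iff.1 h with ⟨rfl, rfl⟩ | ⟨rfl, rfl⟩
    · simp
    · simp [H.adj_comm x y, add_comm, Sym2.eq_swap]
  · simp [h]

theorem deletedPairs_deleteEdges (hHG : H ≤ G) {i j : V} (hij : H.Adj i j) :
    deletedPairs G (H.deleteEdges {s(i, j)}) = deletedPairs G H + 2 := by
  have h2 := sum_pair hij.ne 1
  simp only [mul_one] at h2
  rw [← h2]
  simp only [deletedPairs, ← Finset.sum_add_distrib]
  refine Finset.sum_congr rfl fun x _ => Finset.sum_congr rfl fun y _ => ?_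
  simp only [SimpleGraph.deleteEdges_adj, Set.mem_singleton_iff]
  by_cases h : s(x, y) = s(i, j)
  · have h1 : H.Adj x y := by rwa [← SimpleGraph.mem_edgeSet, h]
    simp [h, h1, hHG h1]
  · simp [h]

/-- The situation after trying to delete the edges `xy` with `done x y`, when the graph `H` is
left. -/
structure Reduced (G H : SimpleGraph V) (s t : V) (D m : ℕ) (done : V → V → Prop) : Prop where
  le : H ≤ G
  opt : IsOpt H s t D m
  count_le : ∀ d, Admissible s t D d → m + deletedPairs G H ≤ cost G Set.univ d
  tight : ∀ x y, done x y → H.Adj x y → ∀ d, Admissible s t D d → cost H Set.univ d = m →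
    pairCost H d x y = 0

theorem Reduced.refl {D m : ℕ} (h : IsOpt G s t D m) : Reduced G G s t D m fun _ _ => False :=
  ⟨le_rfl, h, fun d hd => by simpa [deletedPairs] using h.2 d hd, fun _ _ h => h.elim⟩

variable {D m : ℕ} {done : V → V → Prop}

theorem Reduced.mono (h : Reduced G H s t D m done) {done' : V → V → Prop}
    (hd : ∀ x y, done' x y → H.Adj x y → done x y) : Reduced G H s t D m done' :=
  ⟨h.le, h.opt, h.count_le, fun x y hxy hH => h.tight x y (hd x y hxy hH) hH⟩

/-- If a labelling that is optimal for H paid for the edge ij, deleting the edge would save two,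
contrary to the assumption on m'. So every optimal labelling has cost zero at ij. -/
theorem Reduced.keep (h : Reduced G H s t D m done) {i j : V} (hij : H.Adj i j) {m' : ℕ}
    (hm' : IsOpt (H.deleteEdges {s(i, j)}) s t D m') (hlt : m < m' + 2) :
    Reduced G H s t D m fun x y => done x y ∨ x = i ∧ y = j := by
  refine ⟨h.le, h.opt, h.count_le, fun x y hxy hH d hd hcost => ?_⟩
  rcases hxy with hxy | ⟨rfl, rfl⟩
  · exact h.tight x y hxy hH d hd hcost
  · have h1 := cost_deleteEdges hij d
    have h2 := hm'.2 d hd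
    omega

/-- The two deleted ordered pairs are paid for by the drop of the optimum, so the lower bound in
`count_le` survives. An optimal labelling of the smaller graph costs at most m' + 2 ≤ m in H, hence
is optimal there, and the edges already kept remain tight. -/
theorem Reduced.delete (h : Reduced G H s t D m done) {i j : V} (hij : H.Adj i j) {m' : ℕ}
    (hm' : IsOpt (H.deleteEdges {s(i, j)}) s t D m') (hle : m' + 2 ≤ m) :
    Reduced G (H.deleteEdges {s(i, j)}) s t D m' fun x y => done x y ∨ x = i ∧ y = j := by
  refine ⟨(H.deleteEdges_le _).trans h.le, hm', fun d hd => ?_, fun x y hxy hH d hd hcost => ?_⟩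
  · have := h.count_le d hd
    rw [deletedPairs_deleteEdges h.le hij]
    omega
  · rw [SimpleGraph.deleteEdges_adj] at hH
    rcases hxy with hxy | ⟨rfl, rfl⟩
    · have h1 := cost_deleteEdges hij d
      have h2 := h.opt.2 d hd
      have h3 : pairCost H d i j ≤ 1 := by simp only [pairCost]; split_ifs <;> omega
      have h4 := h.tight x y hxy hH.1 d hd (by omega)
      simp only [pairCost] at h4 ⊢
      simp only [SimpleGraph.deleteEdges_adj, hH, true_and, not_false_iff] at h4 ⊢
      exact h4
    · simp at hH

/-- When deleting any further edge has been tried, the deleted edges are a minimum cut. -/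
theorem Reduced.isMinBoundedCut (h : Reduced G H s t (numLabels (Fintype.card V) L) m done)
    (hall : ∀ x y, done x y) : IsMinBoundedCut G s t L (G.edgeFinset \ H.edgeFinset) := by
  obtain ⟨⟨d, hd, hm⟩, -⟩ := h.opt
  -- A labelling that is optimal for the remaining graph pays for none of its edges, so it certifies
  -- that the deleted edges are a cut.
  have htight : ∀ x y, pairCost H d x y = 0 := by
    intro x y
    by_cases hH : H.Adj x y
    · exact h.tight x y (hall x y) hH d hd hm
    · simp [pairCost, hH]
  refine ⟨isBoundedCut_of_labelling (fun e he => ?_) hd fun x y hxy hF => ?_, fun F' hF' => ?_⟩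
  · simp only [Finset.coe_sdiff, SimpleGraph.coe_edgeFinset] at he
    exact he.1
  · simp only [Finset.mem_sdiff, SimpleGraph.mem_edgeFinset, SimpleGraph.mem_edgeSet, hxy,
      true_and, not_not] at hF
    have := htight x y
    simp only [pairCost, hF, true_and] at this
    split_ifs at this
    omega
  -- The labelling of any other cut F' costs at most twice the size of F' in G, and by `count_le` at
  -- least the number of deleted ordered pairs, which is twice the number of deleted edges.
  · obtain ⟨d', hd', hv⟩ := hF'.exists_labelling
    have h1 := h.count_le d' hd'
    have h2 := cost_univ_le hv
    have h3 : deletedPairs G H = 2 * (G.edgeFinset \ H.edgeFinset).card := by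
      have h4 := sum_adj_eq (G \ H)
      rw [SimpleGraph.edgeFinset_sdiff] at h4
      rw [← h4]
      simp [deletedPairs, SimpleGraph.sdiff_adj]
    omega

end Cut

open Cmd

/-! ## The program for the dynamic programming -/

-- Beside the input: `rM` is the number of labellings in the table and `rM₀` their number before the
-- current extension; `rOff` is the position behind the table. `rVal` receives one plus the optimum,
-- or 0 if the table does not suffice, and `rCur` is one plus the optimum of the current graph.
-- `rC`, `rV`, `rU`, `rP` stand for a labelling, a representative, the vertex to be labelled and a
-- refinement; `rU` also serves as a label when the table is extended. `rBad` counts missing costs.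
notation "rN" => (0 : ℕ)
notation "rS" => (1 : ℕ)
notation "rT" => (2 : ℕ)
notation "rL" => (3 : ℕ)
notation "rD" => (4 : ℕ)
notation "rM" => (5 : ℕ)
notation "rM₀" => (6 : ℕ)
notation "rOff" => (7 : ℕ)
notation "rVal" => (8 : ℕ)
notation "rCur" => (9 : ℕ)
notation "rC" => (10 : ℕ)
notation "rV" => (11 : ℕ)
notation "rU" => (12 : ℕ)
notation "rY" => (13 : ℕ)
notation "rX" => (14 : ℕ)
notation "rW" => (15 : ℕ)
notation "rP" => (16 : ℕ)
notation "rMis" => (17 : ℕ)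
notation "rSum" => (18 : ℕ)
notation "rBad" => (19 : ℕ)
notation "rBest" => (20 : ℕ)
notation "rRound" => (21 : ℕ)
notation "rI" => (22 : ℕ)
notation "rJ" => (23 : ℕ)
notation "rCnt" => (24 : ℕ)
notation "rA" => (25 : ℕ)
notation "rB" => (26 : ℕ)

-- `aH` holds the graph in which costs are measured, `aT` the partial labellings, `aR` the
-- representatives of components, `aW` one plus the costs of components (0 for unknown), and `aB`
-- the boundary labelling. `aRow` holds the multiples of n, because the machine cannot multiply.
notation "aG" => (0 : ℕ)
notation "aOut" => (1 : ℕ)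
notation "aH" => (2 : ℕ)
notation "aT" => (3 : ℕ)
notation "aR" => (4 : ℕ)
notation "aW" => (5 : ℕ)
notation "aRow" => (6 : ℕ)
notation "aB" => (7 : ℕ)

/-- The position of the entry in row `r`, column `q`. -/
def pos (r q : ℕ) : Expr := .plus (.entry aRow (.reg r)) (.reg q)

/-- The entry of the matrix `a` in row `r`, column `q`. -/
def mat (a r q : ℕ) : Expr := .entry a (pos r q)

/-- The absolute difference, a test for inequality. -/
def absDiff (e₁ e₂ : Expr) : Expr := .plus (.minus e₁ e₂) (.minus e₂ e₁)

/-- The test for zero. -/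
def isZero (e : Expr) : Expr := .minus (.lit 1) e

/-- `p` is run if `e` is zero. -/
def whenZero (e : Expr) (p : Cmd) : Cmd := .ite e .skip p

/-- The value of the expression is added to the register. -/
def incr (x : ℕ) (e : Expr) : Cmd := .assign x (.plus (.reg x) e)

theorem eval_pos (σ : State) (r q : ℕ) :
    (pos r q).eval σ = σ.arr aRow (σ.reg r) + σ.reg q := rfl

theorem eval_mat (σ : State) (a r q : ℕ) :
    (mat a r q).eval σ = σ.arr a (σ.arr aRow (σ.reg r) + σ.reg q) := rfl

@[simp] theorem eval_lit (σ : State) (c : ℕ) : (Expr.lit c).eval σ = c := rfl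
@[simp] theorem eval_reg (σ : State) (x : ℕ) : (Expr.reg x).eval σ = σ.reg x := rfl
@[simp] theorem eval_entry (σ : State) (a : ℕ) (i : Expr) :
    (Expr.entry a i).eval σ = σ.arr a (i.eval σ) := rfl
@[simp] theorem eval_plus (σ : State) (e₁ e₂ : Expr) :
    (Expr.plus e₁ e₂).eval σ = e₁.eval σ + e₂.eval σ := rfl
@[simp] theorem eval_minus (σ : State) (e₁ e₂ : Expr) :
    (Expr.minus e₁ e₂).eval σ = e₁.eval σ - e₂.eval σ := rfl

theorem eval_absDiff (σ : State) (e₁ e₂ : Expr) :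
    (absDiff e₁ e₂).eval σ = (e₁.eval σ - e₂.eval σ) + (e₂.eval σ - e₁.eval σ) := rfl

@[simp] theorem absDiff_eq_zero {σ : State} {e₁ e₂ : Expr} :
    (absDiff e₁ e₂).eval σ = 0 ↔ e₁.eval σ = e₂.eval σ := by
  rw [eval_absDiff]; omega

@[simp] theorem isZero_eq_zero {σ : State} {e : Expr} :
    (isZero e).eval σ = 0 ↔ e.eval σ ≠ 0 := by
  simp only [isZero, eval_minus, eval_lit]; omega

theorem exec_whenZero (e : Expr) (p : Cmd) (σ : State) :
    (whenZero e p).exec σ = if e.eval σ = 0 then p.exec σ else σ := by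
  simp only [whenZero, exec]
  split_ifs <;> simp_all

/-- Conjunctions are encoded as sums: a sum of natural numbers vanishes exactly if all its terms do.
Tests are written so that zero means true. -/
theorem exec_whenZero_iff {e : Expr} {σ : State} {P : Prop} [Decidable P]
    (h : e.eval σ = 0 ↔ P) (p : Cmd) :
    (whenZero e p).exec σ = if P then p.exec σ else σ := by
  rw [exec_whenZero]
  simp only [h]

theorem exec_ite_iff {e : Expr} {σ : State} {P : Prop} [Decidable P]
    (h : e.eval σ ≠ 0 ↔ P) (p q : Cmd) :
    (Cmd.ite e p q).exec σ = if P then p.exec σ else q.exec σ := by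
  rw [Cmd.exec]
  simp only [h]

@[simp] theorem exec_skip (σ : State) : skip.exec σ = σ := rfl
@[simp] theorem exec_seq (p q : Cmd) (σ : State) : (seq p q).exec σ = q.exec (p.exec σ) := rfl
@[simp] theorem exec_assign (x : ℕ) (e : Expr) (σ : State) :
    (assign x e).exec σ = σ.setReg x (e.eval σ) := rfl
@[simp] theorem exec_store (a : ℕ) (i e : Expr) (σ : State) :
    (store a i e).exec σ = σ.setArr a (i.eval σ) (e.eval σ) := rfl
@[simp] theorem exec_incr (x : ℕ) (e : Expr) (σ : State) :
    (incr x e).exec σ = σ.setReg x (σ.reg x + e.eval σ) := rfl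

/-- Count the neighbours of `y` in the component of `v`. -/
def neighbourCmd : Cmd :=
  seq (assign rCnt (.lit 0)) (count rX rN (whenZero
    (.plus (isZero (mat aG rX rY)) (.plus (mat aT rC rX) (absDiff (mat aR rC rX) (.reg rV))))
    (incr rCnt (.lit 1))))

/-- Compute the restriction of the labelling `c` to the boundary of the component of `v`. -/
def boundaryCmd : Cmd :=
  count rY rN (seq neighbourCmd
    (ite (.plus (.reg rCnt) (.plus (isZero (absDiff (.reg rY) (.reg rS)))
        (isZero (absDiff (.reg rY) (.reg rT)))))
      (store aB (.reg rY) (mat aT rC rY)) (store aB (.reg rY) (.lit 0))))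

/-- Count the differences between the labelling `p` and the boundary, apart from `u`. -/
def mismatchCmd : Cmd :=
  seq (assign rMis (isZero (mat aT rP rU)))
    (count rY rN (ite (absDiff (.reg rY) (.reg rU))
      (incr rMis (absDiff (mat aT rP rY) (.entry aB (.reg rY)))) skip))

/-- Add the cost of the component `w` of the labelling `p` to the sum. -/
def addCompCmd : Cmd :=
  seq (incr rSum (.minus (mat aW rP rW) (.lit 1))) (incr rBad (isZero (mat aW rP rW)))

/-- Compute the candidate value for the labelling `p`. -/
def candidateCmd : Cmd :=
  seq (assign rSum (.lit 1))
    (seq (count rY rN (whenZero (.plus (isZero (mat aH rU rY)) (.plus (isZero (mat aT rP rY))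
        (.minus (.lit 2) (absDiff (mat aT rP rU) (mat aT rP rY)))))
      (incr rSum (.lit 2))))
    (count rW rN (whenZero (.plus (.plus (mat aT rP rW) (absDiff (mat aR rP rW) (.reg rW)))
        (.plus (mat aT rC rW) (absDiff (mat aR rC rW) (.reg rV)))) addCompCmd)))

/-- Improve the best value. -/
def bestCmd : Cmd :=
  ite (.plus (isZero (.reg rBest)) (.minus (.reg rBest) (.reg rSum)))
    (assign rBest (.reg rSum)) skip

/-- Find the best candidate for labelling `u`. -/
def searchCmd : Cmd :=
  seq (assign rBad (.lit 0)) (seq (assign rBest (.lit 0))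
    (count rP rM (seq mismatchCmd (whenZero (.reg rMis) (seq candidateCmd bestCmd)))))

/-- Try to compute the cost of the component of `v` by labelling `u`. -/
def vertexCmd : Cmd :=
  whenZero (.plus (mat aT rC rU) (absDiff (mat aR rC rU) (.reg rV)))
    (seq searchCmd (whenZero (.plus (.reg rBad) (isZero (.reg rBest)))
      (store aW (pos rC rV) (.reg rBest))))

/-- Try to compute the cost of the component of `v`. -/
def compCmd : Cmd :=
  whenZero (.plus (mat aT rC rV) (absDiff (mat aR rC rV) (.reg rV)))
    (seq boundaryCmd (count rU rN vertexCmd))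

/-- Try to compute the costs of all components. -/
def roundCmd : Cmd := count rC rM (count rV rN compCmd)

/-- Forget all costs. -/
def clearCmd : Cmd := count rC rM (count rV rN (store aW (pos rC rV) (.lit 0)))

/-- Compute the cost of the whole graph. -/
def rootCmd : Cmd :=
  seq (assign rP (.lit 0)) (seq (assign rBad (.lit 0)) (seq (assign rSum (.lit 1))
    (seq (whenZero (.plus (isZero (mat aH rS rT)) (.minus (.lit 3) (.reg rD)))
      (incr rSum (.lit 2)))
    (seq (count rW rN (whenZero (.plus (mat aT rP rW) (absDiff (mat aR rP rW) (.reg rW)))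
      addCompCmd))
    (ite (.reg rBad) (assign rVal (.lit 0)) (assign rVal (.reg rSum)))))))

/-- Compute one plus the minimal cost of a labelling, or zero if the labellings in the table
do not suffice. -/
def costCmd : Cmd := seq clearCmd (seq (count rRound rN roundCmd) rootCmd)

/-! ### Correctness of the search for the best label of one vertex -/

section Spec

open Classical

variable {n : ℕ} {G H : SimpleGraph (Fin n)} {s t : Fin n} {D K M : ℕ}
  {φ : ℕ → Fin n → ℕ} {R : ℕ → Fin n → Fin n}

/-- Row and column are quotient and remainder modulo n, so writing one matrix entry leaves all
others intact. -/
theorem index_inj {c c' : ℕ} {v v' : Fin n} :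
    c * n + (v : ℕ) = c' * n + (v' : ℕ) ↔ c = c' ∧ v = v' := by
  constructor
  · intro h
    have hn : 0 < n := v.pos
    have h1 := congrArg (· / n) h
    have h2 := congrArg (· % n) h
    simp only [Nat.mul_comm _ n, Nat.mul_add_div hn, Nat.mul_add_mod,
      Nat.div_eq_of_lt v.2, Nat.div_eq_of_lt v'.2, Nat.mod_eq_of_lt v.2,
      Nat.mod_eq_of_lt v'.2, add_zero] at h1 h2
    exact ⟨h1, Fin.ext h2⟩
  · rintro ⟨rfl, rfl⟩; rfl

/-- The matrix in array `a`. -/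
def State.matrix (σ : State) (n a : ℕ) (c : ℕ) (v : Fin n) : ℕ := σ.arr a (c * n + v)

/-- The array `a` holds the adjacency matrix of `G`. -/
def HasGraph (G : SimpleGraph (Fin n)) (a : ℕ) (σ : State) : Prop :=
  ∀ x y : Fin n, σ.arr a (x * n + y) = if G.Adj x y then 1 else 0

/-- The storage contains the graph, the partial labellings and the components. -/
structure Loaded (G : SimpleGraph (Fin n)) (s t : Fin n) (D M : ℕ) (φ : ℕ → Fin n → ℕ)
    (R : ℕ → Fin n → Fin n) (σ : State) : Prop where
  n_eq : σ.reg rN = n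
  s_eq : σ.reg rS = s
  t_eq : σ.reg rT = t
  D_eq : σ.reg rD = D
  M_eq : σ.reg rM = M
  row : ∀ i, i < n ∨ i < M → σ.arr aRow i = i * n
  graph : HasGraph G aG σ
  label : ∀ c < M, ∀ v : Fin n, σ.arr aT (c * n + v) = φ c v
  rep : ∀ c < M, ∀ v : Fin n, σ.arr aR (c * n + v) = R c v

/-- Preservation of the standing data is reduced to a decidable check of which registers and arrays
a command writes. -/
theorem Loaded.of_frame {p : Cmd} {σ τ : State} (h : Loaded G s t D M φ R σ) (hf : p.Frame σ τ)
    (hr : ∀ x ∈ [rN, rS, rT, rD, rM], x ∉ p.wregs)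
    (ha : ∀ a ∈ [aG, aRow, aT, aR], a ∉ p.warrs) : Loaded G s t D M φ R τ := by
  simp only [List.forall_mem_cons] at hr ha
  obtain ⟨r0, r1, r2, r3, r4, -⟩ := hr
  obtain ⟨a0, a1, a2, a3, -⟩ := ha
  constructor
  · rw [hf.1 _ r0, h.n_eq]
  · rw [hf.1 _ r1, h.s_eq]
  · rw [hf.1 _ r2, h.t_eq]
  · rw [hf.1 _ r3, h.D_eq]
  · rw [hf.1 _ r4, h.M_eq]
  · rw [hf.2 _ a1]; exact h.row
  · unfold HasGraph; rw [hf.2 _ a0]; exact h.graph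
  · rw [hf.2 _ a2]; exact h.label
  · rw [hf.2 _ a3]; exact h.rep

theorem Loaded.setReg {σ : State} (h : Loaded G s t D M φ R σ) {x j : ℕ}
    (hx : x ∉ [rN, rS, rT, rD, rM]) : Loaded G s t D M φ R (σ.setReg x j) :=
  h.of_frame (p := assign x (.lit j)) (frame_exec _ σ)
    (fun y hy => by simp only [wregs, List.mem_singleton]; rintro rfl; exact hx hy)
    (by simp [warrs])

theorem Loaded.exec {σ : State} (h : Loaded G s t D M φ R σ) {p : Cmd}
    (hr : ∀ x ∈ [rN, rS, rT, rD, rM], x ∉ p.wregs)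
    (ha : ∀ a ∈ [aG, aRow, aT, aR], a ∉ p.warrs) : Loaded G s t D M φ R (p.exec σ) :=
  h.of_frame (frame_exec p σ) hr ha

namespace Loaded

variable {σ : State} (h : Loaded G s t D M φ R σ) {r q c : ℕ} {v w : Fin n}
include h

theorem eval_pos (hr : σ.reg r = c) (hc : c < M) (hq : σ.reg q = v) :
    (pos r q).eval σ = c * n + v := by
  rw [LBCut.eval_pos, hr, hq, h.row c (.inr hc)]

theorem eval_mat (a : ℕ) (hr : σ.reg r = c) (hc : c < M) (hq : σ.reg q = v) :
    (mat a r q).eval σ = σ.matrix n a c v := by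
  rw [LBCut.eval_mat, hr, hq, h.row c (.inr hc)]; rfl

theorem eval_label (hr : σ.reg r = c) (hc : c < M) (hq : σ.reg q = v) :
    (mat aT r q).eval σ = φ c v := by
  rw [LBCut.eval_mat, hr, hq, h.row c (.inr hc), h.label c hc]

theorem eval_rep (hr : σ.reg r = c) (hc : c < M) (hq : σ.reg q = v) :
    (mat aR r q).eval σ = R c v := by
  rw [LBCut.eval_mat, hr, hq, h.row c (.inr hc), h.rep c hc]

theorem eval_graph {a : ℕ} (hH : HasGraph H a σ) (hr : σ.reg r = w) (hq : σ.reg q = v) :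
    (mat a r q).eval σ = if H.Adj w v then 1 else 0 := by
  rw [LBCut.eval_mat, hr, hq, h.row w (.inl w.2), hH]

theorem isRep_iff (hr : σ.reg r = c) (hc : c < M) (hq : σ.reg q = v) :
    (Expr.plus (mat aT r q) (absDiff (mat aR r q) (.reg q))).eval σ = 0 ↔
      IsRep (φ c) (R c) v := by
  simp [h.eval_label hr hc hq, h.eval_rep hr hc hq, hq, IsRep, Fin.val_inj]

theorem mem_comp_iff {z : ℕ} (hr : σ.reg r = c) (hc : c < M) (hq : σ.reg q = v)
    (hz : σ.reg z = w) :
    (Expr.plus (mat aT r q) (absDiff (mat aR r q) (.reg z))).eval σ = 0 ↔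
      v ∈ comp (φ c) (R c) w := by
  simp [h.eval_label hr hc hq, h.eval_rep hr hc hq, hz, comp, Fin.val_inj]

end Loaded

theorem HasGraph.of_arr_eq {a : ℕ} {σ τ : State} (h : HasGraph H a σ) (ha : τ.arr a = σ.arr a) :
    HasGraph H a τ := by
  unfold HasGraph; rw [ha]; exact h

theorem exec_neighbourCmd {σ : State} (h : Loaded G s t D M φ R σ) {c : ℕ} (hc : c < M)
    (hC : σ.reg rC = c) {v y : Fin n} (hV : σ.reg rV = v) (hY : σ.reg rY = y) :
    (neighbourCmd.exec σ).reg rCnt =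
      ∑ x, if G.Adj x y ∧ x ∈ comp (φ c) (R c) v then 1 else 0 := by
  rw [neighbourCmd, exec_seq, exec_assign, exec_count_sum
    (fun x : Fin n => if G.Adj x y ∧ x ∈ comp (φ c) (R c) v then 1 else 0)
    (by simpa using h.n_eq) (by decide)]
  · simp
  intro x τ hF hx
  have hτ := (h.setReg (x := rCnt) (by decide)).of_frame hF (by decide) (by decide)
  have hC' : τ.reg rC = c := (hF.1 _ (by decide)).trans (by simpa using hC)
  have hV' : τ.reg rV = v := (hF.1 _ (by decide)).trans (by simpa using hV)
  have hY' : τ.reg rY = y := (hF.1 _ (by decide)).trans (by simpa using hY)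
  rw [exec_whenZero_iff (P := G.Adj x y ∧ x ∈ comp (φ c) (R c) v)]
  · split_ifs <;> simp
  · rw [eval_plus, Nat.add_eq_zero_iff, hτ.mem_comp_iff hC' hc hx hV', isZero_eq_zero,
      hτ.eval_graph hτ.graph hx hY']
    simp

theorem exec_boundaryCmd {σ : State} (h : Loaded G s t D M φ R σ) {c : ℕ} (hc : c < M)
    (hC : σ.reg rC = c) {v : Fin n} (hV : σ.reg rV = v) (y : Fin n) :
    (boundaryCmd.exec σ).arr aB y = boundary G s t (φ c) (comp (φ c) (R c) v) y := by
  refine exec_count (fun k τ => ∀ y : Fin n, y < k →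
    τ.arr aB y = boundary G s t (φ c) (comp (φ c) (R c) v) y) h.n_eq (fun k j τ h => h)
    (fun y hy => absurd hy (by omega)) (fun k τ hk hF hx hI => ?_) y y.2
  obtain ⟨z, rfl⟩ : ∃ z : Fin n, (z : ℕ) = k := ⟨⟨k, hk⟩, rfl⟩
  have hτ := h.of_frame hF (by decide) (by decide)
  have hτC : τ.reg rC = c := (hF.1 _ (by decide)).trans hC
  have hτV : τ.reg rV = v := (hF.1 _ (by decide)).trans hV
  have hcnt := exec_neighbourCmd hτ hc hτC hτV hx
  have hρ := hτ.exec (p := neighbourCmd) (by decide) (by decide)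
  have hρC : (neighbourCmd.exec τ).reg rC = c := (exec_reg _ (by decide)).trans hτC
  have hρY : (neighbourCmd.exec τ).reg rY = z := (exec_reg _ (by decide)).trans hx
  have hρB : (neighbourCmd.exec τ).arr aB = τ.arr aB := exec_arr _ (by decide)
  rw [exec_seq]
  generalize neighbourCmd.exec τ = ρ at *
  have hlab := hρ.eval_label hρC hc hρY
  have hcond : (Expr.plus (.reg rCnt) (.plus (isZero (absDiff (.reg rY) (.reg rS)))
      (isZero (absDiff (.reg rY) (.reg rT))))).eval ρ ≠ 0 ↔
      (∃ x ∈ comp (φ c) (R c) v, G.Adj x z) ∨ z = s ∨ z = t := by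
    rw [eval_plus, eval_plus, eval_reg, hcnt, Ne, Nat.add_eq_zero_iff, Nat.add_eq_zero_iff,
      isZero_eq_zero, isZero_eq_zero, Ne, Ne, absDiff_eq_zero, absDiff_eq_zero, eval_reg, eval_reg,
      eval_reg, hρY, hρ.s_eq, hρ.t_eq, Fin.val_inj, Fin.val_inj, not_and_or, not_and_or, not_not,
      not_not]
    simp [and_comm]
  intro y hy
  have hs : (Cmd.ite (.plus (.reg rCnt) (.plus (isZero (absDiff (.reg rY) (.reg rS)))
      (isZero (absDiff (.reg rY) (.reg rT))))) (store aB (.reg rY) (mat aT rC rY))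
      (store aB (.reg rY) (.lit 0))).exec ρ =
      ρ.setArr aB z (boundary G s t (φ c) (comp (φ c) (R c) v) z) := by
    rw [exec_ite_iff hcond, boundary]
    split_ifs
    · rw [exec_store, hlab, eval_reg, hρY]
    · rw [exec_store, eval_lit, eval_reg, hρY]
  rw [hs, State.setArr_arr]
  split_ifs with hyz
  · rw [Fin.ext hyz.2]
  · rw [hρB]
    exact hI y (by have : (y : ℕ) ≠ z := fun h => hyz ⟨rfl, h⟩; omega)

theorem exec_mismatchCmd {σ : State} (h : Loaded G s t D M φ R σ) {p : ℕ} (hp : p < M)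
    (hP : σ.reg rP = p) {u : Fin n} (hU : σ.reg rU = u) {ψ : Fin n → ℕ} {C : Set (Fin n)}
    (hB : ∀ y : Fin n, σ.arr aB y = boundary G s t ψ C y) :
    (mismatchCmd.exec σ).reg rMis = 0 ↔ Matches G s t ψ C u (φ p) := by
  rw [mismatchCmd, exec_seq, exec_assign, exec_count_sum (fun y : Fin n => if y = u then 0 else
      (φ p y - boundary G s t ψ C y) + (boundary G s t ψ C y - φ p y))
    (by simpa using h.n_eq) (by decide)]
  · rw [State.setReg_reg, if_pos rfl, Nat.add_eq_zero_iff, isZero_eq_zero, h.eval_label hP hp hU,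
      Finset.sum_eq_zero_iff, Matches]
    refine and_congr_right' (forall_congr' fun y => ?_)
    by_cases hyu : y = u
    · simp [hyu]
    · simp only [Finset.mem_univ, hyu, if_false, forall_const, ne_eq, not_false_eq_true]
      omega
  intro y τ hF hx
  have hτ := (h.setReg (x := rMis) (by decide)).of_frame hF (by decide) (by decide)
  have hP' : τ.reg rP = p := (hF.1 _ (by decide)).trans (by simpa using hP)
  have hU' : τ.reg rU = u := (hF.1 _ (by decide)).trans (by simpa using hU)
  have hB' : τ.arr aB = σ.arr aB := hF.2 _ (by decide)
  rw [exec_ite_iff (P := y ≠ u) (by simp [hx, hU', Fin.val_inj]), ite_not]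
  split_ifs with hyu
  · rfl
  · rw [exec_incr, State.setReg_reg, if_pos rfl, eval_absDiff, hτ.eval_label hP' hp hx, eval_entry,
      eval_reg, hx, hB', hB]

/-- The value of `addCompCmd`. -/
theorem exec_addCompCmd {σ : State} (h : Loaded G s t D M φ R σ) {p : ℕ} (hp : p < M)
    (hP : σ.reg rP = p) {w : Fin n} (hW : σ.reg rW = w) :
    (addCompCmd.exec σ).reg rSum = σ.reg rSum + (σ.matrix n aW p w - 1) ∧
    (addCompCmd.exec σ).reg rBad = σ.reg rBad + (1 - σ.matrix n aW p w) := by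
  have h1 := h.eval_mat aW hP hp hW
  have h2 := (h.setReg (x := rSum) (j := σ.reg rSum + (σ.matrix n aW p w - 1))
    (by decide)).eval_mat aW (r := rP) (q := rW) (by simpa using hP) hp (by simpa using hW)
  simp only [addCompCmd, exec_seq, exec_incr, eval_minus, h1, eval_lit, isZero, h2,
    State.setReg_reg]
  exact ⟨rfl, rfl⟩

/-- The value of a loop that sums up the costs of some components. -/
theorem exec_sumComp {σ : State} (h : Loaded G s t D M φ R σ) {p : ℕ} (hp : p < M)
    (hP : σ.reg rP = p) {e : Expr} {Q : Fin n → Prop}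
    (he : ∀ (w : Fin n) (τ : State), (count rW rN (whenZero e addCompCmd)).Frame σ τ →
      τ.reg rW = w → (e.eval τ = 0 ↔ Q w)) :
    ((count rW rN (whenZero e addCompCmd)).exec σ).reg rSum =
      σ.reg rSum + ∑ w, (if Q w then σ.matrix n aW p w - 1 else 0) ∧
    ((count rW rN (whenZero e addCompCmd)).exec σ).reg rBad =
      σ.reg rBad + ∑ w, (if Q w then 1 - σ.matrix n aW p w else 0) := by
  have step : ∀ (w : Fin n) (τ : State), (count rW rN (whenZero e addCompCmd)).Frame σ τ →
      τ.reg rW = w →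
      ((whenZero e addCompCmd).exec τ).reg rSum =
        τ.reg rSum + (if Q w then σ.matrix n aW p w - 1 else 0) ∧
      ((whenZero e addCompCmd).exec τ).reg rBad =
        τ.reg rBad + (if Q w then 1 - σ.matrix n aW p w else 0) := by
    intro w τ hF hx
    have hτ := h.of_frame hF
      (fun x hx h => by revert x; simp [whenZero, addCompCmd, incr, wregs])
      (fun x hx h => by revert x; simp [whenZero, addCompCmd, incr, warrs])
    have hP' : τ.reg rP = p :=
      (hF.1 _ (by simp [whenZero, addCompCmd, incr, wregs])).trans hP
    have hm : τ.matrix n aW = σ.matrix n aW := by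
      unfold State.matrix
      rw [hF.2 _ (by simp [whenZero, addCompCmd, incr, warrs])]
    have := exec_addCompCmd hτ hp hP' hx
    rw [hm] at this
    rw [exec_whenZero_iff (he w τ hF hx)]
    split_ifs
    · exact this
    · simp
  exact ⟨exec_count_sum _ h.n_eq (by decide) fun w τ hF hx => (step w τ hF hx).1,
    exec_count_sum _ h.n_eq (by decide) fun w τ hF hx => (step w τ hF hx).2⟩

/-- With truncated subtraction the summand is one precisely for a missing cost, so `rBad` remains
zero as long as nothing is missing. -/
theorem sum_sub_eq_zero_iff {Q : Fin n → Prop} {g : Fin n → ℕ} :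
    (∑ w, if Q w then 1 - g w else 0) = 0 ↔ ∀ w, Q w → g w ≠ 0 := by
  rw [Finset.sum_eq_zero_iff]
  refine forall_congr' fun w => ?_
  by_cases h : Q w
  · simp [h]; omega
  · simp [h]

/-- The storage contains everything for finding the costs for the component of `v` in the
labelling `c`. -/
structure Ready (G H : SimpleGraph (Fin n)) (s t : Fin n) (D M : ℕ) (φ : ℕ → Fin n → ℕ)
    (R : ℕ → Fin n → Fin n) (c : ℕ) (v : Fin n) (σ : State) : Prop where
  loaded : Loaded G s t D M φ R σ
  weights : HasGraph H aH σ
  lt : c < M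
  c_eq : σ.reg rC = c
  v_eq : σ.reg rV = v

theorem Ready.of_frame {c : ℕ} {v : Fin n} {p : Cmd} {σ τ : State}
    (h : Ready G H s t D M φ R c v σ) (hf : p.Frame σ τ)
    (hr : ∀ x ∈ [rN, rS, rT, rD, rM, rC, rV], x ∉ p.wregs)
    (ha : ∀ a ∈ [aG, aRow, aT, aR, aH], a ∉ p.warrs) : Ready G H s t D M φ R c v τ where
  loaded := h.loaded.of_frame hf (fun x hx => hr x (by simp at hx ⊢; tauto))
    (fun x hx => ha x (by simp at hx ⊢; tauto))
  weights := h.weights.of_arr_eq (hf.2 _ (ha _ (by simp)))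
  lt := h.lt
  c_eq := (hf.1 _ (hr _ (by simp))).trans h.c_eq
  v_eq := (hf.1 _ (hr _ (by simp))).trans h.v_eq

theorem Ready.exec {c : ℕ} {v : Fin n} {p : Cmd} {σ : State}
    (h : Ready G H s t D M φ R c v σ)
    (hr : ∀ x ∈ [rN, rS, rT, rD, rM, rC, rV], x ∉ p.wregs)
    (ha : ∀ a ∈ [aG, aRow, aT, aR, aH], a ∉ p.warrs) : Ready G H s t D M φ R c v (p.exec σ) :=
  h.of_frame (frame_exec p σ) hr ha

/-- The command resets `rSum` but not `rBad`: over all refinements of the same component a single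
missing cost must be remembered. -/
theorem exec_candidateCmd {σ : State} {c : ℕ} {v : Fin n} (h : Ready G H s t D M φ R c v σ)
    {p : ℕ} (hp : p < M) (hP : σ.reg rP = p) {u : Fin n} (hU : σ.reg rU = u) :
    (candidateCmd.exec σ).reg rSum =
      candidate H (φ p) (R p) (comp (φ c) (R c) v) u (σ.matrix n aW p) ∧
    ((candidateCmd.exec σ).reg rBad = 0 ↔ σ.reg rBad = 0 ∧
      ∀ w, IsRep (φ p) (R p) w → w ∈ comp (φ c) (R c) v → σ.matrix n aW p w ≠ 0) := by
  rw [candidateCmd, exec_seq, exec_seq, exec_assign, eval_lit]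
  have h₁ : Ready G H s t D M φ R c v (σ.setReg rSum 1) :=
    h.of_frame (frame_exec (assign rSum (.lit 1)) σ) (by decide) (by decide)
  have hsum := exec_count_sum (x := rY) (b := rN) (f := rSum)
    (p := whenZero (.plus (isZero (mat aH rU rY)) (.plus (isZero (mat aT rP rY))
        (.minus (.lit 2) (absDiff (mat aT rP rU) (mat aT rP rY))))) (incr rSum (.lit 2)))
    (fun y : Fin n => if φ p y ≠ 0 then 2 * pairCost H (φ p) u y else 0) h₁.loaded.n_eq (by decide)
    (fun y τ hF hx => by
      have hτ := h₁.of_frame hF (by decide) (by decide)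
      have hP' : τ.reg rP = p := (hF.1 _ (by decide)).trans (by simpa using hP)
      have hU' : τ.reg rU = u := (hF.1 _ (by decide)).trans (by simpa using hU)
      rw [exec_whenZero_iff (P := φ p y ≠ 0 ∧ H.Adj u y ∧
        1 < (φ p u - φ p y) + (φ p y - φ p u))]
      · simp only [pairCost]
        by_cases h1 : φ p y = 0
        · simp [h1]
        · by_cases h2 : H.Adj u y ∧ 1 < (φ p u - φ p y) + (φ p y - φ p u)
          · simp [h1, h2]
          · simp [h1, h2]
      · rw [eval_plus, eval_plus, Nat.add_eq_zero_iff, Nat.add_eq_zero_iff, isZero_eq_zero,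
          isZero_eq_zero, eval_minus, eval_absDiff, eval_lit, hτ.loaded.eval_graph hτ.weights hU' hx,
          hτ.loaded.eval_label hP' hp hx, hτ.loaded.eval_label hP' hp hU']
        have : 2 - ((φ p u - φ p y) + (φ p y - φ p u)) = 0 ↔
          1 < (φ p u - φ p y) + (φ p y - φ p u) := by omega
        rw [this]
        by_cases hH : H.Adj u y <;> simp [hH])
  have hfr := frame_exec (count rY rN (whenZero (.plus (isZero (mat aH rU rY))
    (.plus (isZero (mat aT rP rY)) (.minus (.lit 2) (absDiff (mat aT rP rU) (mat aT rP rY)))))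
    (incr rSum (.lit 2)))) (σ.setReg rSum 1)
  have h₂ := h₁.of_frame hfr (by decide) (by decide)
  have hP₂ := (hfr.1 rP (by decide)).trans (by simpa using hP)
  have hbad := (hfr.1 rBad (by decide)).trans (State.setReg_reg _ _ _ _)
  have hW := hfr.2 aW (by decide)
  generalize (count rY rN (whenZero (.plus (isZero (mat aH rU rY))
    (.plus (isZero (mat aT rP rY)) (.minus (.lit 2) (absDiff (mat aT rP rU) (mat aT rP rY)))))
    (incr rSum (.lit 2)))).exec (σ.setReg rSum 1) = ρ at *
  have hm : ρ.matrix n aW = σ.matrix n aW := by unfold State.matrix; rw [hW]; rfl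
  obtain ⟨r1, r2⟩ := exec_sumComp h₂.loaded hp hP₂
    (Q := fun w => IsRep (φ p) (R p) w ∧ w ∈ comp (φ c) (R c) v)
    (e := .plus (.plus (mat aT rP rW) (absDiff (mat aR rP rW) (.reg rW)))
        (.plus (mat aT rC rW) (absDiff (mat aR rC rW) (.reg rV))))
    (fun w τ hF hx => by
      have hτ := h₂.of_frame hF (by decide) (by decide)
      rw [eval_plus, Nat.add_eq_zero_iff,
        hτ.loaded.isRep_iff ((hF.1 _ (by decide)).trans hP₂) hp hx,
        hτ.loaded.mem_comp_iff hτ.c_eq hτ.lt hx hτ.v_eq])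
  refine ⟨?_, ?_⟩
  · rw [r1, hsum, hm, candidate, Finset.mul_sum]
    simp only [State.setReg_reg, if_true, mul_ite, mul_zero]
    congr!
  · rw [r2, hbad, Nat.add_eq_zero_iff, sum_sub_eq_zero_iff, hm]
    simp

theorem exec_bestCmd (σ : State) :
    (bestCmd.exec σ).reg rBest =
      if σ.reg rBest = 0 ∨ σ.reg rSum < σ.reg rBest then σ.reg rSum else σ.reg rBest := by
  rw [bestCmd, exec_ite_iff (P := σ.reg rBest = 0 ∨ σ.reg rSum < σ.reg rBest)]
  · split_ifs <;> simp
  · simp only [isZero, eval_plus, eval_minus, eval_reg, eval_lit]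
    omega

/-- Candidates are at least one, so the value 0 of `rBest` can stand for the absence of a
refinement. The best value is the minimum of the candidates even if some costs are missing; only
then it need not be the true cost, which is why `rBad` is reported separately. -/
theorem exec_searchCmd {σ : State} {c : ℕ} {v : Fin n} (h : Ready G H s t D M φ R c v σ)
    {u : Fin n} (hU : σ.reg rU = u)
    (hB : ∀ y : Fin n, σ.arr aB y = boundary G s t (φ c) (comp (φ c) (R c) v) y) :
    ((searchCmd.exec σ).reg rBad = 0 ↔ Known G s t M φ R (σ.matrix n aW) c v u) ∧
    ((searchCmd.exec σ).reg rBest ≠ 0 ↔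
      ∃ p < M, Matches G s t (φ c) (comp (φ c) (R c) v) u (φ p)) ∧
    ((searchCmd.exec σ).reg rBest ≠ 0 →
      IsBest G H s t M φ R (σ.matrix n aW) c v u ((searchCmd.exec σ).reg rBest)) := by
  set C := comp (φ c) (R c) v with hC
  set W := σ.matrix n aW with hW
  let I : ℕ → State → Prop := fun k τ =>
    (τ.reg rBad = 0 ↔ ∀ p < k, Matches G s t (φ c) C u (φ p) →
      ∀ w, IsRep (φ p) (R p) w → w ∈ C → W p w ≠ 0) ∧
    (τ.reg rBest ≠ 0 ↔ ∃ p < k, Matches G s t (φ c) C u (φ p)) ∧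
    (τ.reg rBest ≠ 0 → (∃ p < k, Matches G s t (φ c) C u (φ p) ∧
        candidate H (φ p) (R p) C u (W p) = τ.reg rBest) ∧
      ∀ p < k, Matches G s t (φ c) C u (φ p) →
        τ.reg rBest ≤ candidate H (φ p) (R p) C u (W p))
  have main : I M (searchCmd.exec σ) := by
    rw [searchCmd, exec_seq, exec_seq, exec_assign, exec_assign]
    have h₁ : Ready G H s t D M φ R c v ((σ.setReg rBad 0).setReg rBest 0) :=
      h.of_frame (frame_exec (seq (assign rBad (.lit 0)) (assign rBest (.lit 0))) σ)
        (by decide) (by decide)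
    refine exec_count I h₁.loaded.M_eq (fun k j τ hI => by simpa [I] using hI) (by simp [I])
      (fun k τ hk hF hx hI => ?_)
    have hτ := h₁.of_frame hF (by decide) (by decide)
    have hU' : τ.reg rU = u := (hF.1 _ (by decide)).trans (by simpa using hU)
    have hB' : τ.arr aB = σ.arr aB := hF.2 _ (by decide)
    have hW' : τ.arr aW = σ.arr aW := hF.2 _ (by decide)
    have hmis := exec_mismatchCmd (ψ := φ c) (C := C) hτ.loaded hk hx hU'
      (fun y => by rw [hB']; exact hB y)
    have hρ := hτ.exec (p := mismatchCmd) (by decide) (by decide)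
    have e1 : (mismatchCmd.exec τ).reg rP = k := (exec_reg _ (by decide)).trans hx
    have e2 : (mismatchCmd.exec τ).reg rU = u := (exec_reg _ (by decide)).trans hU'
    have e3 : (mismatchCmd.exec τ).reg rBad = τ.reg rBad := exec_reg _ (by decide)
    have e4 : (mismatchCmd.exec τ).reg rBest = τ.reg rBest := exec_reg _ (by decide)
    have e5 : (mismatchCmd.exec τ).matrix n aW = W := by
      unfold State.matrix; rw [exec_arr _ (by decide), hW']; rfl
    rw [exec_seq, exec_whenZero_iff (e := .reg rMis) hmis]
    generalize mismatchCmd.exec τ = ρ at *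
    obtain ⟨i1, i2, i3⟩ := hI
    split_ifs with hM
    · obtain ⟨c1, c2⟩ := exec_candidateCmd hρ hk e1 e2
      have c3 : (candidateCmd.exec ρ).reg rBest = τ.reg rBest :=
        (exec_reg _ (by decide)).trans e4
      have b1 := exec_bestCmd (candidateCmd.exec ρ)
      have b2 : (bestCmd.exec (candidateCmd.exec ρ)).reg rBad = (candidateCmd.exec ρ).reg rBad :=
        exec_reg _ (by decide)
      rw [exec_seq]
      rw [e5, ← hC] at c1 c2
      rw [c1, c3] at b1
      simp only [I, b1, b2, c2, e3, i1]
      have hpos : 1 ≤ candidate H (φ k) (R k) C u (W k) := by simp only [candidate]; omega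
      refine ⟨?_, ?_, ?_⟩
      · constructor
        · rintro ⟨h1, h2⟩ p hp hmp
          rcases Nat.lt_succ_iff_lt_or_eq.1 hp with hp | rfl
          · exact h1 p hp hmp
          · exact h2
        · exact fun h1 => ⟨fun p hp => h1 p (by omega), h1 k (by omega) hM⟩
      · constructor
        · exact fun _ => ⟨k, by omega, hM⟩
        · intro _
          split_ifs <;> omega
      · intro _
        constructor
        · split_ifs with hlt
          · exact ⟨k, by omega, hM, rfl⟩
          · obtain ⟨⟨p, hp, h1⟩, -⟩ := i3 (by omega)
            exact ⟨p, by omega, h1⟩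
        · intro p hp hmp
          rcases Nat.lt_succ_iff_lt_or_eq.1 hp with hp | rfl
          · have h1 := (i3 (i2.2 ⟨p, hp, hmp⟩)).2 p hp hmp
            have h2 := i2.2 ⟨p, hp, hmp⟩
            split_ifs <;> omega
          · split_ifs <;> omega
    · have hlt : ∀ p, p < k + 1 → Matches G s t (φ c) C u (φ p) → p < k := fun p hp hmp => by
        rcases Nat.lt_succ_iff_lt_or_eq.1 hp with hp | rfl
        · exact hp
        · exact absurd hmp hM
      simp only [I, e3, e4, i1]
      refine ⟨⟨fun h1 p hp hmp => h1 p (hlt p hp hmp) hmp, fun h1 p hp => h1 p (by omega)⟩,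
        i2.trans ⟨fun ⟨p, hp, h1⟩ => ⟨p, by omega, h1⟩, fun ⟨p, hp, h1⟩ => ⟨p, hlt p hp h1, h1⟩⟩,
        fun h1 => ?_⟩
      obtain ⟨⟨p, hp, h2⟩, h3⟩ := i3 h1
      exact ⟨⟨p, by omega, h2⟩, fun p hp hmp => h3 p (hlt p hp hmp) hmp⟩
  exact main

end Spec

/-! ### Rounds of the dynamic programming and the cost of the whole graph -/

section Spec

open Classical

variable {n : ℕ} {G H : SimpleGraph (Fin n)} {s t : Fin n} {D K M : ℕ}
  {φ : ℕ → Fin n → ℕ} {R : ℕ → Fin n → Fin n}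

theorem exec_vertexCmd {σ : State} {c : ℕ} {v : Fin n} (h : Ready G H s t D M φ R c v σ)
    {u : Fin n} (hU : σ.reg rU = u)
    (hB : ∀ y : Fin n, σ.arr aB y = boundary G s t (φ c) (comp (φ c) (R c) v) y) :
    if u ∈ comp (φ c) (R c) v ∧ Known G s t M φ R (σ.matrix n aW) c v u ∧
      ∃ p < M, Matches G s t (φ c) (comp (φ c) (R c) v) u (φ p)
    then IsBest G H s t M φ R (σ.matrix n aW) c v u ((vertexCmd.exec σ).matrix n aW c v) ∧
      ∀ c' v', (c', v') ≠ (c, v) → (vertexCmd.exec σ).matrix n aW c' v' = σ.matrix n aW c' v'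
    else (vertexCmd.exec σ).matrix n aW = σ.matrix n aW := by
  rw [vertexCmd, exec_whenZero_iff (h.loaded.mem_comp_iff h.c_eq h.lt hU h.v_eq)]
  by_cases hu : u ∈ comp (φ c) (R c) v
  swap
  · simp [hu]
  obtain ⟨s1, s2, s3⟩ := exec_searchCmd h hU hB
  have hρ := h.exec (p := searchCmd) (by decide) (by decide)
  have hW : (searchCmd.exec σ).arr aW = σ.arr aW := exec_arr _ (by decide)
  rw [if_pos hu, exec_seq, exec_whenZero_iff (P := Known G s t M φ R (σ.matrix n aW) c v u ∧
    ∃ p < M, Matches G s t (φ c) (comp (φ c) (R c) v) u (φ p))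
    (by rw [eval_plus, Nat.add_eq_zero_iff, isZero_eq_zero, eval_reg, eval_reg, s1, s2])]
  generalize searchCmd.exec σ = ρ at *
  by_cases hK : Known G s t M φ R (σ.matrix n aW) c v u ∧
    ∃ p < M, Matches G s t (φ c) (comp (φ c) (R c) v) u (φ p)
  · rw [if_pos ⟨hu, hK⟩, if_pos hK, exec_store, hρ.loaded.eval_pos hρ.c_eq hρ.lt hρ.v_eq, eval_reg]
    refine ⟨?_, fun c' v' hne => ?_⟩
    · have := s3 (s2.2 hK.2)
      simpa [State.matrix] using this
    · simp only [State.matrix, State.setArr_arr, index_inj]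
      rw [if_neg, hW]
      rintro ⟨-, rfl, rfl⟩
      exact hne rfl
  · rw [if_neg (fun h => hK h.2), if_neg hK]
    unfold State.matrix
    rw [hW]

variable (G H s t D M φ R) in
/-- The costs `W` arise from `W₀` by trying to compute the costs of the components with
`done`. -/
structure Stepped (W₀ W : ℕ → Fin n → ℕ) (done : ℕ → Fin n → Fin n → Prop) : Prop where
  sound : Sound G H s t D M φ R W
  mono : ∀ c < M, ∀ v, W₀ c v ≠ 0 → W c v ≠ 0
  progress : ∀ c < M, ∀ v u, done c v u → IsRep (φ c) (R c) v → u ∈ comp (φ c) (R c) v →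
    Known G s t M φ R W₀ c v u →
    (∃ p < M, Matches G s t (φ c) (comp (φ c) (R c) v) u (φ p)) → W c v ≠ 0

/-- The standing assumptions on the table of partial labellings. -/
structure Setup (G H : SimpleGraph (Fin n)) (s t : Fin n) (D K M : ℕ) (φ : ℕ → Fin n → ℕ)
    (R : ℕ → Fin n → Fin n) : Prop where
  le : H ≤ G
  pos : 1 ≤ D
  ne : s ≠ t
  table : IsTable s t D K M φ
  comp : ∀ c < M, IsComp G (φ c) (R c)

theorem Stepped.of_imp {W₀ W : ℕ → Fin n → ℕ} {done done' : ℕ → Fin n → Fin n → Prop}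
    (h : Stepped G H s t D M φ R W₀ W done)
    (hd : ∀ c v u, IsRep (φ c) (R c) v → done' c v u → done c v u) :
    Stepped G H s t D M φ R W₀ W done' :=
  ⟨h.sound, h.mono, fun c hc v u hdone hv => h.progress c hc v u (hd c v u hv hdone) hv⟩

/-- A known cost may be overwritten through another choice of u, but only by a correct value, and it
never becomes unknown. So whatever was known at the beginning of the round is still available, and
an attempt that would have succeeded then succeeds now. -/
theorem Stepped.vertexCmd (hS : Setup G H s t D K M φ R) {W₀ : ℕ → Fin n → ℕ}
    {done : ℕ → Fin n → Fin n → Prop} {σ : State} {c : ℕ} {v : Fin n}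
    (h : Ready G H s t D M φ R c v σ) {u : Fin n} (hU : σ.reg rU = u)
    (hB : ∀ y : Fin n, σ.arr aB y = boundary G s t (φ c) (comp (φ c) (R c) v) y)
    (hI : Stepped G H s t D M φ R W₀ (σ.matrix n aW) done) :
    Stepped G H s t D M φ R W₀ ((vertexCmd.exec σ).matrix n aW)
      fun c' v' u' => done c' v' u' ∨ c' = c ∧ v' = v ∧ u' = u := by
  have hv := exec_vertexCmd h hU hB
  split_ifs at hv with hK
  · obtain ⟨h1, h2⟩ := hI.sound.update hS.le hS.pos hS.table hS.comp h.lt hK.1 hK.2.1 hv.1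
      (fun c' _ v' => hv.2 c' v')
    have hmono : ∀ c' v', σ.matrix n aW c' v' ≠ 0 →
        (LBCut.vertexCmd.exec σ).matrix n aW c' v' ≠ 0 := by
      intro c' v' hne
      by_cases he : (c', v') = (c, v)
      · obtain ⟨rfl, rfl⟩ := Prod.mk.inj he
        exact h2
      · rwa [hv.2 c' v' he]
    refine ⟨h1, fun c' hc' v' hne => hmono c' v' (hI.mono c' hc' v' hne), ?_⟩
    rintro c' hc' v' u' (hd | ⟨rfl, rfl, rfl⟩) hr hu hk hm
    · exact hmono c' v' (hI.progress c' hc' v' u' hd hr hu hk hm)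
    · exact h2
  · rw [hv]
    refine ⟨hI.sound, hI.mono, ?_⟩
    rintro c' hc' v' u' (hd | ⟨rfl, rfl, rfl⟩) hr hu hk hm
    · exact hI.progress c' hc' v' u' hd hr hu hk hm
    · exact absurd ⟨hu, fun p hp hmp w hw hwC => hI.mono p hp w (hk p hp hmp w hw hwC), hm⟩ hK

theorem Stepped.compCmd (hS : Setup G H s t D K M φ R) {W₀ : ℕ → Fin n → ℕ}
    {done : ℕ → Fin n → Fin n → Prop} {σ : State} {c : ℕ} {v : Fin n}
    (h : Ready G H s t D M φ R c v σ)
    (hI : Stepped G H s t D M φ R W₀ (σ.matrix n aW) done) :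
    Stepped G H s t D M φ R W₀ ((compCmd.exec σ).matrix n aW)
      fun c' v' u' => done c' v' u' ∨ c' = c ∧ v' = v := by
  rw [LBCut.compCmd, exec_whenZero_iff (h.loaded.isRep_iff h.c_eq h.lt h.v_eq)]
  split_ifs with hr
  swap
  · refine hI.of_imp ?_
    rintro c' v' u' hr' (hd | ⟨rfl, rfl⟩)
    · exact hd
    · exact absurd hr' hr
  have hρ := h.exec (p := boundaryCmd) (by decide) (by decide)
  have hB := exec_boundaryCmd h.loaded h.lt h.c_eq h.v_eq
  have hW : (boundaryCmd.exec σ).matrix n aW = σ.matrix n aW := by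
    unfold State.matrix; rw [exec_arr _ (by decide)]
  rw [exec_seq]
  generalize boundaryCmd.exec σ = ρ at *
  have := exec_count (x := rU) (b := rN) (p := LBCut.vertexCmd) (σ := ρ)
    (fun k τ => Stepped G H s t D M φ R W₀ (τ.matrix n aW)
      fun c' v' u' => done c' v' u' ∨ c' = c ∧ v' = v ∧ u' < k) hρ.loaded.n_eq
    (fun k j τ hI => hI) (by simpa [hW] using hI) (fun k τ hk hF hx hI => by
      have hτ := hρ.of_frame hF (by decide) (by decide)
      have := hI.vertexCmd hS hτ (u := ⟨k, hk⟩) hx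
        (fun y => by rw [hF.2 _ (by decide)]; exact hB y)
      refine this.of_imp ?_
      rintro c' v' u' - (hd | ⟨h1, h2, h3⟩)
      · exact .inl (.inl hd)
      · rcases Nat.lt_succ_iff_lt_or_eq.1 h3 with h3 | h3
        · exact .inl (.inr ⟨h1, h2, h3⟩)
        · exact .inr ⟨h1, h2, Fin.ext h3⟩)
  exact this.of_imp fun c' v' u' _ hd => hd.imp id fun hd => ⟨hd.1, hd.2, u'.2⟩

theorem Stepped.roundCmd (hS : Setup G H s t D K M φ R) {σ : State}
    (h : Loaded G s t D M φ R σ) (hH : HasGraph H aH σ)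
    (hI : Sound G H s t D M φ R (σ.matrix n aW)) :
    Stepped G H s t D M φ R (σ.matrix n aW) ((roundCmd.exec σ).matrix n aW)
      fun c' _ _ => c' < M := by
  refine exec_count (x := rC) (b := rM) (p := count rV rN LBCut.compCmd) (σ := σ)
    (fun k τ => Stepped G H s t D M φ R (σ.matrix n aW) (τ.matrix n aW)
      fun c' _ _ => c' < k) h.M_eq (fun k j τ hI => hI)
    ⟨hI, fun _ _ _ h => h, fun _ _ _ _ h => absurd h (by omega)⟩ (fun c τ hc hF hx hI => ?_)
  have hτ := h.of_frame hF (by decide) (by decide)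
  have hHτ := hH.of_arr_eq (hF.2 _ (by decide))
  have := exec_count (x := rV) (b := rN) (p := LBCut.compCmd) (σ := τ)
    (fun k τ => Stepped G H s t D M φ R (σ.matrix n aW) (τ.matrix n aW)
      fun c' v' _ => c' < c ∨ c' = c ∧ v' < k) hτ.n_eq (fun k j τ hI => hI)
    (by simpa using hI) (fun k ρ hk hG hy hJ => by
      have hρ := hτ.of_frame hG (by decide) (by decide)
      have hHρ := hHτ.of_arr_eq (hG.2 _ (by decide))
      have := hJ.compCmd (v := ⟨k, hk⟩) hS ⟨hρ, hHρ, hc, (hG.1 _ (by decide)).trans hx, hy⟩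
      refine this.of_imp ?_
      rintro c' v' u' - (hd | ⟨h1, h2⟩)
      · exact .inl (.inl hd)
      · rcases Nat.lt_succ_iff_lt_or_eq.1 h2 with h2 | h2
        · exact .inl (.inr ⟨h1, h2⟩)
        · exact .inr ⟨h1, Fin.ext h2⟩)
  refine this.of_imp fun c' v' u' _ hd => ?_
  rcases Nat.lt_succ_iff_lt_or_eq.1 hd with hd | hd
  · exact .inl hd
  · exact .inr ⟨hd, v'.2⟩

/-- After `r` rounds the costs of all solvable components with at most `r` vertices are known. -/
theorem exec_rounds (hS : Setup G H s t D K M φ R) {σ : State}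
    (h : Loaded G s t D M φ R σ) (hH : HasGraph H aH σ)
    (hI : Sound G H s t D M φ R (σ.matrix n aW)) :
    Sound G H s t D M φ R (((count rRound rN roundCmd).exec σ).matrix n aW) ∧
    ∀ c < M, ∀ v, IsRep (φ c) (R c) v → Solvable G s t M φ R c v →
      ((count rRound rN roundCmd).exec σ).matrix n aW c v ≠ 0 := by
  have := exec_count (x := rRound) (b := rN) (p := roundCmd) (σ := σ)
    (fun r τ => Sound G H s t D M φ R (τ.matrix n aW) ∧
      ∀ c < M, ∀ v, IsRep (φ c) (R c) v → Solvable G s t M φ R c v →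
        (comp (φ c) (R c) v).ncard ≤ r → τ.matrix n aW c v ≠ 0) h.n_eq (fun k j τ hI => hI)
    ⟨hI, fun c hc v hv _ h0 => by
      rw [Nat.le_zero, Set.ncard_eq_zero] at h0
      exact absurd (show v ∈ comp (φ c) (R c) v from hv) (h0 ▸ Set.notMem_empty v)⟩
    (fun r τ hr hF hx hI => by
      have hst := Stepped.roundCmd hS (h.of_frame hF (by decide) (by decide))
        (hH.of_arr_eq (hF.2 _ (by decide))) hI.1
      refine ⟨hst.sound, fun c hc v hv hsol hcard => ?_⟩
      -- Solvability provides a vertex u such that all components arising from labelling it are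
      -- solvable and strictly smaller, so that their costs are known after r rounds.
      cases hsol with
      | intro _ _ u hu hm hk =>
      refine hst.progress c hc v u hc hv hu (fun p hp hmp w hw hwC => ?_) hm
      refine hI.2 p hp w hw (hk p hp hmp w hw hwC) ?_
      have := Set.ncard_lt_ncard (hmp.comp_ssubset (hS.comp c hc) (hS.comp p hp) hu hwC)
        (Set.toFinite _)
      omega)
  -- No component has more than n vertices, so n rounds suffice.
  refine ⟨this.1, fun c hc v hv hsol => this.2 c hc v hv hsol ?_⟩
  have := Set.ncard_le_card (comp (φ c) (R c) v)
  simpa using this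

/-- Costs from an earlier choice of H are no longer valid. The table without any known cost is sound
for trivial reasons. -/
theorem exec_clearCmd {σ : State} (h : Loaded G s t D M φ R σ) :
    ∀ c < M, ∀ v, (clearCmd.exec σ).matrix n aW c v = 0 := by
  refine exec_count (x := rC) (b := rM) (p := count rV rN (store aW (pos rC rV) (.lit 0))) (σ := σ)
    (fun k τ => ∀ c < k, ∀ v, τ.matrix n aW c v = 0) h.M_eq (fun k j τ hI => hI)
    (fun c hc => absurd hc (by omega)) (fun c τ hc hF hx hI => ?_)
  have hτ := h.of_frame hF (by decide) (by decide)
  have := exec_count (x := rV) (b := rN) (p := store aW (pos rC rV) (.lit 0)) (σ := τ)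
    (fun k τ => ∀ c' (v : Fin n), (c' < c ∨ c' = c ∧ (v : ℕ) < k) → τ.matrix n aW c' v = 0) hτ.n_eq
    (fun k j τ hI => hI) (fun c' v hd => hI c' (by simpa using hd) v)
    (fun k ρ hk hG hy hJ c' v hd => by
      obtain ⟨z, rfl⟩ : ∃ z : Fin n, (z : ℕ) = k := ⟨⟨k, hk⟩, rfl⟩
      have hρ := hτ.of_frame hG (by decide) (by decide)
      have hC : ρ.reg rC = c := (hG.1 _ (by decide)).trans hx
      rw [exec_store, hρ.eval_pos hC hc hy]
      simp only [State.matrix, State.setArr_arr, index_inj, eval_lit, true_and]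
      split_ifs with he
      · rfl
      · refine hJ c' v ?_
        rcases hd with hd | ⟨h1, h2⟩
        · exact .inl hd
        · refine .inr ⟨h1, ?_⟩
          rcases Nat.lt_succ_iff_lt_or_eq.1 h2 with h2 | h2
          · exact h2
          · exact absurd ⟨h1, Fin.ext h2⟩ he)
  intro c' hc' v
  refine this c' v ?_
  rcases Nat.lt_succ_iff_lt_or_eq.1 hc' with hd | hd
  · exact .inl hd
  · exact .inr ⟨hd, v.2⟩

theorem exec_rootCmd (hS : Setup G H s t D K M φ R) {σ : State} (h : Loaded G s t D M φ R σ)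
    (hH : HasGraph H aH σ) :
    (rootCmd.exec σ).reg rVal = if ∀ v, IsRep (φ 0) (R 0) v → σ.matrix n aW 0 v ≠ 0 then
      1 + (2 * pairCost H (φ 0) s t +
        ∑ x, if IsRep (φ 0) (R 0) x then σ.matrix n aW 0 x - 1 else 0) else 0 := by
  have hM := hS.table.pos
  have hadm := hS.table.partialAdmissible 0 hM
  rw [rootCmd]
  simp only [exec_seq, exec_assign, eval_lit]
  set σ₁ := ((σ.setReg rP 0).setReg rBad 0).setReg rSum 1 with hσ₁
  have h₁ : Loaded G s t D M φ R σ₁ :=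
    ((h.setReg (by decide)).setReg (by decide)).setReg (by decide)
  have hH₁ : HasGraph H aH σ₁ := hH
  have hW₁ : σ₁.matrix n aW = σ.matrix n aW := rfl
  have hsum : ((whenZero (.plus (isZero (mat aH rS rT)) (.minus (.lit 3) (.reg rD)))
      (incr rSum (.lit 2))).exec σ₁).reg rSum = 1 + 2 * pairCost H (φ 0) s t := by
    rw [exec_whenZero_iff (P := H.Adj s t ∧ 1 < (φ 0 s - φ 0 t) + (φ 0 t - φ 0 s))]
    · simp only [pairCost]
      split_ifs <;> simp [hσ₁]
    · rw [eval_plus, Nat.add_eq_zero_iff, isZero_eq_zero, h₁.eval_graph hH₁ h₁.s_eq h₁.t_eq,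
        eval_minus, eval_lit, eval_reg, h₁.D_eq, hadm.1, hadm.2.1]
      -- The terminals have the labels 1 and D, which differ by more than one exactly if D is at
      -- least 3.
      have : 3 - D = 0 ↔ 1 < (1 - D) + (D - 1) := by omega
      rw [this]
      simp
  have hfr := frame_exec (whenZero (.plus (isZero (mat aH rS rT)) (.minus (.lit 3) (.reg rD)))
      (incr rSum (.lit 2))) σ₁
  generalize (whenZero (.plus (isZero (mat aH rS rT)) (.minus (.lit 3) (.reg rD)))
      (incr rSum (.lit 2))).exec σ₁ = ρ at *
  have hρ := h₁.of_frame hfr (by decide) (by decide)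
  have hP : ρ.reg rP = 0 := (hfr.1 _ (by decide)).trans (by simp [hσ₁])
  have hB : ρ.reg rBad = 0 := (hfr.1 _ (by decide)).trans (by simp [hσ₁])
  have hWρ : ρ.matrix n aW = σ.matrix n aW := by
    rw [← hW₁]; unfold State.matrix; rw [hfr.2 _ (by decide)]
  obtain ⟨r1, r2⟩ := exec_sumComp hρ hM hP (Q := IsRep (φ 0) (R 0))
    (e := .plus (mat aT rP rW) (absDiff (mat aR rP rW) (.reg rW))) (fun w τ hF hx =>
      (hρ.of_frame hF (by decide) (by decide)).isRep_iff ((hF.1 _ (by decide)).trans hP) hM hx)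
  have hbad : ((count rW rN (whenZero (.plus (mat aT rP rW) (absDiff (mat aR rP rW) (.reg rW)))
      addCompCmd)).exec ρ).reg rBad ≠ 0 ↔
      ¬∀ v, IsRep (φ 0) (R 0) v → σ.matrix n aW 0 v ≠ 0 := by
    rw [r2, hB, zero_add, Ne, hWρ]
    exact not_congr sum_sub_eq_zero_iff
  rw [exec_ite_iff (e := .reg rBad) hbad, ite_not]
  split_ifs
  · rw [exec_assign, eval_reg, r1, hsum, hWρ, add_assoc]
    simp
  · simp

/-- The value computed by `costCmd`. -/
theorem exec_costCmd (hS : Setup G H s t D K M φ R) {σ : State} (h : Loaded G s t D M φ R σ)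
    (hH : HasGraph H aH σ) :
    ((costCmd.exec σ).reg rVal ≠ 0 → IsOpt H s t D ((costCmd.exec σ).reg rVal - 1)) ∧
    ((costCmd.exec σ).reg rVal ≠ 0 ↔ ∀ v, IsRep (φ 0) (R 0) v → Solvable G s t M φ R 0 v) := by
  have hM := hS.table.pos
  rw [costCmd, exec_seq, exec_seq]
  have hclear := exec_clearCmd h
  have h₁ := h.exec (p := clearCmd) (by decide) (by decide)
  have hH₁ := hH.of_arr_eq (exec_arr clearCmd (σ := σ) (a := aH) (by decide))
  generalize clearCmd.exec σ = ρ at *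
  obtain ⟨hsound, hknown⟩ := exec_rounds hS h₁ hH₁ (fun c hc v _ hne => absurd (hclear c hc v) hne)
  have h₂ := h₁.exec (p := count rRound rN roundCmd) (by decide) (by decide)
  have hH₂ := hH₁.of_arr_eq (exec_arr (count rRound rN roundCmd) (σ := ρ) (a := aH) (by decide))
  generalize (count rRound rN roundCmd).exec ρ = τ at *
  rw [exec_rootCmd hS h₂ hH₂]
  -- Soundness includes solvability of what is known, and the rounds make known what is solvable.
  -- The resulting criterion does not mention H, so a table that suffices for G suffices for every
  -- subgraph tried later.
  have hiff : (∀ v, IsRep (φ 0) (R 0) v → τ.matrix n aW 0 v ≠ 0) ↔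
      ∀ v, IsRep (φ 0) (R 0) v → Solvable G s t M φ R 0 v :=
    ⟨fun hk v hv => (hsound 0 hM v hv (hk v hv)).2, fun hk v hv => hknown 0 hM v hv (hk v hv)⟩
  rw [← hiff]
  split_ifs with hk
  · refine ⟨fun _ => ?_, by simpa using hk⟩
    rw [Nat.add_sub_cancel_left]
    exact (leastCost_univ hS.le hS.pos hS.ne hS.table hS.comp hsound hk).isOpt
      (hS.table.partialAdmissible 0 hM) hS.table.zero_ne
  · exact ⟨fun h => absurd rfl h, by simpa using hk⟩

end Spec

/-! ## The whole program -/

/-- Append to the table the labelling `c` with the new label `l + 1` at `v`. -/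
def appendCmd : Cmd :=
  seq (store aRow (.reg rM) (.reg rOff))
    (seq (count rY rN (store aT (.plus (.reg rOff) (.reg rY)) (mat aT rC rY)))
    (seq (store aT (.plus (.reg rOff) (.reg rV)) (.plus (.reg rU) (.lit 1)))
    (seq (store aT (.plus (.reg rOff) (.reg rS)) (.lit 1))
    (seq (store aT (.plus (.reg rOff) (.reg rT)) (.reg rD))
    (seq (incr rOff (.reg rN)) (incr rM (.lit 1)))))))

/-- Append to the table all the labellings that differ from one of the first `M₀` in one label. -/
def extendCmd : Cmd := count rC rM₀ (count rV rN (count rU rD appendCmd))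

/-- Give the vertices with the representative `a` the representative `b`. -/
def mergeCmd : Cmd :=
  count rW rN (whenZero (absDiff (mat aR rC rW) (.reg rA)) (store aR (pos rC rW) (.reg rB)))

/-- Give the ends of the edge `xy` the same representative if both are unlabelled. -/
def linkCmd : Cmd :=
  whenZero (.plus (isZero (mat aG rX rY)) (.plus (mat aT rC rX) (mat aT rC rY)))
    (seq (assign rA (mat aR rC rX)) (seq (assign rB (mat aR rC rY)) mergeCmd))

/-- Compute the components of all partial labellings. -/
def componentsCmd : Cmd :=
  count rC rM (seq (count rW rN (store aR (pos rC rW) (.reg rW)))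
    (count rX rN (count rY rN linkCmd)))

/-- Try to delete the edge `ij`. -/
def edgeCmd : Cmd :=
  whenZero (isZero (mat aH rI rJ)) (seq (store aH (pos rI rJ) (.lit 0))
    (seq (store aH (pos rJ rI) (.lit 0)) (seq costCmd
    (ite (.minus (.reg rCur) (.plus (.reg rVal) (.lit 1)))
      (seq (assign rCur (.reg rVal))
        (seq (store aOut (pos rI rJ) (.lit 1)) (store aOut (pos rJ rI) (.lit 1))))
      (seq (store aH (pos rI rJ) (.lit 1)) (store aH (pos rJ rI) (.lit 1)))))))

/-- Delete as many edges as possible. -/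
def edgesCmd : Cmd := seq (assign rCur (.reg rVal)) (count rI rN (count rJ rN edgeCmd))

/-- Set up the storage. -/
def initCmd : Cmd :=
  seq (assign rD (.plus (.minus (.reg rN) (.minus (.reg rN) (.plus (.reg rL) (.lit 1)))) (.lit 1)))
    (seq (count rI rN (seq (store aRow (.reg rI) (.reg rOff)) (incr rOff (.reg rN))))
    (seq (count rI rN (count rJ rN (store aH (pos rI rJ) (mat aG rI rJ))))
    (seq (store aT (.reg rS) (.lit 1)) (seq (store aT (.reg rT) (.reg rD))
    (seq (assign rM (.lit 1)) (assign rOff (.reg rN)))))))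

/-! ### Enlarging the table of partial labellings -/

section Spec

open Classical

variable {n : ℕ} {G H : SimpleGraph (Fin n)} {s t : Fin n} {D K M : ℕ}
  {φ : ℕ → Fin n → ℕ} {R : ℕ → Fin n → Fin n}

/-- The storage contains the graph and the partial labellings. -/
structure Tabled (G : SimpleGraph (Fin n)) (s t : Fin n) (D M : ℕ) (φ : ℕ → Fin n → ℕ)
    (σ : State) : Prop where
  n_eq : σ.reg rN = n
  s_eq : σ.reg rS = s
  t_eq : σ.reg rT = t
  D_eq : σ.reg rD = D
  M_eq : σ.reg rM = M
  off_eq : σ.reg rOff = M * n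
  row : ∀ i, i < n ∨ i < M → σ.arr aRow i = i * n
  graph : HasGraph G aG σ
  label : ∀ c < M, ∀ v : Fin n, σ.arr aT (c * n + v) = φ c v

theorem Tabled.of_frame {p : Cmd} {σ τ : State} (h : Tabled G s t D M φ σ) (hf : p.Frame σ τ)
    (hr : ∀ x ∈ [rN, rS, rT, rD, rM, rOff], x ∉ p.wregs)
    (ha : ∀ a ∈ [aG, aRow, aT], a ∉ p.warrs) : Tabled G s t D M φ τ := by
  simp only [List.forall_mem_cons] at hr ha
  obtain ⟨r0, r1, r2, r3, r4, r5, -⟩ := hr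
  obtain ⟨a0, a1, a2, -⟩ := ha
  constructor
  · rw [hf.1 _ r0, h.n_eq]
  · rw [hf.1 _ r1, h.s_eq]
  · rw [hf.1 _ r2, h.t_eq]
  · rw [hf.1 _ r3, h.D_eq]
  · rw [hf.1 _ r4, h.M_eq]
  · rw [hf.1 _ r5, h.off_eq]
  · rw [hf.2 _ a1]; exact h.row
  · exact h.graph.of_arr_eq (hf.2 _ a0)
  · rw [hf.2 _ a2]; exact h.label

theorem Tabled.setReg {σ : State} (h : Tabled G s t D M φ σ) {x j : ℕ}
    (hx : x ∉ [rN, rS, rT, rD, rM, rOff]) : Tabled G s t D M φ (σ.setReg x j) :=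
  h.of_frame (p := assign x (.lit j)) (frame_exec _ σ)
    (fun y hy => by simp only [wregs, List.mem_singleton]; rintro rfl; exact hx hy)
    (by simp [warrs])

/-- The partial labelling that arises from `ψ` by giving `v` the label `l`, and by restoring the
labels of `s` and `t`. -/
noncomputable def relabel (s t : Fin n) (D : ℕ) (ψ : Fin n → ℕ) (v : Fin n) (l : ℕ) (y : Fin n) :
    ℕ :=
  if y = t then D else if y = s then 1 else if y = v then l else ψ y

theorem Tabled.eval_label {σ : State} (h : Tabled G s t D M φ σ) {r q c : ℕ} {v : Fin n}
    (hr : σ.reg r = c) (hc : c < M) (hq : σ.reg q = v) : (mat aT r q).eval σ = φ c v := by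
  rw [LBCut.eval_mat, hr, hq, h.row c (.inr hc), h.label c hc]

theorem exec_appendCmd {σ : State} (h : Tabled G s t D M φ σ) {c : ℕ} (hc : c < M)
    (hC : σ.reg rC = c) {v : Fin n} (hV : σ.reg rV = v) {l : ℕ} (hU : σ.reg rU = l) :
    Tabled G s t D (M + 1) (Function.update φ M (relabel s t D (φ c) v (l + 1)))
      (appendCmd.exec σ) := by
  -- The copy is written to row M, whereas its source is a row c < M, which therefore stays intact
  -- during the copying.
  have hcopy : ∀ τ : State, Tabled G s t D M φ τ → τ.reg rC = c →
      ∀ (a : ℕ) (y : Fin n), a ≤ M →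
        ((count rY rN (store aT (.plus (.reg rOff) (.reg rY)) (mat aT rC rY))).exec τ).arr aT
          (a * n + y) = if a = M then φ c y else τ.arr aT (a * n + y) := by
    intro τ hτ hC a y ha
    have := exec_count (x := rY) (b := rN)
      (p := store aT (.plus (.reg rOff) (.reg rY)) (mat aT rC rY)) (σ := τ)
      (fun k ρ => ∀ a ≤ M, ∀ y : Fin n, ρ.arr aT (a * n + y) =
        if a = M ∧ (y : ℕ) < k then φ c y else τ.arr aT (a * n + y)) hτ.n_eq
      (fun k j τ hI => hI) (by simp) (fun k ρ hk hF hx hI a ha y => by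
        have e1 : ρ.reg rOff = M * n := (hF.1 _ (by decide)).trans hτ.off_eq
        have e2 : ρ.reg rC = c := (hF.1 _ (by decide)).trans hC
        have e3 : ρ.arr aRow = τ.arr aRow := hF.2 _ (by decide)
        obtain ⟨z, rfl⟩ : ∃ z : Fin n, (z : ℕ) = k := ⟨⟨k, hk⟩, rfl⟩
        have e4 : (mat aT rC rY).eval ρ = φ c z := by
          rw [eval_mat, hx, e2, e3, hτ.row c (.inr hc), hI c hc.le z, if_neg (by omega),
            hτ.label c hc]
        rw [exec_store, e4, eval_plus, eval_reg, eval_reg, e1, hx, State.setArr_arr, hI a ha]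
        simp only [index_inj, true_and]
        by_cases h1 : a = M ∧ y = z
        · obtain ⟨rfl, rfl⟩ := h1
          simp
        · rw [if_neg h1]
          have : (a = M ∧ (y : ℕ) < z + 1) ↔ (a = M ∧ (y : ℕ) < z) := by
            refine and_congr_right fun h2 => ?_
            have : (y : ℕ) ≠ z := fun h3 => h1 ⟨h2, Fin.ext h3⟩
            omega
          simp only [this])
    rw [this a ha y]
    simp
  rw [appendCmd, exec_seq, exec_store, eval_reg, eval_reg, exec_seq]
  have h₁ : Tabled G s t D M φ (σ.setArr aRow (σ.reg rM) (σ.reg rOff)) := by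
    refine ⟨h.n_eq, h.s_eq, h.t_eq, h.D_eq, h.M_eq, h.off_eq, fun i hi => ?_, h.graph, h.label⟩
    rw [State.setArr_arr, h.M_eq, h.off_eq, h.row i hi]
    split_ifs with h1
    · rw [h1.2]
    · rfl
  -- The multiples of n are needed both for vertices and for rows of the table. If M < n the entry
  -- at M is already there and is overwritten by its own value.
  have hrow : ∀ i, i < n ∨ i < M + 1 →
      (σ.setArr aRow (σ.reg rM) (σ.reg rOff)).arr aRow i = i * n := by
    intro i hi
    rw [State.setArr_arr, h.M_eq, h.off_eq]
    split_ifs with h1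
    · rw [h1.2]
    · exact h.row i (by omega)
  have hcp := hcopy _ h₁ hC
  have hfr := frame_exec (count rY rN (store aT (.plus (.reg rOff) (.reg rY)) (mat aT rC rY)))
    (σ.setArr aRow (σ.reg rM) (σ.reg rOff))
  have e0 := (hfr.1 rN (by decide)).trans h₁.n_eq
  have e1 := (hfr.1 rS (by decide)).trans h₁.s_eq
  have e2 := (hfr.1 rT (by decide)).trans h₁.t_eq
  have e3 := (hfr.1 rD (by decide)).trans h₁.D_eq
  have e4 := (hfr.1 rM (by decide)).trans h₁.M_eq
  have e5 := (hfr.1 rOff (by decide)).trans h₁.off_eq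
  have e6 := (hfr.1 rV (by decide)).trans hV
  have e7 := (hfr.1 rU (by decide)).trans hU
  have a0 := hfr.2 aRow (by decide)
  have a1 := h₁.graph.of_arr_eq (hfr.2 aG (by decide))
  rw [← a0] at hrow
  have hlab := h₁.label
  generalize (count rY rN (store aT (.plus (.reg rOff) (.reg rY)) (mat aT rC rY))).exec
    (σ.setArr aRow (σ.reg rM) (σ.reg rOff)) = ρ at *
  refine ⟨by simp [e0], by simp [e1], by simp [e2], by simp [e3], by simp [e4],
    by simp [e5, e0, add_mul], fun i hi => by simpa using hrow i hi, fun x y => ?_,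
    fun c' hc' y => ?_⟩
  · simpa using a1 x y
  · simp only [exec_seq, exec_store, exec_incr, eval_plus, eval_reg, eval_lit, State.setArr_reg,
      State.setReg_reg, State.setReg_arr, State.setArr_arr, e0, e1, e2, e3, e4, e5, e6, e7,
      index_inj, true_and]
    rw [hcp c' y (by omega)]
    by_cases hM : c' = M
    · subst hM
      simp [relabel]
    · have := hlab c' (by omega) y
      rw [Function.update_of_ne hM, ← this]
      simp [hM]

theorem relabel_partialAdmissible (hst : s ≠ t) (hD : 1 ≤ D) {ψ : Fin n → ℕ}
    (hψ : PartialAdmissible s t D ψ) {v : Fin n} {l : ℕ} (hl : l ≤ D) :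
    PartialAdmissible s t D (relabel s t D ψ v l) := by
  refine ⟨by simp [relabel, hst], by simp [relabel], fun y => ?_⟩
  have := hψ.2.2 y
  simp only [relabel]
  split_ifs <;> omega

theorem numLabelled_relabel_le {ψ : Fin n → ℕ} {v : Fin n} {l : ℕ}
    (hψ : numLabelled s t ψ ≤ K) : numLabelled s t (relabel s t D ψ v l) ≤ K + 1 := by
  refine le_trans (Set.ncard_le_ncard (t := insert v {v | (v ≠ s ∧ v ≠ t) ∧ ψ v ≠ 0})
    (fun y hy => ?_) (Set.toFinite _)) ((Set.ncard_insert_le _ _).trans (Nat.add_le_add_right hψ 1))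
  by_cases hyv : y = v
  · exact .inl hyv
  · exact .inr ⟨hy.1, by simpa [relabel, hy.1.1, hy.1.2, hyv] using hy.2⟩

/-- Removing any one of the K + 1 labels gives a labelling that is already in the table. The label
is written as l + 1 with l < D because loop counters start at zero. -/
theorem exists_relabel_eq {ψ : Fin n → ℕ} (hψ : PartialAdmissible s t D ψ)
    (hcard : numLabelled s t ψ = K + 1) :
    ∃ (ψ' : Fin n → ℕ) (v : Fin n) (l : ℕ), PartialAdmissible s t D ψ' ∧
      numLabelled s t ψ' ≤ K ∧ l < D ∧ ψ = relabel s t D ψ' v (l + 1) := by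
  obtain ⟨v, hv⟩ := Set.nonempty_of_ncard_ne_zero
    (show {v | (v ≠ s ∧ v ≠ t) ∧ ψ v ≠ 0}.ncard ≠ 0 by
      change numLabelled s t ψ ≠ 0
      omega)
  have hv2 := hv.2
  refine ⟨Function.update ψ v 0, v, ψ v - 1, ⟨?_, ?_, fun y => ?_⟩, ?_, ?_, ?_⟩
  · rw [Function.update_of_ne hv.1.1.symm, hψ.1]
  · rw [Function.update_of_ne hv.1.2.symm, hψ.2.1]
  · rw [Function.update_apply]
    split_ifs
    · exact Nat.zero_le _
    · exact hψ.2.2 y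
  · have h1 := Set.ncard_sdiff_singleton_of_mem hv
    rw [show {v | (v ≠ s ∧ v ≠ t) ∧ ψ v ≠ 0}.ncard = K + 1 from hcard, Nat.add_sub_cancel] at h1
    rw [← h1]
    refine Set.ncard_le_ncard (fun y hy => ?_) (Set.toFinite _)
    have hy2 := hy.2
    rw [Function.update_apply] at hy2
    by_cases hyv : y = v
    · simp [hyv] at hy2
    · rw [if_neg hyv] at hy2
      exact ⟨⟨hy.1, hy2⟩, hyv⟩
  · have := hψ.2.2 v
    omega
  · funext y
    simp only [relabel, Function.update_apply]
    split_ifs with h1 h2 h3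
    · rw [h1, hψ.2.1]
    · rw [h2, hψ.1]
    · rw [h3]; omega
    · rfl

/-- The storage after appending relabellings of the first `M₀` labellings. -/
def Extended (G : SimpleGraph (Fin n)) (s t : Fin n) (D K M₀ : ℕ) (φ₀ : ℕ → Fin n → ℕ)
    (done : ℕ → ℕ → ℕ → Prop) (count : ℕ) (σ : State) : Prop :=
  ∃ φ, Tabled G s t D (M₀ + count) φ σ ∧ (∀ c < M₀, φ c = φ₀ c) ∧
    (∀ c < M₀ + count, PartialAdmissible s t D (φ c)) ∧
    (∀ c < M₀ + count,
      numLabelled s t (φ c) ≤ K + 1) ∧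
    ∀ c < M₀, ∀ (v : Fin n) (l : ℕ), done c v l →
      ∃ c' < M₀ + count, φ c' = relabel s t D (φ₀ c) v (l + 1)

theorem Extended.of_imp {M₀ : ℕ} {φ₀ : ℕ → Fin n → ℕ} {done done' : ℕ → ℕ → ℕ → Prop}
    {k k' : ℕ} {σ : State} (h : Extended G s t D K M₀ φ₀ done k σ) (hk : k = k')
    (hd : ∀ c (v : Fin n) l, done' c v l → done c v l) :
    Extended G s t D K M₀ φ₀ done' k' σ := by
  subst hk
  obtain ⟨φ, h1, h2, h3, h4, h5⟩ := h
  exact ⟨φ, h1, h2, h3, h4, fun c hc v l hl => h5 c hc v l (hd c v l hl)⟩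

theorem Extended.setReg {M₀ : ℕ} {φ₀ : ℕ → Fin n → ℕ} {done : ℕ → ℕ → ℕ → Prop}
    {k : ℕ} {σ : State} (h : Extended G s t D K M₀ φ₀ done k σ) {x j : ℕ}
    (hx : x ∉ [rN, rS, rT, rD, rM, rOff]) :
    Extended G s t D K M₀ φ₀ done k (σ.setReg x j) := by
  obtain ⟨φ, h1, h2⟩ := h
  exact ⟨φ, h1.setReg hx, h2⟩

theorem Extended.appendCmd (hst : s ≠ t) (hD : 1 ≤ D) {M₀ : ℕ} {φ₀ : ℕ → Fin n → ℕ}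
    (hT : IsTable s t D K M₀ φ₀) {done : ℕ → ℕ → ℕ → Prop} {k : ℕ} {σ : State}
    (h : Extended G s t D K M₀ φ₀ done k σ) {c : ℕ} (hc : c < M₀)
    (hC : σ.reg rC = c) {v : Fin n} (hV : σ.reg rV = v) {l : ℕ} (hl : l < D) (hU : σ.reg rU = l) :
    Extended G s t D K M₀ φ₀ (fun c' v' l' => done c' v' l' ∨ c' = c ∧ v' = v ∧ l' = l) (k + 1)
      (appendCmd.exec σ) := by
  obtain ⟨φ, h1, h2, h3, h4, h5⟩ := h
  have hne : ∀ c' < M₀ + k, c' ≠ M₀ + k := fun c' h => h.ne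
  have hφc := h2 c hc
  refine ⟨_, exec_appendCmd h1 (by omega) hC hV hU, fun c' hc' => ?_, fun c' hc' => ?_,
    fun c' hc' => ?_, ?_⟩
  · rw [Function.update_of_ne (by omega), h2 c' hc']
  · rw [Function.update_apply]
    split_ifs
    · exact relabel_partialAdmissible hst hD (h3 c (by omega)) (by omega)
    · exact h3 c' (by omega)
  · rw [Function.update_apply]
    split_ifs
    · exact numLabelled_relabel_le (hφc ▸ hT.numLabelled_le c hc)
    · exact h4 c' (by omega)
  · rintro c' hc' v' l' (hd | ⟨rfl, hv, rfl⟩)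
    · obtain ⟨c₁, hc₁, h6⟩ := h5 c' hc' v' l' hd
      exact ⟨c₁, by omega, by rw [Function.update_of_ne (hne c₁ hc₁), h6]⟩
    · exact ⟨M₀ + k, by omega, by rw [Function.update_self, hφc, Fin.ext hv]⟩

/-- Each of the M old labellings contributes n · D relabellings, whence the factor 1 + n · D.
Repetitions do no harm, as the table need only be complete. Labellings with at most K labels are
there already; one with K + 1 labels is a relabelling of one with K. -/
theorem exec_extendCmd (hst : s ≠ t) (hD : 1 ≤ D) (hT : IsTable s t D K M φ) {σ : State}
    (h : Tabled G s t D M φ σ) (hM₀ : σ.reg rM₀ = M) :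
    ∃ M' φ', Tabled G s t D M' φ' (extendCmd.exec σ) ∧ IsTable s t D (K + 1) M' φ' ∧
      M' = M * (1 + n * D) := by
  have main : Extended G s t D K M φ (fun c _ l => c < M ∧ l < D) (M * (n * D))
      (extendCmd.exec σ) := by
    refine exec_count (x := rC) (b := rM₀) (p := count rV rN (count rU rD LBCut.appendCmd)) (σ := σ)
      (fun k τ => Extended G s t D K M φ (fun c _ l => c < k ∧ l < D) (k * (n * D)) τ)
      hM₀ (fun k j τ hI => hI.setReg (by decide)) ?_ (fun c τ hc hF hx hI => ?_)
    · refine ⟨φ, by simpa using h, fun _ _ => rfl, by simpa using hT.partialAdmissible, ?_, ?_⟩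
      · intro c hc
        exact (hT.numLabelled_le c (by omega)).trans (Nat.le_succ K)
      · intro c _ v l hd; exact absurd hd.1 (by omega)
    have hNτ : τ.reg rN = n := (hF.1 _ (by decide)).trans h.n_eq
    have hDτ : τ.reg rD = D := (hF.1 _ (by decide)).trans h.D_eq
    have := exec_count (x := rV) (b := rN) (p := count rU rD LBCut.appendCmd) (σ := τ)
      (fun k τ => Extended G s t D K M φ
        (fun c' v' l => (c' < c ∨ c' = c ∧ v' < k) ∧ l < D) (c * (n * D) + k * D) τ)
      hNτ (fun k j τ hI => hI.setReg (by decide)) (hI.of_imp (by simp) (by simp))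
      (fun v ρ hv hG hy hJ => by
        have hDρ : ρ.reg rD = D := (hG.1 _ (by decide)).trans hDτ
        have hCρ : ρ.reg rC = c := (hG.1 _ (by decide)).trans hx
        have := exec_count (x := rU) (b := rD) (p := LBCut.appendCmd) (σ := ρ)
          (fun k τ => Extended G s t D K M φ
            (fun c' v' l => (c' < c ∨ c' = c ∧ v' < v) ∧ l < D ∨ c' = c ∧ v' = v ∧ l < k)
            (c * (n * D) + v * D + k) τ)
          hDρ (fun k j τ hI => hI.setReg (by decide)) (hJ.of_imp (by simp) (by simp))
          (fun l ξ hl hE hz hK => by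
            have := hK.appendCmd (v := ⟨v, hv⟩) hst hD hT hc
              ((hE.1 _ (by decide)).trans hCρ) ((hE.1 _ (by decide)).trans hy) hl hz
            exact this.of_imp (by omega) fun c' v' l' hd => by
              dsimp only
              rcases hd with hd | ⟨h1, h2, h3⟩
              · exact .inl (.inl hd)
              · rcases Nat.lt_succ_iff_lt_or_eq.1 h3 with h3 | h3
                · exact .inl (.inr ⟨h1, h2, h3⟩)
                · exact .inr ⟨h1, h2, h3⟩)
        refine this.of_imp (by ring) fun c' v' l' hd => ?_
        obtain ⟨h1 | ⟨h1, h2⟩, h3⟩ := hd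
        · exact .inl ⟨.inl h1, h3⟩
        · rcases Nat.lt_succ_iff_lt_or_eq.1 h2 with h2 | h2
          · exact .inl ⟨.inr ⟨h1, h2⟩, h3⟩
          · exact .inr ⟨h1, h2, h3⟩)
    refine this.of_imp (by ring) fun c' v' l' hd => ⟨?_, hd.2⟩
    rcases Nat.lt_succ_iff_lt_or_eq.1 hd.1 with h1 | h1
    · exact .inl h1
    · exact .inr ⟨h1, v'.2⟩
  obtain ⟨φ', h1, h2, h3, h4, h5⟩ := main
  refine ⟨_, φ', h1, ⟨?_, h3, h4, fun ψ hψ hcard => ?_, ?_⟩, by ring⟩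
  · have := hT.pos; omega
  · rcases Nat.le_succ_iff.1 hcard with hcard | hcard
    · obtain ⟨c, hc, h6⟩ := hT.exists_eq ψ hψ hcard
      exact ⟨c, by omega, by rw [h2 c hc, h6]⟩
    · obtain ⟨ψ', v, l, h6, h7, h8, rfl⟩ := exists_relabel_eq hψ hcard
      obtain ⟨c, hc, h9⟩ := hT.exists_eq ψ' h6 h7
      obtain ⟨c', hc', h10⟩ := h5 c hc v l ⟨hc, h8⟩
      exact ⟨c', hc', by rw [h10, h9]⟩
  · rw [h2 0 hT.pos]; exact hT.zero_ne

end Spec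

/-! ### Computing components and deleting edges -/

section Spec

open Classical

variable {n : ℕ} {G H : SimpleGraph (Fin n)} {s t : Fin n} {D K M : ℕ}
  {φ : ℕ → Fin n → ℕ} {R : ℕ → Fin n → Fin n}

theorem Tabled.eval_pos {σ : State} (h : Tabled G s t D M φ σ) {r q c : ℕ} {v : Fin n}
    (hr : σ.reg r = c) (hc : c < M) (hq : σ.reg q = v) : (pos r q).eval σ = c * n + v := by
  rw [LBCut.eval_pos, hr, hq, h.row c (.inr hc)]

theorem Tabled.eval_mat {σ : State} (h : Tabled G s t D M φ σ) (a : ℕ) {r q c : ℕ} {v : Fin n}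
    (hr : σ.reg r = c) (hc : c < M) (hq : σ.reg q = v) : (mat a r q).eval σ = σ.matrix n a c v := by
  rw [LBCut.eval_mat, hr, hq, h.row c (.inr hc)]; rfl

theorem Tabled.eval_graph {σ : State} (h : Tabled G s t D M φ σ) {r q : ℕ} {v w : Fin n}
    (hr : σ.reg r = w) (hq : σ.reg q = v) :
    (mat aG r q).eval σ = if G.Adj w v then 1 else 0 := by
  rw [LBCut.eval_mat, hr, hq, h.row w (.inl w.2), h.graph]

theorem State.setArr_matrix (σ : State) (a c : ℕ) (z : Fin n) (b c' : ℕ) (w : Fin n) :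
    (σ.setArr a (c * n + z) b).matrix n a c' w =
      if c' = c ∧ w = z then b else σ.matrix n a c' w := by
  simp [State.matrix, index_inj]

theorem exec_mergeCmd {σ : State} (h : Tabled G s t D M φ σ) {c : ℕ} (hc : c < M)
    (hC : σ.reg rC = c) {a b : ℕ} (hA : σ.reg rA = a) (hB : σ.reg rB = b) (c' : ℕ) (w : Fin n) :
    (mergeCmd.exec σ).matrix n aR c' w =
      if c' = c ∧ σ.matrix n aR c w = a then b else σ.matrix n aR c' w := by
  have := exec_count (x := rW) (b := rN)
    (p := whenZero (absDiff (mat aR rC rW) (.reg rA)) (store aR (pos rC rW) (.reg rB))) (σ := σ)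
    (fun k τ => ∀ (c' : ℕ) (w : Fin n), τ.matrix n aR c' w =
      if (w : ℕ) < k ∧ c' = c ∧ σ.matrix n aR c w = a then b else σ.matrix n aR c' w) h.n_eq
    (fun k j τ hI => hI) (by simp) (fun k τ hk hF hx hI c' w => by
      obtain ⟨z, rfl⟩ : ∃ z : Fin n, (z : ℕ) = k := ⟨⟨k, hk⟩, rfl⟩
      have hτ := h.of_frame hF (by decide) (by decide)
      have hC' : τ.reg rC = c := (hF.1 _ (by decide)).trans hC
      have hA' : τ.reg rA = a := (hF.1 _ (by decide)).trans hA
      have hB' : τ.reg rB = b := (hF.1 _ (by decide)).trans hB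
      rw [exec_whenZero_iff (P := σ.matrix n aR c z = a)
        (by rw [absDiff_eq_zero, hτ.eval_mat aR hC' hc hx, eval_reg, hA', hI]; simp)]
      have hw : (w : ℕ) < z + 1 ↔ (w : ℕ) < z ∨ w = z := by
        rw [Fin.ext_iff]; omega
      simp only [hw]
      split_ifs with h1 h2 h2
      · rw [exec_store, hτ.eval_pos hC' hc hx, eval_reg, hB', State.setArr_matrix, hI]
        by_cases h3 : w = z
        · rw [if_pos ⟨h2.2.1, h3⟩]
        · rw [if_neg (fun h4 => h3 h4.2), if_pos ⟨h2.1.resolve_right h3, h2.2⟩]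
      · rw [exec_store, hτ.eval_pos hC' hc hx, eval_reg, hB', State.setArr_matrix, hI,
          if_neg (fun h3 : c' = c ∧ w = z => h2 ⟨.inr h3.2, h3.1, h3.2 ▸ h1⟩), if_neg]
        exact fun h3 => h2 ⟨.inl h3.1, h3.2⟩
      · have hwz : (w : ℕ) < z := h2.1.resolve_right fun h3 => h1 (h3 ▸ h2.2.2)
        rw [hI, if_pos ⟨hwz, h2.2⟩]
      · rw [hI, if_neg]
        exact fun h3 => h2 ⟨.inl h3.1, h3.2⟩)
  refine (this c' w).trans ?_
  simp only [w.2, true_and]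

/-- Row `c` of the array of representatives, when the edges with `done` are considered. -/
def Linked (G : SimpleGraph (Fin n)) (ψ : Fin n → ℕ) (row : Fin n → ℕ)
    (done : Fin n → Fin n → Prop) : Prop :=
  ∃ r : Fin n → Fin n, (∀ w, row w = r w) ∧ (∀ x, ψ x = 0 → Joined G {v | ψ v = 0} x (r x)) ∧
    ∀ x y, done x y → ψ x = 0 → ψ y = 0 → G.Adj x y → r x = r y

theorem Linked.of_imp {ψ : Fin n → ℕ} {row : Fin n → ℕ} {done done' : Fin n → Fin n → Prop}
    (h : Linked G ψ row done) (hd : ∀ x y, done' x y → done x y) : Linked G ψ row done' := by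
  obtain ⟨r, h1, h2, h3⟩ := h
  exact ⟨r, h1, h2, fun x y hxy => h3 x y (hd x y hxy)⟩

/-- Replacing the representative of x by that of y wherever it occurs keeps all equalities between
representatives. Every vertex stays joined to its representative, since the edge xy links the two
classes. -/
theorem Linked.linkCmd {σ : State} (h : Tabled G s t D M φ σ) {c : ℕ} (hc : c < M)
    (hC : σ.reg rC = c) {x y : Fin n} (hX : σ.reg rX = x) (hY : σ.reg rY = y)
    {done : Fin n → Fin n → Prop} (hI : Linked G (φ c) (σ.matrix n aR c) done) :
    Linked G (φ c) ((linkCmd.exec σ).matrix n aR c) (fun x' y' => done x' y' ∨ x' = x ∧ y' = y) ∧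
      ∀ c', c' ≠ c → (linkCmd.exec σ).matrix n aR c' = σ.matrix n aR c' := by
  rw [LBCut.linkCmd, exec_whenZero_iff (P := G.Adj x y ∧ φ c x = 0 ∧ φ c y = 0) (by
    rw [eval_plus, eval_plus, Nat.add_eq_zero_iff, Nat.add_eq_zero_iff, isZero_eq_zero,
      h.eval_graph hX hY, h.eval_label hC hc hX, h.eval_label hC hc hY]
    simp)]
  obtain ⟨r, h1, h2, h3⟩ := hI
  split_ifs with hxy
  · have hR := fun c' w => exec_mergeCmd (σ := (σ.setReg rA (r x)).setReg rB (r y))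
      ((h.setReg (by decide)).setReg (by decide)) hc (a := r x) (b := r y) (by simpa using hC)
      (by simp) (by simp) c' w
    have e1 : (mat aR rC rX).eval σ = r x := by rw [h.eval_mat aR hC hc hX, h1]
    have e2 : (mat aR rC rY).eval (σ.setReg rA (r x)) = r y := by
      rw [(h.setReg (x := rA) (by decide)).eval_mat aR (c := c) (v := y) (by simpa using hC) hc
        (by simpa using hY)]
      exact h1 y
    rw [exec_seq, exec_seq, exec_assign, exec_assign, e1, e2]
    have hrow : ∀ c', ((σ.setReg rA (r x)).setReg rB (r y)).matrix n aR c' = σ.matrix n aR c' :=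
      fun _ => rfl
    simp only [hrow] at hR
    refine ⟨⟨fun w => if r w = r x then r y else r w, fun w => ?_, fun w hw => ?_, ?_⟩,
      fun c' hc' => ?_⟩
    · rw [hR, h1 w]
      by_cases h4 : r w = r x
      · simp [h4]
      · simp [h4, Fin.val_inj]
    · by_cases h4 : r w = r x
      · have hj1 := h2 w hw
        have hj2 := (h2 x hxy.2.1).symm
        have hj3 := h2 y hxy.2.2
        have hj4 : Joined G {v | φ c v = 0} x y := .single ⟨hxy.1, hxy.2.1, hxy.2.2⟩
        rw [h4] at hj1
        show Joined G _ w (if r w = r x then r y else r w)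
        rw [if_pos h4]
        exact (hj1.trans hj2).trans (hj4.trans hj3)
      · show Joined G _ w (if r w = r x then r y else r w)
        rw [if_neg h4]
        exact h2 w hw
    · rintro x' y' (hd | ⟨rfl, rfl⟩) hx' hy' ha
      · simp only [h3 x' y' hd hx' hy' ha]
      · simp
    · funext w
      rw [hR, if_neg (fun h4 => hc' h4.1)]
  · refine ⟨⟨r, h1, h2, ?_⟩, fun _ _ => rfl⟩
    rintro x' y' (hd | ⟨rfl, rfl⟩) hx' hy' ha
    · exact h3 x' y' hd hx' hy' ha
    · exact absurd ⟨ha, hx', hy'⟩ hxy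

/-- At first every vertex represents itself. Merging along all edges between unlabelled vertices
makes the representatives constant on components. Each row of the table is treated separately, and
edges are those of G, not of H. -/
theorem exec_componentsCmd {σ : State} (h : Tabled G s t D M φ σ) :
    ∃ R : ℕ → Fin n → Fin n, Loaded G s t D M φ R (componentsCmd.exec σ) ∧
      ∀ c < M, IsComp G (φ c) (R c) := by
  have main : ∀ c < M, Linked G (φ c) ((componentsCmd.exec σ).matrix n aR c)
      fun _ _ => True := by
    refine exec_count (x := rC) (b := rM) (p := seq (count rW rN (store aR (pos rC rW) (.reg rW)))
      (count rX rN (count rY rN linkCmd))) (σ := σ)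
      (fun k τ => ∀ c < k, Linked G (φ c) (τ.matrix n aR c) fun _ _ => True) h.M_eq
      (fun k j τ hI => hI) (fun c hc => absurd hc (by omega)) (fun c τ hc hF hx hI => ?_)
    have hτ := h.of_frame hF (by decide) (by decide)
    have hinit := exec_count (x := rW) (b := rN) (p := store aR (pos rC rW) (.reg rW)) (σ := τ)
      (fun k ρ => ∀ (c' : ℕ) (w : Fin n), ρ.matrix n aR c' w =
        if c' = c ∧ (w : ℕ) < k then (w : ℕ) else τ.matrix n aR c' w) hτ.n_eq
      (fun k j τ hI => hI) (by simp) (fun k ρ hk hG hy hJ c' w => by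
        obtain ⟨z, rfl⟩ : ∃ z : Fin n, (z : ℕ) = k := ⟨⟨k, hk⟩, rfl⟩
        have hρ := hτ.of_frame hG (by decide) (by decide)
        have hC : ρ.reg rC = c := (hG.1 _ (by decide)).trans hx
        have hJ' := hJ c' w
        rw [exec_store, hρ.eval_pos hC hc hy, eval_reg, hy]
        simp only [State.matrix, State.setArr_arr, index_inj, true_and] at hJ' ⊢
        rw [hJ']
        have hw : (w : ℕ) < z + 1 ↔ (w : ℕ) < z ∨ w = z := by
          rw [Fin.ext_iff]; omega
        simp only [hw]
        by_cases h1 : w = z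
        · subst h1; simp
        · simp [h1])
    have hfr := frame_exec (count rW rN (store aR (pos rC rW) (.reg rW))) τ
    rw [exec_seq]
    have hρ := hτ.of_frame hfr (by decide) (by decide)
    have hCρ : _ = c := (hfr.1 rC (by decide)).trans hx
    generalize (count rW rN (store aR (pos rC rW) (.reg rW))).exec τ = ρ at *
    have hlink := exec_count (x := rX) (b := rN) (p := count rY rN linkCmd) (σ := ρ)
      (fun k ξ => (Linked G (φ c) (ξ.matrix n aR c) fun x _ => (x : ℕ) < k) ∧
        ∀ c', c' ≠ c → ξ.matrix n aR c' = ρ.matrix n aR c') hρ.n_eq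
      (fun k j τ hI => hI) ⟨⟨id, fun w => by simp [hinit], fun x _ => .refl,
        fun x y hd => absurd hd (by omega)⟩, fun _ _ => rfl⟩ (fun x ξ hxn hE hX hJ => by
        have hξ := hρ.of_frame hE (by decide) (by decide)
        have hCξ : ξ.reg rC = c := (hE.1 _ (by decide)).trans hCρ
        have := exec_count (x := rY) (b := rN) (p := linkCmd) (σ := ξ)
          (fun k ξ => (Linked G (φ c) (ξ.matrix n aR c)
              fun x' y' => (x' : ℕ) < x ∨ (x' : ℕ) = x ∧ (y' : ℕ) < k) ∧
            ∀ c', c' ≠ c → ξ.matrix n aR c' = ρ.matrix n aR c') hξ.n_eq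
          (fun k j τ hI => hI) ⟨hJ.1.of_imp (by simp), hJ.2⟩ (fun y ζ hyn hL hY hK => by
            have hζ := hξ.of_frame hL (by decide) (by decide)
            have := hK.1.linkCmd (x := ⟨x, hxn⟩) (y := ⟨y, hyn⟩) hζ hc
              ((hL.1 _ (by decide)).trans hCξ) ((hL.1 _ (by decide)).trans hX) hY
            refine ⟨this.1.of_imp fun x' y' hd => ?_, fun c' hc' => by
              rw [this.2 c' hc', hK.2 c' hc']⟩
            rcases hd with hd | ⟨h1, h2⟩
            · exact .inl (.inl hd)
            · rcases Nat.lt_succ_iff_lt_or_eq.1 h2 with h2 | h2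
              · exact .inl (.inr ⟨h1, h2⟩)
              · exact .inr ⟨Fin.ext h1, Fin.ext h2⟩)
        refine ⟨this.1.of_imp fun x' y' hd => ?_, this.2⟩
        rcases Nat.lt_succ_iff_lt_or_eq.1 hd with hd | hd
        · exact .inl hd
        · exact .inr ⟨hd, y'.2⟩)
    intro c' hc'
    by_cases hcc : c' = c
    · subst hcc
      exact hlink.1.of_imp fun x' y' _ => x'.2
    · rw [hlink.2 c' hcc]
      have : ρ.matrix n aR c' = τ.matrix n aR c' := by
        funext w
        rw [hinit, if_neg (fun h4 => hcc h4.1)]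
      rw [this]
      exact hI c' (by omega)
  have : Nonempty (Fin n → Fin n) := ⟨id⟩
  choose! R hR using main
  have hτ := h.of_frame (frame_exec componentsCmd σ) (by decide) (by decide)
  exact ⟨R, ⟨hτ.n_eq, hτ.s_eq, hτ.t_eq, hτ.D_eq, hτ.M_eq, hτ.row, hτ.graph, hτ.label,
    fun c hc v => (hR c hc).1 v⟩, fun c hc => ⟨fun x y hx hy ha => (hR c hc).2.2 x y trivial hx hy ha,
    (hR c hc).2.1⟩⟩

/-- The array `aOut` holds the edges of `G` that are not in `H`. -/
def HasOutput (G H : SimpleGraph (Fin n)) (σ : State) : Prop :=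
  ∀ x y : Fin n, σ.arr aOut (x * n + y) = if G.Adj x y ∧ ¬H.Adj x y then 1 else 0

/-- The storage while edges are deleted. -/
def Deleting (G : SimpleGraph (Fin n)) (s t : Fin n) (D K M : ℕ) (φ : ℕ → Fin n → ℕ)
    (R : ℕ → Fin n → Fin n) (done : Fin n → Fin n → Prop) (σ : State) : Prop :=
  ∃ H : SimpleGraph (Fin n), Setup G H s t D K M φ R ∧ Loaded G s t D M φ R σ ∧ HasGraph H aH σ ∧
    HasOutput G H σ ∧ σ.reg rCur ≠ 0 ∧ Reduced G H s t D (σ.reg rCur - 1) done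

theorem Deleting.of_imp {done done' : Fin n → Fin n → Prop} {σ : State}
    (h : Deleting G s t D K M φ R done σ) (hd : ∀ x y, done' x y → done x y) :
    Deleting G s t D K M φ R done' σ := by
  obtain ⟨H, h1, h2, h3, h4, h5, h6⟩ := h
  exact ⟨H, h1, h2, h3, h4, h5, h6.mono fun x y hxy _ => hd x y hxy⟩

theorem Deleting.setReg {done : Fin n → Fin n → Prop} {σ : State}
    (h : Deleting G s t D K M φ R done σ) {x j : ℕ} (hx : x ∉ [rN, rS, rT, rD, rM])
    (hx' : x ≠ rCur) : Deleting G s t D K M φ R done (σ.setReg x j) := by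
  obtain ⟨H, h1, h2, h3, h4, h5, h6⟩ := h
  refine ⟨H, h1, h2.setReg hx, h3, h4, ?_⟩
  rw [State.setReg_reg, if_neg hx'.symm]
  exact ⟨h5, h6⟩

/-- The edge is removed on trial, the optimum is recomputed, and the edge is restored unless the
optimum has dropped by two. -/
theorem Deleting.edgeCmd (hsol : ∀ v, IsRep (φ 0) (R 0) v → Solvable G s t M φ R 0 v)
    {done : Fin n → Fin n → Prop} {σ : State} (h : Deleting G s t D K M φ R done σ)
    {i j : Fin n} (hi : σ.reg rI = i) (hj : σ.reg rJ = j) :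
    Deleting G s t D K M φ R (fun x y => done x y ∨ x = i ∧ y = j) (edgeCmd.exec σ) := by
  obtain ⟨H, hS, hL, hH, hO, hcur, hred⟩ := h
  rw [LBCut.edgeCmd, exec_whenZero_iff (P := H.Adj i j)
    (by rw [isZero_eq_zero, hL.eval_graph hH hi hj]; simp)]
  split_ifs with hij
  swap
  · refine ⟨H, hS, hL, hH, hO, hcur, hred.mono ?_⟩
    rintro x y (hd | ⟨rfl, rfl⟩) ha
    · exact hd
    · exact absurd ha hij
  have hp : ∀ τ : State, Loaded G s t D M φ R τ → τ.reg rI = i → τ.reg rJ = j →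
      (pos rI rJ).eval τ = i * n + j ∧ (pos rJ rI).eval τ = j * n + i := by
    intro τ hτ h1 h2
    rw [eval_pos, eval_pos, h1, h2, hτ.row i (.inl i.2), hτ.row j (.inl j.2)]
    exact ⟨rfl, rfl⟩
  have harr : ∀ (τ : State) (a b : ℕ) (x y : Fin n),
      ((τ.setArr a (i * n + j) b).setArr a (j * n + i) b).arr a (x * n + y) =
        if s(x, y) = s(i, j) then b else τ.arr a (x * n + y) := by
    intro τ a b x y
    simp only [State.setArr_arr, index_inj, Sym2.eq_iff, true_and, Fin.val_inj]
    by_cases h1 : x = j ∧ y = i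
    · simp [h1]
    · by_cases h2 : x = i ∧ y = j <;> simp [h1, h2]
  have hstore : ∀ (τ : State) (a b : ℕ), a ∉ [aG, aRow, aT, aR] → Loaded G s t D M φ R τ →
      τ.reg rI = i → τ.reg rJ = j →
      (store a (pos rJ rI) (.lit b)).exec ((store a (pos rI rJ) (.lit b)).exec τ) =
        (τ.setArr a (i * n + j) b).setArr a (j * n + i) b ∧
      Loaded G s t D M φ R ((τ.setArr a (i * n + j) b).setArr a (j * n + i) b) := by
    intro τ a b ha hτ h1 h2
    have e1 : (store a (pos rI rJ) (.lit b)).exec τ = τ.setArr a (i * n + j) b := by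
      rw [exec_store, (hp τ hτ h1 h2).1, eval_lit]
    have l1 := hτ.exec (p := store a (pos rI rJ) (.lit b)) (by simp [wregs])
      (by simp [warrs] at ha ⊢; tauto)
    have e2 : (store a (pos rJ rI) (.lit b)).exec ((store a (pos rI rJ) (.lit b)).exec τ) =
        (τ.setArr a (i * n + j) b).setArr a (j * n + i) b := by
      rw [exec_store, (hp _ l1 h1 h2).2, eval_lit, e1]
    have l2 := l1.exec (p := store a (pos rJ rI) (.lit b)) (by simp [wregs])
      (by simp [warrs] at ha ⊢; tauto)
    exact ⟨e2, e2 ▸ l2⟩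
  simp only [exec_seq (store _ _ _), exec_seq costCmd]
  obtain ⟨e1, hL₁⟩ := hstore σ aH 0 (by decide) hL hi hj
  rw [e1]
  have hH₁ : HasGraph (H.deleteEdges {s(i, j)}) aH
      ((σ.setArr aH (i * n + j) 0).setArr aH (j * n + i) 0) := by
    intro x y
    rw [harr, hH x y]
    simp only [SimpleGraph.deleteEdges_adj, Set.mem_singleton_iff]
    by_cases hs : s(x, y) = s(i, j) <;> simp [hs]
  have hO₁ : HasOutput G H ((σ.setArr aH (i * n + j) 0).setArr aH (j * n + i) 0) := by
    intro x y
    rw [← hO x y]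
    simp
  have hr₁ : ((σ.setArr aH (i * n + j) 0).setArr aH (j * n + i) 0).reg = σ.reg := rfl
  generalize (σ.setArr aH (i * n + j) 0).setArr aH (j * n + i) 0 = τ at *
  have hS₁ : Setup G (H.deleteEdges {s(i, j)}) s t D K M φ R :=
    ⟨(H.deleteEdges_le _).trans hS.le, hS.pos, hS.ne, hS.table, hS.comp⟩
  obtain ⟨c1, c2⟩ := exec_costCmd hS₁ hL₁ hH₁
  -- Solvability does not depend on H, so the recomputation cannot fail.
  have hval := c2.2 hsol
  have hopt := c1 hval
  have hfr := frame_exec costCmd τ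
  have hL₂ := hL₁.of_frame hfr (by decide) (by decide)
  have hH₂ := hH₁.of_arr_eq (hfr.2 aH (by decide))
  have hO₂ : HasOutput G H (costCmd.exec τ) := by
    unfold HasOutput
    rw [hfr.2 aOut (by decide)]
    exact hO₁
  have hcur₂ := hfr.1 rCur (by decide)
  have hi₂ := hfr.1 rI (by decide)
  have hj₂ := hfr.1 rJ (by decide)
  rw [hr₁] at hcur₂ hi₂ hj₂
  rw [hi] at hi₂
  rw [hj] at hj₂
  generalize costCmd.exec τ = ρ at *
  -- Both registers hold one plus an optimum, so their difference is that of the optima.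
  rw [exec_ite_iff (P := ρ.reg rVal + 2 ≤ σ.reg rCur)
    (by simp only [eval_minus, eval_plus, eval_reg, eval_lit, hcur₂]; omega)]
  split_ifs with hle
  · have hL₃ : Loaded G s t D M φ R (ρ.setReg rCur (ρ.reg rVal)) := hL₂.setReg (by decide)
    obtain ⟨e2, hL₄⟩ := hstore (ρ.setReg rCur (ρ.reg rVal)) aOut 1 (by decide) hL₃
      (by simpa using hi₂) (by simpa using hj₂)
    rw [exec_seq, exec_assign, eval_reg, exec_seq, e2]
    refine ⟨_, hS₁, hL₄, fun x y => ?_, fun x y => ?_, by simpa using hval, ?_⟩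
    · simpa using hH₂ x y
    · rw [harr, State.setReg_arr, hO₂ x y]
      simp only [SimpleGraph.deleteEdges_adj, Set.mem_singleton_iff]
      by_cases hs : s(x, y) = s(i, j)
      · have : G.Adj x y := by
          rw [← SimpleGraph.mem_edgeSet, hs]
          exact hS.le hij
        simp [hs, this]
      · simp [hs]
    · simpa using hred.delete hij hopt (by omega)
  · obtain ⟨e2, hL₄⟩ := hstore ρ aH 1 (by decide) hL₂ hi₂ hj₂
    rw [exec_seq, e2]
    refine ⟨H, hS, hL₄, fun x y => ?_, fun x y => ?_, by simpa [hcur₂] using hcur, ?_⟩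
    · rw [harr, hH₂ x y]
      simp only [SimpleGraph.deleteEdges_adj, Set.mem_singleton_iff]
      by_cases hs : s(x, y) = s(i, j)
      · have : H.Adj x y := by rwa [← SimpleGraph.mem_edgeSet, hs]
        simp [hs, this]
      · simp [hs]
    · simpa using hO₂ x y
    · simpa [hcur₂] using hred.keep hij hopt (by omega)

theorem exec_edgesCmd (hS : Setup G G s t D K M φ R)
    (hsol : ∀ v, IsRep (φ 0) (R 0) v → Solvable G s t M φ R 0 v) {σ : State}
    (hL : Loaded G s t D M φ R σ) (hH : HasGraph G aH σ) (hO : HasOutput G G σ)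
    (hval : σ.reg rVal ≠ 0) (hopt : IsOpt G s t D (σ.reg rVal - 1)) :
    Deleting G s t D K M φ R (fun _ _ => True) (edgesCmd.exec σ) := by
  rw [edgesCmd, exec_seq, exec_assign, eval_reg]
  have hL₁ : Loaded G s t D M φ R (σ.setReg rCur (σ.reg rVal)) := hL.setReg (by decide)
  have h₁ : Deleting G s t D K M φ R (fun _ _ => False) (σ.setReg rCur (σ.reg rVal)) :=
    ⟨G, hS, hL₁, hH, hO, by simpa using hval, by simpa using Reduced.refl hopt⟩
  generalize σ.setReg rCur (σ.reg rVal) = ρ at *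
  have := exec_count (x := rI) (b := rN) (p := count rJ rN LBCut.edgeCmd) (σ := ρ)
    (fun k τ => Deleting G s t D K M φ R (fun x _ => (x : ℕ) < k) τ) hL₁.n_eq
    (fun k j τ hI => hI.setReg (by decide) (by decide)) (h₁.of_imp (by simp))
    (fun i τ hi hF hx hI => by
      have hN : τ.reg rN = n := (hF.1 _ (by decide)).trans hL₁.n_eq
      have := exec_count (x := rJ) (b := rN) (p := LBCut.edgeCmd) (σ := τ)
        (fun k τ => Deleting G s t D K M φ R
          (fun x y => (x : ℕ) < i ∨ (x : ℕ) = i ∧ (y : ℕ) < k) τ) hN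
        (fun k j τ hI => hI.setReg (by decide) (by decide)) (hI.of_imp (by simp))
        (fun j ξ hj hG hy hJ => by
          refine (hJ.edgeCmd (i := ⟨i, hi⟩) (j := ⟨j, hj⟩) hsol
            ((hG.1 _ (by decide)).trans hx) hy).of_imp fun x y hd => ?_
          rcases hd with hd | ⟨h1, h2⟩
          · exact .inl (.inl hd)
          · rcases Nat.lt_succ_iff_lt_or_eq.1 h2 with h2 | h2
            · exact .inl (.inr ⟨h1, h2⟩)
            · exact .inr ⟨Fin.ext h1, Fin.ext h2⟩)
      refine this.of_imp fun x y hd => ?_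
      rcases Nat.lt_succ_iff_lt_or_eq.1 hd with hd | hd
      · exact .inl hd
      · exact .inr ⟨hd, y.2⟩)
  exact this.of_imp fun x _ _ => x.2

end Spec

/-! ### Initialisation, the search for K and the whole program -/

section Spec

open Classical

variable {n : ℕ} {G : SimpleGraph (Fin n)} {s t : Fin n} {D K M L : ℕ}
  {φ : ℕ → Fin n → ℕ} {R : ℕ → Fin n → Fin n}

/-- The partial labelling of `s` and `t` alone. -/
def terminalLabels (s t : Fin n) (D : ℕ) (v : Fin n) : ℕ :=
  if v = t then D else if v = s then 1 else 0

theorem isTable_terminalLabels (hst : s ≠ t) (hD : 1 ≤ D) :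
    IsTable s t D 0 1 fun _ => terminalLabels s t D := by
  refine ⟨one_pos, fun _ _ => ⟨by simp [terminalLabels, hst], by simp [terminalLabels],
    fun v => ?_⟩, fun _ _ => ?_, fun ψ hψ hcard => ⟨0, one_pos, ?_⟩, fun v => ?_⟩
  · simp only [terminalLabels]
    split_ifs <;> omega
  · rw [numLabelled, Nat.le_zero, Set.ncard_eq_zero]
    refine Set.eq_empty_of_forall_notMem fun v hv => hv.2 ?_
    simp [terminalLabels, hv.1.1, hv.1.2]
  · rw [numLabelled, Nat.le_zero, Set.ncard_eq_zero] at hcard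
    funext v
    simp only [terminalLabels]
    split_ifs with h1 h2
    · rw [h1, hψ.2.1]
    · rw [h2, hψ.1]
    · by_contra h3
      exact (Set.eq_empty_iff_forall_notMem.1 hcard v) ⟨⟨h2, h1⟩, fun h4 => h3 h4.symm⟩
  · simp only [terminalLabels]
    split_ifs with h1 h2
    · simp [h1]; omega
    · simp [h2]
    · simp [h1, h2]

theorem hasGraph_inputState (G : SimpleGraph (Fin n)) (s t : Fin n) (L : ℕ) :
    HasGraph G aG (inputState G s t L) := by
  intro x y
  have : (∃ i j : Fin n, (x : ℕ) * n + y = i * n + j ∧ G.Adj i j) ↔ G.Adj x y := by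
    constructor
    · rintro ⟨i, j, h, hij⟩
      obtain ⟨h1, rfl⟩ := index_inj.1 h
      rwa [Fin.ext h1]
    · exact fun h => ⟨x, y, rfl, h⟩
  simp only [inputState, true_and, this]

/-- The storage before round `K` of the main loop. -/
def Stage (G : SimpleGraph (Fin n)) (s t : Fin n) (D K M : ℕ) (σ : State) : Prop :=
  ∃ φ, Tabled G s t D M φ σ ∧ IsTable s t D K M φ ∧ HasGraph G aH σ ∧ HasOutput G G σ

theorem exec_copyCmd {σ : State} (hn : σ.reg rN = n) (hrow : ∀ i < n, σ.arr aRow i = i * n)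
    (hG : HasGraph G aG σ) :
    HasGraph G aH
      ((count rI rN (count rJ rN (store aH (pos rI rJ) (mat aG rI rJ)))).exec σ) := by
  have := exec_count (x := rI) (b := rN) (p := count rJ rN (store aH (pos rI rJ) (mat aG rI rJ)))
    (σ := σ) (fun k τ => ∀ x y : Fin n, (x : ℕ) < k → τ.arr aH (x * n + y) =
      if G.Adj x y then 1 else 0) hn
    (fun k j τ hI => hI) (by simp) (fun i τ hi hF hx hI => by
      have hN : τ.reg rN = n := (hF.1 _ (by decide)).trans hn
      have := exec_count (x := rJ) (b := rN) (p := store aH (pos rI rJ) (mat aG rI rJ)) (σ := τ)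
        (fun k τ => ∀ x y : Fin n, ((x : ℕ) < i ∨ (x : ℕ) = i ∧ (y : ℕ) < k) →
          τ.arr aH (x * n + y) = if G.Adj x y then 1 else 0) hN
        (fun k j τ hI => hI) (fun x y hxy => hI x y (by omega)) (fun j ρ hj hE hy hJ x y hxy => by
          obtain ⟨i, rfl⟩ : ∃ z : Fin n, (z : ℕ) = i := ⟨⟨i, hi⟩, rfl⟩
          obtain ⟨j, rfl⟩ : ∃ z : Fin n, (z : ℕ) = j := ⟨⟨j, hj⟩, rfl⟩
          have e1 : ρ.reg rI = i := (hE.1 _ (by decide)).trans hx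
          have e2 : ρ.arr aRow i = i * n := by
            rw [hE.2 _ (by decide), hF.2 _ (by decide), hrow i i.2]
          have e3 : HasGraph G aG ρ := by
            refine (hG.of_arr_eq (hF.2 aG (by decide))).of_arr_eq (hE.2 aG (by decide))
          rw [exec_store, eval_pos, eval_mat, e1, hy, e2, State.setArr_arr, e3 i j]
          simp only [index_inj, true_and, Fin.val_inj]
          by_cases h1 : x = i ∧ y = j
          · obtain ⟨rfl, rfl⟩ := h1
            simp
          · rw [if_neg h1]
            refine hJ x y ?_
            rw [Fin.ext_iff, Fin.ext_iff] at h1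
            omega)
      exact fun x y hxy => this x y (by have := y.2; omega))
  exact fun x y => this x y x.2

theorem stage_initCmd (hst : s ≠ t) :
    Stage G s t (numLabels n L) 0 1 (initCmd.exec (inputState G s t L)) ∧
      (initCmd.exec (inputState G s t L)).reg rVal = 0 := by
  have hval : (initCmd.exec (inputState G s t L)).reg rVal = 0 :=
    exec_reg initCmd (by decide)
  have hD1 : 1 ≤ numLabels n L := Nat.le_add_left 1 _
  have hG := hasGraph_inputState G s t L
  have hout : (initCmd.exec (inputState G s t L)).arr aOut = (inputState G s t L).arr aOut :=
    exec_arr initCmd (by decide)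
  refine ⟨⟨_, ?_, isTable_terminalLabels hst hD1, ?_, fun x y => ?_⟩, hval⟩
  rotate_left 2
  · rw [hout]
    simp [inputState]
  all_goals
    obtain ⟨h0, h1, h2, h3, h4⟩ : (inputState G s t L).reg rN = n ∧ (inputState G s t L).reg rS = s ∧
        (inputState G s t L).reg rT = t ∧ (inputState G s t L).reg rL = L ∧
        (inputState G s t L).reg rOff = 0 := by
      simp [inputState]
    have h5 : ∀ i, (inputState G s t L).arr aT i = 0 := by simp [inputState]
    -- Truncated subtraction computes the minimum: n − (n − (L + 1)) = min(L + 1, n).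
    have hD : (n - (n - (L + 1))) + 1 = numLabels n L := by
      rw [numLabels]
      omega
    generalize inputState G s t L = σ at *
    rw [initCmd, exec_seq, exec_seq, exec_seq, exec_assign]
    simp only [eval_plus, eval_minus, eval_reg, eval_lit, h0, h3, hD]
    have hrow := exec_count (x := rI) (b := rN)
      (p := seq (store aRow (.reg rI) (.reg rOff)) (incr rOff (.reg rN)))
      (σ := σ.setReg rD (numLabels n L))
      (fun k τ => τ.reg rOff = k * n ∧ ∀ i < k, τ.arr aRow i = i * n) (by simpa using h0)
      (fun k j τ hI => by simpa using hI) (by simp [h4]) (fun k τ hk hF hx hI => by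
        have hN : τ.reg rN = n := (hF.1 _ (by decide)).trans (by simpa using h0)
        refine ⟨by simp [hI.1, hN, add_mul], fun i hi => ?_⟩
        by_cases hik : i = k
        · subst hik; simp [hx, hI.1]
        · simpa [hx, hik] using hI.2 i (by omega))
    have hfr := frame_exec (count rI rN (seq (store aRow (.reg rI) (.reg rOff)) (incr rOff (.reg rN))))
      (σ.setReg rD (numLabels n L))
    have e0 : _ = n := (hfr.1 rN (by decide)).trans (by simpa using h0)
    have e1 : _ = (s : ℕ) := (hfr.1 rS (by decide)).trans (by simpa using h1)
    have e2 : _ = (t : ℕ) := (hfr.1 rT (by decide)).trans (by simpa using h2)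
    have e3 : _ = numLabels n L := (hfr.1 rD (by decide)).trans (by simp)
    have e4 : HasGraph G aG _ := HasGraph.of_arr_eq (σ := σ) hG (hfr.2 aG (by decide))
    have e5 : ∀ i, _ = 0 := fun i => (congrFun (hfr.2 aT (by decide)) i).trans (h5 i)
    generalize (count rI rN (seq (store aRow (.reg rI) (.reg rOff)) (incr rOff (.reg rN)))).exec
      (σ.setReg rD (numLabels n L)) = τ at *
    have hcopy := exec_copyCmd e0 hrow.2 e4
    have hfr' := frame_exec (count rI rN (count rJ rN (store aH (pos rI rJ) (mat aG rI rJ)))) τ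
    have g0 := (hfr'.1 rN (by decide)).trans e0
    have g1 := (hfr'.1 rS (by decide)).trans e1
    have g2 := (hfr'.1 rT (by decide)).trans e2
    have g3 := (hfr'.1 rD (by decide)).trans e3
    have g4 := e4.of_arr_eq (hfr'.2 aG (by decide))
    have g5 := fun i => (congrFun (hfr'.2 aT (by decide)) i).trans (e5 i)
    have g6 := hfr'.2 aRow (by decide)
    generalize (count rI rN (count rJ rN (store aH (pos rI rJ) (mat aG rI rJ)))).exec τ = ρ at *
  · refine ⟨by simp [g0], by simp [g1], by simp [g2], by simp [g3], by simp, by simp [g0],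
      fun i hi => ?_, fun x y => ?_, fun c hc v => ?_⟩
    · have : i < n := by have := s.pos; omega
      simpa [g6] using hrow.2 i this
    · simpa using g4 x y
    · obtain rfl : c = 0 := by omega
      simp [g1, g2, g3, g5, terminalLabels, Fin.val_inj]
  · intro x y
    simpa using hcopy x y

theorem Stage.exec {σ : State} (h : Stage G s t D K M σ) (hst : s ≠ t) (hD : 1 ≤ D) :
    Stage G s t D (K + 1) (M * (1 + n * D))
        ((seq componentsCmd costCmd).exec (extendCmd.exec (σ.setReg rM₀ (σ.reg rM)))) ∧
      (extendCmd.exec (σ.setReg rM₀ (σ.reg rM))).reg rM = M * (1 + n * D) ∧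
      ∃ φ R, Setup G G s t D (K + 1) (M * (1 + n * D)) φ R ∧
        Loaded G s t D (M * (1 + n * D)) φ R
          ((seq componentsCmd costCmd).exec (extendCmd.exec (σ.setReg rM₀ (σ.reg rM)))) ∧
        (((seq componentsCmd costCmd).exec
          (extendCmd.exec (σ.setReg rM₀ (σ.reg rM)))).reg rVal ≠ 0 →
          IsOpt G s t D (((seq componentsCmd costCmd).exec
            (extendCmd.exec (σ.setReg rM₀ (σ.reg rM)))).reg rVal - 1)) ∧
        (((seq componentsCmd costCmd).exec
          (extendCmd.exec (σ.setReg rM₀ (σ.reg rM)))).reg rVal ≠ 0 ↔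
          ∀ v, IsRep (φ 0) (R 0) v → Solvable G s t (M * (1 + n * D)) φ R 0 v) := by
  obtain ⟨φ₀, h1, h2, h3, h4⟩ := h
  obtain ⟨M', φ, h5, h6, rfl⟩ := exec_extendCmd hst hD h2 (h1.setReg (x := rM₀) (j := σ.reg rM)
    (by decide)) (by simpa using h1.M_eq)
  have h3' : HasGraph G aH (extendCmd.exec (σ.setReg rM₀ (σ.reg rM))) :=
    h3.of_arr_eq (exec_arr extendCmd (σ := σ.setReg rM₀ (σ.reg rM)) (by decide))
  have h4' : HasOutput G G (extendCmd.exec (σ.setReg rM₀ (σ.reg rM))) := by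
    unfold HasOutput
    rw [exec_arr extendCmd (by decide)]
    exact h4
  generalize extendCmd.exec (σ.setReg rM₀ (σ.reg rM)) = τ at *
  obtain ⟨R, h7, h8⟩ := exec_componentsCmd h5
  have h9 := h3'.of_arr_eq (exec_arr componentsCmd (σ := τ) (a := aH) (by decide))
  have hS : Setup G G s t D (K + 1) (M * (1 + n * D)) φ R := ⟨le_rfl, hD, hst, h6, h8⟩
  obtain ⟨h10, h11⟩ := exec_costCmd hS h7 h9
  have hfr := frame_exec (seq componentsCmd costCmd) τ
  refine ⟨⟨φ, h5.of_frame hfr (by decide) (by decide), h6, h3'.of_arr_eq (hfr.2 _ (by decide)), ?_⟩,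
    h5.M_eq, φ, R, hS, h7.exec (by decide) (by decide), h10, h11⟩
  unfold HasOutput
  rw [hfr.2 aOut (by decide)]
  exact h4'

/-- The storage contains everything that is needed for finding the edges of a minimum cut. -/
def Solved (G : SimpleGraph (Fin n)) (s t : Fin n) (D M : ℕ) (σ : State) : Prop :=
  ∃ K φ R, Setup G G s t D K M φ R ∧ Loaded G s t D M φ R σ ∧ HasGraph G aH σ ∧ HasOutput G G σ ∧
    σ.reg rVal ≠ 0 ∧ IsOpt G s t D (σ.reg rVal - 1) ∧
    ∀ v, IsRep (φ 0) (R 0) v → Solvable G s t M φ R 0 v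

/-- One round of the main loop. -/
def stageProg : Program :=
  .seq (.assign rM₀ (.reg rM)) (.seq extendCmd.prog (seq componentsCmd costCmd).prog)

/-- The search for a sufficient number of labels. -/
def searchProg : Program := .loop (isZero (.reg rVal)) stageProg

/-- Induction on the number j of values of K left before treewidth plus one. At that value the bags
of an optimal decomposition fit into the table, so the loop ends there at the latest. If it ends
earlier, the table suffices for this particular graph, which is all that the later steps use. All
loop bounds are at most B, since the table never exceeds (1 + nD)^(k + 1) rows. -/
theorem runs_searchProg (hst : s ≠ t) (hD : 1 ≤ D) {B : ℕ} (hn : n ≤ B) (hDB : D ≤ B)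
    (hB : (1 + n * D) ^ (treeWidth G + 1) ≤ B) :
    ∀ (j K : ℕ) (σ : State), K + j = treeWidth G + 1 → Stage G s t D K ((1 + n * D) ^ K) σ →
      (σ.reg rVal ≠ 0 → Solved G s t D ((1 + n * D) ^ K) σ) →
      (K = treeWidth G + 1 → σ.reg rVal ≠ 0) →
      ∃ T τ, T ≤ j * (extendCmd.bnd B + (seq componentsCmd costCmd).bnd B + 6) + 4 ∧
        Runs searchProg σ T τ ∧ ∃ K ≤ treeWidth G + 1, Solved G s t D ((1 + n * D) ^ K) τ := by
  have hpow : ∀ K ≤ treeWidth G + 1, (1 + n * D) ^ K ≤ B := fun K hK =>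
    (Nat.pow_le_pow_right (by omega) hK).trans hB
  intro j
  induction j with
  | zero =>
    intro K σ hK hσ hsol hend
    exact ⟨4, σ, by omega, .loop_false (isZero_eq_zero.2 (hend hK)),
      K, by omega, hsol (hend hK)⟩
  | succ j ih =>
    intro K σ hK hσ hsol hend
    by_cases hval : σ.reg rVal = 0
    swap
    · exact ⟨4, σ, by omega, .loop_false (isZero_eq_zero.2 hval),
        K, by omega, hsol hval⟩
    obtain ⟨h1, h2, φ, R, h3, h4, h5, h6⟩ := hσ.exec hst hD
    rw [← pow_succ] at h1 h2 h3 h4 h6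
    obtain ⟨_, hσT, -⟩ := hσ
    obtain ⟨T₁, hT₁, hr₁⟩ := runs B extendCmd (by decide) (by decide)
      (σ.setReg rM₀ (σ.reg rM)) (fun b hb => by
        have hb' : b = rM₀ ∨ b = rN ∨ b = rD := by
          revert b; decide
        have := hpow K (by omega)
        rcases hb' with rfl | rfl | rfl
        · simpa [hσT.M_eq] using this
        · simpa [hσT.n_eq] using hn
        · simpa [hσT.D_eq] using hDB)
    have hN : (extendCmd.exec (σ.setReg rM₀ (σ.reg rM))).reg rN = n := by
      rw [exec_reg extendCmd (by decide)]
      simpa using hσT.n_eq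
    obtain ⟨T₂, hT₂, hr₂⟩ := runs B (seq componentsCmd costCmd) (by decide) (by decide)
      (extendCmd.exec (σ.setReg rM₀ (σ.reg rM))) (fun b hb => by
        have hb' : b = rM ∨ b = rN := by
          revert b; decide
        have := hpow (K + 1) (by omega)
        rcases hb' with rfl | rfl
        · rw [h2]; exact this
        · rw [hN]; exact hn)
    generalize (seq componentsCmd costCmd).exec (extendCmd.exec (σ.setReg rM₀ (σ.reg rM))) = τ at *
    obtain ⟨T₃, υ, hT₃, hr₃, hυ⟩ := ih (K + 1) τ (by omega) h1
      (fun hv => by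
        obtain ⟨-, -, -, h7, h8⟩ := h1
        exact ⟨K + 1, φ, R, h3, h4, h7, h8, hv, h5 hv, h6.1 hv⟩)
      -- This is the only place where the treewidth guarantees success.
      (fun hk => h6.2 fun v hv => by
        obtain ⟨m, Δ, hΔ⟩ := exists_treeDecomposition G
        exact solvable_root Δ (hk ▸ hΔ) hD h3.table h3.comp v hv)
    refine ⟨_, υ, ?_, .loop_true (by simp [isZero, hval])
      (.seq (.assign σ rM₀ (.reg rM)) (.seq hr₁ hr₂)) hr₃, hυ⟩
    simp only [isZero, Expr.cost]
    linarith

/-- The program that computes minimum bounded cuts. -/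
def mainProg : Program := .seq initCmd.prog (.seq searchProg edgesCmd.prog)

theorem Solved.exec_edgesCmd {σ : State} (h : Solved G s t (numLabels n L) M σ) :
    ∃ F : Finset (Sym2 (Fin n)), OutputsEdgeSet (edgesCmd.exec σ) F ∧ IsMinBoundedCut G s t L F := by
  obtain ⟨K, φ, R, h1, h2, h3, h4, h5, h6, h7⟩ := h
  obtain ⟨H, -, -, -, hO, -, hred⟩ := LBCut.exec_edgesCmd h1 h7 h2 h3 h4 h5 h6
  refine ⟨G.edgeFinset \ H.edgeFinset, fun i j => ?_, ?_⟩
  · rw [show (edgesCmd.exec σ).arr 1 _ = _ from hO i j]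
    simp
  · have hD : numLabels n L = numLabels (Fintype.card (Fin n)) L := by rw [Fintype.card_fin]
    rw [hD] at hred
    convert hred.isMinBoundedCut fun _ _ => trivial

theorem runs_mainProg (hst : s ≠ t) {B : ℕ} (hn : n ≤ B) (hDB : numLabels n L ≤ B)
    (hB : (1 + n * numLabels n L) ^ (treeWidth G + 1) ≤ B) :
    ∃ T τ, ∃ F : Finset (Sym2 (Fin n)), Runs mainProg (inputState G s t L) T τ ∧
      T ≤ (treeWidth G + 2) * ((seq initCmd (seq extendCmd (seq (seq componentsCmd costCmd)
        edgesCmd))).bnd B + 6) ∧ OutputsEdgeSet τ F ∧ IsMinBoundedCut G s t L F := by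
  obtain ⟨T₁, hT₁, hr₁⟩ := runs B initCmd (by decide) (by decide) (inputState G s t L)
    (fun b hb => by
      have hb' : b = rN := by
        revert b; decide
      subst hb'
      simpa [inputState] using hn)
  obtain ⟨h1, h2⟩ := stage_initCmd (G := G) (L := L) hst
  obtain ⟨T₂, τ, hT₂, hr₂, K, hK, hτ⟩ := runs_searchProg (G := G) 
    (D := numLabels n L) hst (Nat.le_add_left 1 _) hn hDB hB
    (treeWidth G + 1) 0 _ (by omega) (by simpa using h1) (fun h => absurd h2 h) (by omega)
  obtain ⟨F, hF⟩ := hτ.exec_edgesCmd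
  have hpow := (Nat.pow_le_pow_right (n := 1 + n * numLabels n L) (by omega) hK).trans hB
  obtain ⟨_, _, _, -, h3, -⟩ := hτ
  obtain ⟨T₃, hT₃, hr₃⟩ := runs B edgesCmd (by decide) (by decide) τ
    (fun b hb => by
      have hb' : b = rM ∨ b = rN := by
        revert b; decide
      rcases hb' with rfl | rfl
      · rw [h3.M_eq]; exact hpow
      · rw [h3.n_eq]; exact hn)
  refine ⟨_, _, F, .seq hr₁ (.seq hr₂ hr₃), ?_, hF⟩
  simp only [bnd] at hT₂ ⊢
  nlinarith

end Spec

theorem time_le {n k d a D B S T : ℕ} (hn : 2 ≤ n) (hD : D ≤ n + 1)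
    (hB : B = (1 + n * D) ^ (k + 1) + n + D) (hS : S ≤ a * (B + 1) ^ d)
    (hT : T ≤ (k + 2) * (S + 6)) : T ≤ (a + 6) * n ^ (k + 2 + (3 * k + 6) * d) := by
  have h1 : 1 + n * D ≤ n ^ 3 := by
    have : n * D ≤ n * (n + 1) := Nat.mul_le_mul_left n hD
    nlinarith [Nat.mul_le_mul hn hn]
  have h2 : (1 + n * D) ^ (k + 1) ≤ n ^ (3 * k + 3) :=
    (Nat.pow_le_pow_left h1 _).trans_eq (by rw [← pow_mul]; ring_nf)
  have h3 : n ≤ n ^ (3 * k + 3) := Nat.le_self_pow (by omega) n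
  have h4 : 8 ≤ n ^ 3 := Nat.pow_le_pow_left hn 3
  have h5 : B + 1 ≤ n ^ (3 * k + 6) := by
    have : n ^ (3 * k + 6) = n ^ (3 * k + 3) * n ^ 3 := by ring
    nlinarith [Nat.mul_le_mul_left (n ^ (3 * k + 3)) h4]
  have h6 : (B + 1) ^ d ≤ n ^ ((3 * k + 6) * d) := by
    rw [pow_mul]
    exact Nat.pow_le_pow_left h5 d
  have h7 : k + 2 ≤ n ^ (k + 2) := (Nat.lt_pow_self hn).le
  have h8 : 1 ≤ n ^ ((3 * k + 6) * d) := Nat.one_le_pow _ _ (by omega)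
  have h9 : S + 6 ≤ (a + 6) * n ^ ((3 * k + 6) * d) := by
    nlinarith [Nat.mul_le_mul_left a h6]
  calc T ≤ n ^ (k + 2) * ((a + 6) * n ^ ((3 * k + 6) * d)) := hT.trans (Nat.mul_le_mul h7 h9)
    _ = _ := by ring

end LBCut

theorem corollary3 :
    ∃ (P : LBCut.Program) (f : ℕ → ℕ) (C : ℕ), Computable f ∧
      ∀ (k n : ℕ) (G : SimpleGraph (Fin n)) (s t : Fin n) (L : ℕ),
        LBCut.treeWidth G = k → s ≠ t →
          ∃ (T : ℕ) (τ : LBCut.State) (F : Finset (Sym2 (Fin n))),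
            LBCut.Runs P (LBCut.inputState G s t L) T τ ∧
            T ≤ C * n ^ f k ∧
            LBCut.OutputsEdgeSet τ F ∧
            LBCut.IsMinBoundedCut G s t L F := by
  obtain ⟨a, d, h⟩ := LBCut.Cmd.bnd_le (.seq LBCut.initCmd (.seq LBCut.extendCmd
    (.seq (.seq LBCut.componentsCmd LBCut.costCmd) LBCut.edgesCmd)))
  refine ⟨LBCut.mainProg, fun k => k + 2 + (3 * k + 6) * d, a + 6, ?_, ?_⟩
  · exact (Primrec.nat_add.comp (Primrec.nat_add.comp .id (.const 2)) (Primrec.nat_mul.comp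
      (Primrec.nat_add.comp (Primrec.nat_mul.comp (.const 3) .id) (.const 6)) (.const d))).to_comp
  · rintro k n G s t L rfl hst
    have hn : 2 ≤ n := by
      have := Fin.val_ne_of_ne hst
      omega
    obtain ⟨T, τ, F, h1, h2, h3⟩ := LBCut.runs_mainProg (G := G) (s := s) (t := t) (L := L) hst
      (B := (1 + n * LBCut.numLabels n L) ^ (LBCut.treeWidth G + 1) + n + LBCut.numLabels n L)
      (by omega) (by omega) (by omega)
    exact ⟨T, τ, F, h1, LBCut.time_le hn (by unfold LBCut.numLabels; omega) rfl (h _) h2, h3⟩
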